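/- Conventions. Fix a universe and let $\mathrm{Cat}$ be the 2-category of categories in it. A 2-category is a $\mathrm{Cat}$-enriched category (its objects may form a larger collection), and $\mathcal S$ is small if its objects, 1-cells and 2-cells lie in the universe. $[\mathcal S,\mathcal K]_{PS}$ is the 2-category of pseudofunctors $\mathcal S\to\mathcal K$, pseudonatural transformations and modifications; a pseudonatural equivalence $\simeq$ is an equivalence in such a 2-category. $(-)^{op}$ reverses 1-cells only. A pseudofunctor $R:\mathcal A\to\mathcal B$ is right biadjoint to $E:\mathcal B\to\mathcal A$ if there are pseudonatural transformations $\rho:\mathrm{Id}_{\mathcal B}\to RE$, $\varepsilon:ER\to\mathrm{Id}_{\mathcal A}$ and invertible modifications $v:\mathrm{id}_E\Rightarrow(\varepsilon E)(E\rho)$, $w:(R\varepsilon)(\rho R)\Rightarrow\mathrm{id}_R$ satisfying the two coherence (swallowtail) axioms: for every $x\in\mathcal B$ the pasting of $v_x$, $\rho_{\rho_x}^{-1}$ and $w_{Ex}$ is the identity of $\rho_x$, and for every $A\in\mathcal A$ the pasting of $v_{RA}$, $\varepsilon_{\varepsilon_A}^{-1}$ and $w_A$ is the identity of $\varepsilon_A$.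 $R$ is right biadjoint if it is right biadjoint to some $E$. For pseudofunctors $\mathcal W:\mathcal S\to\mathrm{Cat}$ and $\mathcal D:\mathcal S\to\mathcal K$, the weighted bilimit $\{\mathcal W,\mathcal D\}_{bi}$, if it exists, is an object of $\mathcal K$ with an equivalence $\mathcal K(X,\{\mathcal W,\mathcal D\}_{bi})\simeq[\mathcal S,\mathrm{Cat}]_{PS}(\mathcal W,\mathcal K(X,\mathcal D-))$ pseudonatural in $X$. For $\mathcal D:\mathcal S^{op}\to\mathcal A$, the weighted bicolimit $\mathcal W\ast_{bi}\mathcal D$, if it exists, is an object of $\mathcal A$ with an equivalence $\mathcal A(\mathcal W\ast_{bi}\mathcal D,X)\simeq[\mathcal S,\mathrm{Cat}]_{PS}(\mathcal W,\mathcal A(\mathcal D-,X))$ pseudonatural in $X$. Theorem. Let $\mathcal S$ be a small 2-category, $\mathcal A,\mathcal B,\mathcal C$ 2-categories, $\mathcal W:\mathcal S\to\mathrm{Cat}$ a pseudofunctor, $R:\mathcal A\to\mathcal B$ a right biadjoint pseudofunctor and $J:\mathcal A\to\mathcal C$ a pseudofunctor. Let $\mathcal S_0$ be the discrete 2-category on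 the objects of $\mathcal S$. Suppose that for each object $y$ of $\mathcal C$ there is given a pseudofunctor $\mathfrak D_y:\mathcal S\times\mathcal A\to\mathrm{Cat}$ such that (a) there are a pseudofunctor $\mathfrak D_y':\mathcal S_0\to\mathcal B^{op}$ and a pseudonatural equivalence between the restriction of $\mathfrak D_y$ to $\mathcal S_0\times\mathcal A$ and $\mathcal B(-,R-)\circ(\mathfrak D_y'\times\mathrm{Id}_{\mathcal A})$; (b) $\{\mathcal W,\mathfrak D_y(-,A)\}_{bi}\simeq\mathcal C(y,JA)$ pseudonaturally in $A\in\mathcal A$, that is, there is an equivalence $\mathrm{Cat}(X,\mathcal C(y,JA))\simeq[\mathcal S,\mathrm{Cat}]_{PS}(\mathcal W,\mathrm{Cat}(X,\mathfrak D_y(-,A)))$ pseudonatural in $X\in\mathrm{Cat}$ and $A\in\mathcal A$. Then for each object $y$ of $\mathcal C$ there are a pseudofunctor $\mathcal A_y:\mathcal S^{op}\to\mathcal A$ and a pseudonatural equivalence $\mathfrak D_y\simeq\mathcal A(\mathcal A_y-,-)$. Moreover, for any choice of pseudofunctors $\mathcal A_y$ with $\mathfrak D_y\simeq\mathcal A(\mathcal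 A_y-,-)$ for every $y$: $J$ is right biadjoint if and only if for every object $y$ of $\mathcal C$ the weighted bicolimit $\mathcal W\ast_{bi}\mathcal A_y$ exists in $\mathcal A$; and in this case, for any choice of objects $Gy=\mathcal W\ast_{bi}\mathcal A_y$, the assignment $y\mapsto Gy$ extends to a pseudofunctor $G:\mathcal C\to\mathcal A$ to which $J$ is right biadjoint. -/

import Mathlib

open CategoryTheory Bicategory Opposite
open scoped CategoryTheory.Pseudofunctor.StrongTrans

universe w₁ w₂ w₃ w₄ v₁ v₂ v₃ v₄ u₁ u₂ u₃ u₄ v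

namespace BiLift

/-! Conventions: composition of 1-cells is written in diagrammatic order. `B ⥤ᵖ C` is the type of
pseudofunctors; with the instances of `Pseudofunctor.StrongTrans` it is the bicategory
`[B, C]_PS` of pseudofunctors, pseudonatural transformations and modifications. A pseudonatural
equivalence `F ≃ G` is an equivalence (`Bicategory.Equivalence`) in that bicategory. -/

section
variable {B : Type u₁} [Bicategory.{w₁, v₁} B] {C : Type u₂}
    [Bicategory.{w₂, v₂} C] (F : B ⥤ᵖ C)

theorem map₂_associator_inv {a b c d : B} (f : a ⟶ b) (g : b ⟶ c) (h : c ⟶ d) :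
    F.map₂ (α_ f g h).inv = (F.mapComp f (g ≫ h)).hom ≫ F.map f ◁ (F.mapComp g h).hom ≫
      (α_ (F.map f) (F.map g) (F.map h)).inv ≫ (F.mapComp f g).inv ▷ F.map h ≫
      (F.mapComp (f ≫ g) h).inv := by
  rw [← cancel_epi (F.map₂ (α_ f g h).hom), ← F.map₂_comp]
  simp

theorem map_whiskerLeft_map₂ {a b c : B} (f : a ⟶ b) {g h : b ⟶ c} (η : g ⟶ h) :
    F.map f ◁ F.map₂ η = (F.mapComp f g).inv ≫ F.map₂ (f ◁ η) ≫ (F.mapComp f h).hom := by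
  simp

theorem map₂_whiskerRight_map {a b c : B} {f g : a ⟶ b} (η : f ⟶ g) (h : b ⟶ c) :
    F.map₂ η ▷ F.map h = (F.mapComp f h).inv ≫ F.map₂ (η ▷ h) ≫ (F.mapComp g h).hom := by
  simp

theorem map_whiskerLeft_mapComp_hom {a b c d : B} (f : a ⟶ b) (g : b ⟶ c) (h : c ⟶ d) :
    F.map f ◁ (F.mapComp g h).hom = (F.mapComp f (g ≫ h)).inv ≫ F.map₂ (α_ f g h).inv ≫
      (F.mapComp (f ≫ g) h).hom ≫ (F.mapComp f g).hom ▷ F.map h ≫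
      (α_ (F.map f) (F.map g) (F.map h)).hom := by
  simp [map₂_associator_inv]

theorem map_whiskerLeft_mapComp_inv {a b c d : B} (f : a ⟶ b) (g : b ⟶ c) (h : c ⟶ d) :
    F.map f ◁ (F.mapComp g h).inv = (α_ (F.map f) (F.map g) (F.map h)).inv ≫
      (F.mapComp f g).inv ▷ F.map h ≫ (F.mapComp (f ≫ g) h).inv ≫ F.map₂ (α_ f g h).hom ≫
      (F.mapComp f (g ≫ h)).hom := by
  simp
end

section Gen
variable {X : Type u₁} [Bicategory.{w₁, v₁} X] {K : Type u₂} [Bicategory.{w₂, v₂} K] (P : X ⥤ᵖ K)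

/-- The image of a square under a pseudofunctor. -/
def mapSquare {x y x' y' : X} {g : x ⟶ y} {g' : x' ⟶ y'} {t : x ⟶ x'} {t' : y ⟶ y'}
    (σ : g ≫ t' ≅ t ≫ g') : P.map g ≫ P.map t' ≅ P.map t ≫ P.map g' :=
  (P.mapComp g t').symm ≪≫ P.map₂Iso σ ≪≫ P.mapComp t g'

theorem mapSquare_naturality {x y x' y' : X} {g h : x ⟶ y} {g' h' : x' ⟶ y'} {t : x ⟶ x'}
    {t' : y ⟶ y'} (σ : g ≫ t' ≅ t ≫ g') (τ : h ≫ t' ≅ t ≫ h') (η : g ⟶ h) (η' : g' ⟶ h')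
    (H : η ▷ t' ≫ τ.hom = σ.hom ≫ t ◁ η') :
    P.map₂ η ▷ P.map t' ≫ (mapSquare P τ).hom = (mapSquare P σ).hom ≫ P.map t ◁ P.map₂ η' := by
  simp only [mapSquare, Iso.trans_hom, Iso.symm_hom, P.map₂Iso_hom, map₂_whiskerRight_map,
    map_whiskerLeft_map₂, Category.assoc, Iso.hom_inv_id_assoc]
  rw [← P.map₂_comp_assoc, ← P.map₂_comp_assoc, H]

theorem mapSquare_id {x x' : X} (t : x ⟶ x') {i : x ⟶ x} {i' : x' ⟶ x'} (c : i ⟶ 𝟙 x)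
    (c' : i' ⟶ 𝟙 x') (σ : i ≫ t ≅ t ≫ i')
    (H : σ.hom ≫ t ◁ c' = c ▷ t ≫ (λ_ t).hom ≫ (ρ_ t).inv) :
    (mapSquare P σ).hom ≫ P.map t ◁ (P.map₂ c' ≫ (P.mapId x').hom) =
      (P.map₂ c ≫ (P.mapId x).hom) ▷ P.map t ≫ (λ_ (P.map t)).hom ≫ (ρ_ (P.map t)).inv := by
  have h1 : P.map t ◁ (P.mapId x').hom =
      (P.mapComp t (𝟙 x')).inv ≫ P.map₂ (ρ_ t).hom ≫ (ρ_ (P.map t)).inv := by simp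
  have h2 : (P.mapId x).hom ▷ P.map t =
      (P.mapComp (𝟙 x) t).inv ≫ P.map₂ (λ_ t).hom ≫ (λ_ (P.map t)).inv := by simp
  simp only [mapSquare, Iso.trans_hom, Iso.symm_hom, P.map₂Iso_hom, h1, h2, Category.assoc,
    whiskerLeft_comp, comp_whiskerRight, map₂_whiskerRight_map, map_whiskerLeft_map₂,
    Iso.hom_inv_id_assoc, Iso.inv_hom_id_assoc]
  rw [← P.map₂_comp_assoc, H, ← P.map₂_comp_assoc, ← P.map₂_comp_assoc]
  simp only [Category.assoc, Iso.inv_hom_id, Category.comp_id]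

theorem mapSquare_comp {x y z x' y' z' : X} {g : x ⟶ y} {h : y ⟶ z} {k : x ⟶ z}
    {g' : x' ⟶ y'} {h' : y' ⟶ z'} {k' : x' ⟶ z'} {t : x ⟶ x'} {t' : y ⟶ y'} {t'' : z ⟶ z'}
    (c : k ⟶ g ≫ h) (c' : k' ⟶ g' ≫ h') (σ : g ≫ t' ≅ t ≫ g') (τ : h ≫ t'' ≅ t' ≫ h')
    (υ : k ≫ t'' ≅ t ≫ k')
    (H : υ.hom ≫ t ◁ c' = c ▷ t'' ≫ (α_ _ _ _).hom ≫ g ◁ τ.hom ≫ (α_ _ _ _).inv ≫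
      σ.hom ▷ h' ≫ (α_ _ _ _).hom) :
    (mapSquare P υ).hom ≫ P.map t ◁ (P.map₂ c' ≫ (P.mapComp g' h').hom) =
      (P.map₂ c ≫ (P.mapComp g h).hom) ▷ P.map t'' ≫ (α_ _ _ _).hom ≫
      P.map g ◁ (mapSquare P τ).hom ≫ (α_ _ _ _).inv ≫
      (mapSquare P σ).hom ▷ P.map h' ≫ (α_ _ _ _).hom := by
  have H' := congrArg P.map₂ H
  simp only [P.map₂_comp] at H'
  simp only [mapSquare, Iso.trans_hom, Iso.symm_hom, P.map₂Iso_hom, map₂_whiskerRight_map,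
    map_whiskerLeft_map₂, Category.assoc, Iso.hom_inv_id_assoc, whiskerLeft_comp,
    comp_whiskerRight, map_whiskerLeft_mapComp_hom, map_whiskerLeft_mapComp_inv,
    hom_inv_whiskerRight_assoc]
  rw [reassoc_of% H', ← P.map₂_comp_assoc (α_ t g' h').hom, Iso.hom_inv_id, P.map₂_id,
    Category.id_comp]

theorem mapSquare_modification {x y x' y' : X} {g : x ⟶ y} {g' : x' ⟶ y'} {t r : x ⟶ x'}
    {t' r' : y ⟶ y'} (σ : g ≫ t' ≅ t ≫ g') (τ : g ≫ r' ≅ r ≫ g') (β : t ⟶ r) (β' : t' ⟶ r')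
    (H : g ◁ β' ≫ τ.hom = σ.hom ≫ β ▷ g') :
    P.map g ◁ P.map₂ β' ≫ (mapSquare P τ).hom = (mapSquare P σ).hom ≫ P.map₂ β ▷ P.map g' := by
  simp only [mapSquare, Iso.trans_hom, Iso.symm_hom, P.map₂Iso_hom, map₂_whiskerRight_map,
    map_whiskerLeft_map₂, Category.assoc, Iso.hom_inv_id_assoc]
  rw [← P.map₂_comp_assoc, ← P.map₂_comp_assoc, H]

theorem mapSquare_mapId {x y : X} (g : x ⟶ y) (σ : g ≫ 𝟙 y ≅ 𝟙 x ≫ g)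
    (H : σ.hom = (ρ_ g).hom ≫ (λ_ g).inv) :
    P.map g ◁ (P.mapId y).hom ≫ (ρ_ (P.map g)).hom ≫ (λ_ (P.map g)).inv =
      (mapSquare P σ).hom ≫ (P.mapId x).hom ▷ P.map g := by
  have h1 : P.map g ◁ (P.mapId y).hom =
      (P.mapComp g (𝟙 y)).inv ≫ P.map₂ (ρ_ g).hom ≫ (ρ_ (P.map g)).inv := by simp
  have h2 : (P.mapId x).hom ▷ P.map g =
      (P.mapComp (𝟙 x) g).inv ≫ P.map₂ (λ_ g).hom ≫ (λ_ (P.map g)).inv := by simp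
  simp only [mapSquare, Iso.trans_hom, Iso.symm_hom, P.map₂Iso_hom, H, h1, h2, Category.assoc,
    Iso.hom_inv_id_assoc, Iso.inv_hom_id_assoc]
  rw [← P.map₂_comp_assoc, Category.assoc, Iso.inv_hom_id, Category.comp_id]

theorem mapSquare_mapComp {x y x' y' x'' y'' : X} {g : x ⟶ y} {g' : x' ⟶ y'} {g'' : x'' ⟶ y''}
    {t : x ⟶ x'} {r : x' ⟶ x''} {t' : y ⟶ y'} {r' : y' ⟶ y''} {k : x ⟶ x''} {k' : y ⟶ y''}
    (σ : g ≫ t' ≅ t ≫ g') (τ : g' ≫ r' ≅ r ≫ g'') (υ : g ≫ k' ≅ k ≫ g'')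
    (c : k ⟶ t ≫ r) (c' : k' ⟶ t' ≫ r')
    (H : g ◁ c' ≫ (α_ _ _ _).inv ≫ σ.hom ▷ r' ≫ (α_ _ _ _).hom ≫ t ◁ τ.hom ≫ (α_ _ _ _).inv =
      υ.hom ≫ c ▷ g'') :
    P.map g ◁ (P.map₂ c' ≫ (P.mapComp t' r').hom) ≫ (α_ _ _ _).inv ≫ (mapSquare P σ).hom ▷ P.map r' ≫
      (α_ _ _ _).hom ≫ P.map t ◁ (mapSquare P τ).hom ≫ (α_ _ _ _).inv =
      (mapSquare P υ).hom ≫ (P.map₂ c ≫ (P.mapComp t r).hom) ▷ P.map g'' := by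
  have H' := congrArg P.map₂ H
  simp only [P.map₂_comp] at H'
  simp only [mapSquare, Iso.trans_hom, Iso.symm_hom, P.map₂Iso_hom, map₂_whiskerRight_map,
    map_whiskerLeft_map₂, Category.assoc, Iso.hom_inv_id_assoc, whiskerLeft_comp,
    comp_whiskerRight, map_whiskerLeft_mapComp_hom, map_whiskerLeft_mapComp_inv,
    hom_inv_whiskerRight_assoc]
  rw [← reassoc_of% H']
  simp
end Gen

section Curry
open CategoryTheory.Prod
variable {S : Type u₁} [Bicategory.{w₁, v₁} S] {A : Type u₂} [Bicategory.{w₂, v₂} A]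
  {K : Type u₃} [Bicategory.{w₃, v₃} K] (P : S × A ⥤ᵖ K)

/-- The pseudofunctor `P(-, a)`. -/
def slice (a : A) : S ⥤ᵖ K := (Bicategory.Prod.sectL S a).toPseudofunctor.comp P

/-- The pseudofunctor `P(s, -)`. -/
def sliceRight (s : S) : A ⥤ᵖ K := (Bicategory.Prod.sectR s A).toPseudofunctor.comp P

/-- The canonical isomorphism `(g, 1) ≫ (1, f) ≅ (1, f) ≫ (g, 1)`; both sides are `(g, f)` up to
unitors. -/
def interchange {s t : S} {a b : A} (g : s ⟶ t) (f : a ⟶ b) :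
    (g ×ₘ 𝟙 a) ≫ (𝟙 t ×ₘ f) ≅ (𝟙 s ×ₘ f) ≫ (g ×ₘ 𝟙 b) :=
  Iso.prod (ρ_ g ≪≫ (λ_ g).symm) (λ_ f ≪≫ (ρ_ f).symm)

theorem sliceRight_mapId_hom (s : S) (a : A) :
    ((sliceRight P s).mapId a).hom = (P.mapId (s, a)).hom := by
  change P.map₂ (𝟙 _) ≫ _ = _
  rw [P.map₂_id]; exact Category.id_comp _

/-- The pseudonatural transformation `P(-, f) : P(-, a) ⟶ P(-, b)`. -/
def sliceTrans {a b : A} (f : a ⟶ b) : slice P a ⟶ slice P b where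
  app s := P.map (𝟙 s ×ₘ f)
  naturality g := mapSquare P (interchange g f)
  naturality_naturality {s t g h} η := by
    have h1 : η ▷ 𝟙 t ≫ (ρ_ h).hom ≫ (λ_ h).inv = ((ρ_ g).hom ≫ (λ_ g).inv) ≫ 𝟙 s ◁ η := by
      simp
    have h2 : 𝟙 (𝟙 a) ▷ f ≫ (λ_ f).hom ≫ (ρ_ f).inv =
        ((λ_ f).hom ≫ (ρ_ f).inv) ≫ f ◁ 𝟙 (𝟙 b) := by simp
    exact mapSquare_naturality P (interchange g f) (interchange h f) (η ×ₘ 𝟙 (𝟙 a))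
      (η ×ₘ 𝟙 (𝟙 b)) (Prod.ext h1 h2)
  naturality_id s := by
    have h1 : ((ρ_ (𝟙 s)).hom ≫ (λ_ (𝟙 s)).inv) ≫ 𝟙 s ◁ 𝟙 (𝟙 s) =
        𝟙 (𝟙 s) ▷ 𝟙 s ≫ (λ_ (𝟙 s)).hom ≫ (ρ_ (𝟙 s)).inv := by simp [unitors_equal]
    have h2 : ((λ_ f).hom ≫ (ρ_ f).inv) ≫ f ◁ 𝟙 (𝟙 b) =
        𝟙 (𝟙 a) ▷ f ≫ (λ_ f).hom ≫ (ρ_ f).inv := by simp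
    exact mapSquare_id P (𝟙 s ×ₘ f) (𝟙 (𝟙 (s, a))) (𝟙 (𝟙 (s, b))) (interchange (𝟙 s) f)
      (Prod.ext h1 h2)
  naturality_comp {s t r} g h := by
    have h1 : ((ρ_ (g ≫ h)).hom ≫ (λ_ (g ≫ h)).inv) ≫ 𝟙 s ◁ 𝟙 (g ≫ h) =
      𝟙 (g ≫ h) ▷ 𝟙 r ≫ (α_ _ _ _).hom ≫ g ◁ ((ρ_ h).hom ≫ (λ_ h).inv) ≫ (α_ _ _ _).inv ≫
        ((ρ_ g).hom ≫ (λ_ g).inv) ▷ h ≫ (α_ _ _ _).hom := by simp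
    have h2 : ((λ_ f).hom ≫ (ρ_ f).inv) ≫ f ◁ (λ_ (𝟙 b)).inv =
      (λ_ (𝟙 a)).inv ▷ f ≫ (α_ _ _ _).hom ≫ 𝟙 a ◁ ((λ_ f).hom ≫ (ρ_ f).inv) ≫ (α_ _ _ _).inv ≫
        ((λ_ f).hom ≫ (ρ_ f).inv) ▷ 𝟙 b ≫ (α_ _ _ _).hom := by bicategory
    exact mapSquare_comp P
      ((𝟙 (g ≫ h), (λ_ (𝟙 a)).inv) : ((g ≫ h) ×ₘ 𝟙 a) ⟶ (g ×ₘ 𝟙 a) ≫ (h ×ₘ 𝟙 a))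
      ((𝟙 (g ≫ h), (λ_ (𝟙 b)).inv) : ((g ≫ h) ×ₘ 𝟙 b) ⟶ (g ×ₘ 𝟙 b) ≫ (h ×ₘ 𝟙 b))
      (interchange g f) (interchange h f) (interchange (g ≫ h) f) (Prod.ext h1 h2)

/-- The modification `P(-, η) : P(-, f) ⟶ P(-, g)`. -/
def sliceModification {a b : A} {f g : a ⟶ b} (η : f ⟶ g) : sliceTrans P f ⟶ sliceTrans P g where
  as :=
    { app := fun s => P.map₂ (𝟙 (𝟙 s) ×ₘ η)
      naturality := fun {s t} k => by
        have h1 : k ◁ 𝟙 (𝟙 t) ≫ (ρ_ k).hom ≫ (λ_ k).inv =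
          ((ρ_ k).hom ≫ (λ_ k).inv) ≫ 𝟙 (𝟙 s) ▷ k := by simp
        have h2 : 𝟙 a ◁ η ≫ (λ_ g).hom ≫ (ρ_ g).inv = ((λ_ f).hom ≫ (ρ_ f).inv) ≫ η ▷ 𝟙 b := by
          simp
        exact mapSquare_modification P (interchange k f) (interchange k g) (𝟙 (𝟙 s) ×ₘ η)
          (𝟙 (𝟙 t) ×ₘ η) (Prod.ext h1 h2) }

/-- The pseudofunctor `a ↦ P(-, a)` into `[S, K]_PS`. -/
def curry : A ⥤ᵖ (S ⥤ᵖ K) where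
  obj a := slice P a
  map f := sliceTrans P f
  map₂ η := sliceModification P η
  map₂_id f := Pseudofunctor.StrongTrans.homCategory.ext fun s => (sliceRight P s).map₂_id f
  map₂_comp η θ := Pseudofunctor.StrongTrans.homCategory.ext fun s =>
    (sliceRight P s).map₂_comp η θ
  mapId a := Pseudofunctor.StrongTrans.isoMk (fun s => (sliceRight P s).mapId a) (by
    intro s t g
    rw [sliceRight_mapId_hom, sliceRight_mapId_hom]
    exact mapSquare_mapId P (g ×ₘ 𝟙 a) (interchange g (𝟙 a)) (Prod.ext rfl (by
        change (λ_ (𝟙 a)).hom ≫ (ρ_ (𝟙 a)).inv = (ρ_ (𝟙 a)).hom ≫ (λ_ (𝟙 a)).inv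
        simp [unitors_equal])))
  mapComp {a b c} f g := Pseudofunctor.StrongTrans.isoMk
    (fun s => (sliceRight P s).mapComp f g) (by
    intro s t k
    have h1 : k ◁ (ρ_ (𝟙 t)).inv ≫ (α_ _ _ _).inv ≫ ((ρ_ k).hom ≫ (λ_ k).inv) ▷ 𝟙 t ≫
        (α_ _ _ _).hom ≫ 𝟙 s ◁ ((ρ_ k).hom ≫ (λ_ k).inv) ≫ (α_ _ _ _).inv =
      ((ρ_ k).hom ≫ (λ_ k).inv) ≫ (ρ_ (𝟙 s)).inv ▷ k := by bicategory
    have h2 : 𝟙 a ◁ 𝟙 (f ≫ g) ≫ (α_ _ _ _).inv ≫ ((λ_ f).hom ≫ (ρ_ f).inv) ▷ g ≫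
        (α_ _ _ _).hom ≫ f ◁ ((λ_ g).hom ≫ (ρ_ g).inv) ≫ (α_ _ _ _).inv =
      ((λ_ (f ≫ g)).hom ≫ (ρ_ (f ≫ g)).inv) ≫ 𝟙 (f ≫ g) ▷ 𝟙 c := by bicategory
    exact mapSquare_mapComp P (interchange k f) (interchange k g) (interchange k (f ≫ g))
      (((ρ_ (𝟙 s)).inv, 𝟙 (f ≫ g)) : (𝟙 s ×ₘ (f ≫ g)) ⟶ (𝟙 s ×ₘ f) ≫ (𝟙 s ×ₘ g))
      (((ρ_ (𝟙 t)).inv, 𝟙 (f ≫ g)) : (𝟙 t ×ₘ (f ≫ g)) ⟶ (𝟙 t ×ₘ f) ≫ (𝟙 t ×ₘ g)) (Prod.ext h1 h2))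
  map₂_whisker_left f _ _ η := Pseudofunctor.StrongTrans.homCategory.ext fun s =>
    (sliceRight P s).map₂_whisker_left f η
  map₂_whisker_right η h := Pseudofunctor.StrongTrans.homCategory.ext fun s =>
    (sliceRight P s).map₂_whisker_right η h
  map₂_associator f g h := Pseudofunctor.StrongTrans.homCategory.ext fun s =>
    (sliceRight P s).map₂_associator f g h
  map₂_left_unitor f := Pseudofunctor.StrongTrans.homCategory.ext fun s =>
    (sliceRight P s).map₂_left_unitor f
  map₂_right_unitor f := Pseudofunctor.StrongTrans.homCategory.ext fun s =>
    (sliceRight P s).map₂_right_unitor f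

end Curry

section Prod
variable {B : Type u₁} [Bicategory.{w₁, v₁} B] {B' : Type u₂} [Bicategory.{w₂, v₂} B']
  {C : Type u₃} [Bicategory.{w₃, v₃} C] {C' : Type u₄} [Bicategory.{w₄, v₄} C']

/-- The product `F × G : B × C → B' × C'` of two pseudofunctors. -/
def prodMap (F : B ⥤ᵖ B') (G : C ⥤ᵖ C') : B × C ⥤ᵖ B' × C' where
  obj x := (F.obj x.1, G.obj x.2)
  map f := (F.map f.1, G.map f.2)
  map₂ η := (F.map₂ η.1, G.map₂ η.2)
  map₂_id f := Prod.ext (F.map₂_id f.1) (G.map₂_id f.2)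
  map₂_comp η θ := Prod.ext (F.map₂_comp η.1 θ.1) (G.map₂_comp η.2 θ.2)
  mapId x := Iso.prod (F.mapId x.1) (G.mapId x.2)
  mapComp f g := Iso.prod (F.mapComp f.1 g.1) (G.mapComp f.2 g.2)
  map₂_whisker_left f _ _ η :=
    Prod.ext (F.map₂_whisker_left f.1 η.1) (G.map₂_whisker_left f.2 η.2)
  map₂_whisker_right η h :=
    Prod.ext (F.map₂_whisker_right η.1 h.1) (G.map₂_whisker_right η.2 h.2)
  map₂_associator f g h :=
    Prod.ext (F.map₂_associator f.1 g.1 h.1) (G.map₂_associator f.2 g.2 h.2)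
  map₂_left_unitor f := Prod.ext (F.map₂_left_unitor f.1) (G.map₂_left_unitor f.2)
  map₂_right_unitor f := Prod.ext (F.map₂_right_unitor f.1) (G.map₂_right_unitor f.2)

/-- The strict rearrangement `(s, (x, a)) ↦ (x, (s, a))`. -/
def prodExchange (S : Type u₁) [Bicategory.{w₁, v₁} S] (X : Type u₂) [Bicategory.{w₂, v₂} X]
    (A : Type u₃) [Bicategory.{w₃, v₃} A] : S × (X × A) ⥤ᵖ X × (S × A) where
  obj p := (p.2.1, (p.1, p.2.2))
  map f := (f.2.1, (f.1, f.2.2))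
  map₂ η := (η.2.1, (η.1, η.2.2))
  map₂_id _ := rfl
  map₂_comp _ _ := rfl
  mapId _ := Iso.refl _
  mapComp _ _ := Iso.refl _

end Prod

section Op
variable {S : Type u₁} [Bicategory.{w₁, v₁} S] {A : Type u₂} [Bicategory.{w₂, v₂} A]
open Bicategory.Opposite

/-- A pseudofunctor `Sᵒᵖ → A` regarded as a pseudofunctor `S → Aᵒᵖ` (1-cell duals). -/
def rightOp (F : Sᵒᵖ ⥤ᵖ A) : S ⥤ᵖ Aᵒᵖ where
  obj s := op (F.obj (op s))
  map f := (F.map f.op).op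
  map₂ η := op2 (F.map₂ (op2 η))
  map₂_id f := congrArg op2 (F.map₂_id f.op)
  map₂_comp η θ := congrArg op2 (F.map₂_comp (op2 η) (op2 θ))
  mapId s := (F.mapId (op s)).op2
  mapComp f g := (F.mapComp g.op f.op).op2
  map₂_whisker_left f _ _ η := congrArg op2 (F.map₂_whisker_right (op2 η) f.op)
  map₂_whisker_right η h := congrArg op2 (F.map₂_whisker_left h.op (op2 η))
  map₂_associator f g h := congrArg op2 (map₂_associator_inv F h.op g.op f.op)
  map₂_left_unitor f := congrArg op2 (F.map₂_right_unitor f.op)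
  map₂_right_unitor f := congrArg op2 (F.map₂_left_unitor f.op)
end Op

section Discrete
/-- The inclusion into `S` of the discrete 2-category on the objects of `S`. -/
def discreteInclusion (S : Type u₁) [Bicategory.{w₁, v₁} S] :
    LocallyDiscrete (Discrete S) ⥤ᵖ S :=
  pseudofunctorOfIsLocallyDiscrete (fun s => s.as.as)
    (fun f => eqToHom (Discrete.eq_of_hom f.as))
    (fun s => Iso.refl _)
    (fun f g => eqToHomTransIso _ _)
    (by
      rintro ⟨⟨a⟩⟩ ⟨⟨b⟩⟩ ⟨⟨c⟩⟩ ⟨⟨d⟩⟩ ⟨⟨⟨h⟩⟩⟩ ⟨⟨⟨h'⟩⟩⟩ ⟨⟨⟨h''⟩⟩⟩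
      dsimp at h h' h''
      subst h h' h''
      change (λ_ (𝟙 a)).inv ≫ (λ_ (𝟙 a)).inv ▷ 𝟙 a ≫ (α_ (𝟙 a) (𝟙 a) (𝟙 a)).hom ≫
        𝟙 a ◁ (λ_ (𝟙 a)).hom ≫ (λ_ (𝟙 a)).hom = 𝟙 (𝟙 a)
      simp)
    (by
      rintro ⟨⟨a⟩⟩ ⟨⟨b⟩⟩ ⟨⟨⟨h⟩⟩⟩
      dsimp at h
      subst h
      change (λ_ (𝟙 a)).inv ≫ 𝟙 (𝟙 a) ▷ 𝟙 a ≫ (λ_ (𝟙 a)).hom = 𝟙 (𝟙 a)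
      simp)
    (by
      rintro ⟨⟨a⟩⟩ ⟨⟨b⟩⟩ ⟨⟨⟨h⟩⟩⟩
      dsimp at h
      subst h
      change (λ_ (𝟙 a)).inv ≫ 𝟙 a ◁ 𝟙 (𝟙 a) ≫ (ρ_ (𝟙 a)).hom = 𝟙 (𝟙 a)
      simp)
end Discrete

section Hom
variable {B : Type u₁} [Bicategory.{w₁, v₁} B]

theorem cat_hom₂_ext {C D : Cat.{v₁, u₁}} {F G : C ⟶ D} {η θ : F ⟶ G}
    (h : ∀ X, η.toNatTrans.app X = θ.toNatTrans.app X) : η = θ :=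
  Cat.Hom₂.ext (NatTrans.ext (funext h))

/-- The covariant hom pseudofunctor `B(x, -) : B → Cat`. -/
def corep (x : B) : B ⥤ᵖ Cat.{w₁, v₁} where
  obj y := Cat.of (x ⟶ y)
  map g := (postcomp x g).toCatHom
  map₂ η := NatTrans.toCatHom₂ ((postcomposing x _ _).map η)
  map₂_id g := cat_hom₂_ext fun (h : x ⟶ _) => whiskerLeft_id h g
  map₂_comp η θ := cat_hom₂_ext fun (h : x ⟶ _) => whiskerLeft_comp h η θ
  mapId y := rightUnitorNatIsoCat x y
  mapComp g h := (associatorNatIsoLeftCat x g h).symm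
  map₂_whisker_left f g h η := cat_hom₂_ext fun (k : x ⟶ _) => by
    change k ◁ f ◁ η = (α_ k f g).inv ≫ (k ≫ f) ◁ η ≫ (α_ k f h).hom
    simp
  map₂_whisker_right {_ _ _ f g} η h := cat_hom₂_ext fun (k : x ⟶ _) => by
    change k ◁ η ▷ h = (α_ k f h).inv ≫ (k ◁ η) ▷ h ≫ (α_ k g h).hom
    simp
  map₂_associator f g h := cat_hom₂_ext fun (k : x ⟶ _) => by
    change k ◁ (α_ f g h).hom = (α_ k (f ≫ g) h).inv ≫ (α_ k f g).inv ▷ h ≫ 𝟙 _ ≫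
      (α_ (k ≫ f) g h).hom ≫ (α_ k f (g ≫ h)).hom
    simp
  map₂_left_unitor f := cat_hom₂_ext fun (k : x ⟶ _) => by
    change k ◁ (λ_ f).hom = (α_ k (𝟙 _) f).inv ≫ (ρ_ k).hom ▷ f ≫ 𝟙 _
    simp
  map₂_right_unitor f := cat_hom₂_ext fun (k : x ⟶ _) => by
    change k ◁ (ρ_ f).hom = (α_ k f (𝟙 _)).inv ≫ (ρ_ (k ≫ f)).hom ≫ 𝟙 _
    simp

variable (B) in
/-- The hom pseudofunctor `B(-, -) : Bᵒᵖ × B → Cat`, acting on 1-cells by `h ↦ f ≫ h ≫ g`. -/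
def homPseudofunctor : Bᵒᵖ × B ⥤ᵖ Cat.{w₁, v₁} where
  obj p := Cat.of (p.1.unop ⟶ p.2)
  map {p q} f := Functor.toCatHom
    { obj := fun h => f.1.unop ≫ h ≫ f.2
      map := fun η => f.1.unop ◁ η ▷ f.2 }
  map₂ {p q f g} η := NatTrans.toCatHom₂
    { app := fun h => η.1.unop2 ▷ (h ≫ f.2) ≫ g.1.unop ◁ h ◁ η.2
      naturality := fun h k θ => by
        dsimp only
        rw [whisker_exchange_assoc, Category.assoc, ← whiskerLeft_comp, ← whiskerLeft_comp,
          whisker_exchange] }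
  map₂_id {p q} f := cat_hom₂_ext fun (h : p.1.unop ⟶ p.2) => by
    change 𝟙 f.1.unop ▷ (h ≫ f.2) ≫ f.1.unop ◁ h ◁ 𝟙 f.2 = 𝟙 (f.1.unop ≫ h ≫ f.2)
    simp
  map₂_comp {p q f g k} η θ := cat_hom₂_ext fun (h : p.1.unop ⟶ p.2) => by
    change (η.1.unop2 ≫ θ.1.unop2) ▷ (h ≫ f.2) ≫ k.1.unop ◁ h ◁ (η.2 ≫ θ.2) =
      (η.1.unop2 ▷ (h ≫ f.2) ≫ g.1.unop ◁ h ◁ η.2) ≫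
        (θ.1.unop2 ▷ (h ≫ g.2) ≫ k.1.unop ◁ h ◁ θ.2)
    simp only [comp_whiskerRight, whiskerLeft_comp, Category.assoc]
    rw [whisker_exchange_assoc]
  mapId p := Cat.Hom.isoMk (NatIso.ofComponents
    (fun h => λ_ (h ≫ 𝟙 p.2) ≪≫ ρ_ h) (by
      intro (h : p.1.unop ⟶ p.2) (k : p.1.unop ⟶ p.2) θ
      change (𝟙 _ ◁ θ ▷ 𝟙 _) ≫ (λ_ (k ≫ 𝟙 p.2)).hom ≫ (ρ_ k).hom =
        ((λ_ (h ≫ 𝟙 p.2)).hom ≫ (ρ_ h).hom) ≫ θ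
      bicategory))
  mapComp {p q r} f g := Cat.Hom.isoMk (NatIso.ofComponents
    (fun h => α_ g.1.unop f.1.unop (h ≫ f.2 ≫ g.2) ≪≫
      whiskerLeftIso g.1.unop ((whiskerLeftIso f.1.unop (α_ h f.2 g.2).symm) ≪≫
        (α_ f.1.unop (h ≫ f.2) g.2).symm)) (by
      intro (h : p.1.unop ⟶ p.2) (k : p.1.unop ⟶ p.2) θ
      change (g.1.unop ≫ f.1.unop) ◁ θ ▷ (f.2 ≫ g.2) ≫
          (α_ g.1.unop f.1.unop (k ≫ f.2 ≫ g.2)).hom ≫ g.1.unop ◁ (f.1.unop ◁ (α_ k f.2 g.2).inv ≫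
            (α_ f.1.unop (k ≫ f.2) g.2).inv) =
        ((α_ g.1.unop f.1.unop (h ≫ f.2 ≫ g.2)).hom ≫
          g.1.unop ◁ (f.1.unop ◁ (α_ h f.2 g.2).inv ≫
            (α_ f.1.unop (h ≫ f.2) g.2).inv)) ≫ g.1.unop ◁ (f.1.unop ◁ θ ▷ f.2) ▷ g.2
      simp))
  map₂_whisker_left {p q r} f g h η := cat_hom₂_ext fun (k : p.1.unop ⟶ p.2) => by
    change (η.1.unop2 ▷ f.1.unop) ▷ (k ≫ f.2 ≫ g.2) ≫ (h.1.unop ≫ f.1.unop) ◁ k ◁ f.2 ◁ η.2 =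
      ((α_ g.1.unop f.1.unop (k ≫ f.2 ≫ g.2)).hom ≫ g.1.unop ◁ (f.1.unop ◁ (α_ k f.2 g.2).inv ≫
            (α_ f.1.unop (k ≫ f.2) g.2).inv)) ≫
      (η.1.unop2 ▷ ((f.1.unop ≫ k ≫ f.2) ≫ g.2) ≫ h.1.unop ◁ (f.1.unop ≫ k ≫ f.2) ◁ η.2) ≫
      (h.1.unop ◁ ((α_ f.1.unop (k ≫ f.2) h.2).hom ≫ f.1.unop ◁ (α_ k f.2 h.2).hom) ≫
        (α_ h.1.unop f.1.unop (k ≫ f.2 ≫ h.2)).inv)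
    bicategory
  map₂_whisker_right {p q r f g} η h := cat_hom₂_ext fun (k : p.1.unop ⟶ p.2) => by
    change (h.1.unop ◁ η.1.unop2) ▷ (k ≫ f.2 ≫ h.2) ≫ (h.1.unop ≫ g.1.unop) ◁ k ◁ η.2 ▷ h.2 =
      ((α_ h.1.unop f.1.unop (k ≫ f.2 ≫ h.2)).hom ≫ h.1.unop ◁ (f.1.unop ◁ (α_ k f.2 h.2).inv ≫
            (α_ f.1.unop (k ≫ f.2) h.2).inv)) ≫
      (h.1.unop ◁ (η.1.unop2 ▷ (k ≫ f.2) ≫ g.1.unop ◁ k ◁ η.2) ▷ h.2) ≫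
      (h.1.unop ◁ ((α_ g.1.unop (k ≫ g.2) h.2).hom ≫ g.1.unop ◁ (α_ k g.2 h.2).hom) ≫
        (α_ h.1.unop g.1.unop (k ≫ g.2 ≫ h.2)).inv)
    bicategory
  map₂_associator {p q r s} f g h := cat_hom₂_ext fun (k : p.1.unop ⟶ p.2) => by
    obtain ⟨f₁, f₂⟩ := f
    obtain ⟨g₁, g₂⟩ := g
    obtain ⟨h₁, h₂⟩ := h
    change (α_ h₁.unop g₁.unop f₁.unop).inv ▷ (k ≫ (f₂ ≫ g₂) ≫ h₂) ≫
        ((h₁.unop ≫ g₁.unop) ≫ f₁.unop) ◁ k ◁ (α_ f₂ g₂ h₂).hom =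
      ((α_ h₁.unop (g₁.unop ≫ f₁.unop) (k ≫ (f₂ ≫ g₂) ≫ h₂)).hom ≫
        h₁.unop ◁ ((g₁.unop ≫ f₁.unop) ◁ (α_ k (f₂ ≫ g₂) h₂).inv ≫
          (α_ (g₁.unop ≫ f₁.unop) (k ≫ f₂ ≫ g₂) h₂).inv)) ≫
      (h₁.unop ◁ ((α_ g₁.unop f₁.unop (k ≫ f₂ ≫ g₂)).hom ≫
        g₁.unop ◁ (f₁.unop ◁ (α_ k f₂ g₂).inv ≫ (α_ f₁.unop (k ≫ f₂) g₂).inv)) ▷ h₂) ≫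
      𝟙 _ ≫
      (h₁.unop ◁ ((α_ g₁.unop ((f₁.unop ≫ k ≫ f₂) ≫ g₂) h₂).hom ≫
        g₁.unop ◁ (α_ (f₁.unop ≫ k ≫ f₂) g₂ h₂).hom) ≫
        (α_ h₁.unop g₁.unop ((f₁.unop ≫ k ≫ f₂) ≫ g₂ ≫ h₂)).inv) ≫
      ((h₁.unop ≫ g₁.unop) ◁ ((α_ f₁.unop (k ≫ f₂) (g₂ ≫ h₂)).hom ≫
        f₁.unop ◁ (α_ k f₂ (g₂ ≫ h₂)).hom) ≫
        (α_ (h₁.unop ≫ g₁.unop) f₁.unop (k ≫ f₂ ≫ g₂ ≫ h₂)).inv)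
    bicategory
  map₂_left_unitor {p q} f := cat_hom₂_ext fun (k : p.1.unop ⟶ p.2) => by
    obtain ⟨f₁, f₂⟩ := f
    change (ρ_ f₁.unop).hom ▷ (k ≫ 𝟙 _ ≫ f₂) ≫ f₁.unop ◁ k ◁ (λ_ f₂).hom =
      ((α_ f₁.unop (𝟙 _) (k ≫ 𝟙 _ ≫ f₂)).hom ≫
        f₁.unop ◁ ((𝟙 _) ◁ (α_ k (𝟙 _) f₂).inv ≫ (α_ (𝟙 _) (k ≫ 𝟙 _) f₂).inv)) ≫
      f₁.unop ◁ ((λ_ (k ≫ 𝟙 _)).hom ≫ (ρ_ k).hom) ▷ f₂ ≫ 𝟙 _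
    bicategory
  map₂_right_unitor {p q} f := cat_hom₂_ext fun (k : p.1.unop ⟶ p.2) => by
    obtain ⟨f₁, f₂⟩ := f
    change (λ_ f₁.unop).hom ▷ (k ≫ f₂ ≫ 𝟙 _) ≫ f₁.unop ◁ k ◁ (ρ_ f₂).hom =
      ((α_ (𝟙 _) f₁.unop (k ≫ f₂ ≫ 𝟙 _)).hom ≫
        (𝟙 _) ◁ (f₁.unop ◁ (α_ k f₂ (𝟙 _)).inv ≫ (α_ f₁.unop (k ≫ f₂) (𝟙 _)).inv)) ≫
      ((λ_ ((f₁.unop ≫ k ≫ f₂) ≫ 𝟙 _)).hom ≫ (ρ_ (f₁.unop ≫ k ≫ f₂)).hom) ≫ 𝟙 _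
    bicategory

end Hom


section Whisker
variable {X : Type u₁} [Bicategory.{w₁, v₁} X] {Y : Type u₂} [Bicategory.{w₂, v₂} Y]
  {Z : Type u₃} [Bicategory.{w₃, v₃} Z]

/-- The whiskering `η F` of a pseudonatural transformation `η : G ⟶ H` with `F`. -/
def preWhisker (F : X ⥤ᵖ Y) {G H : Y ⥤ᵖ Z} (η : G ⟶ H) : F.comp G ⟶ F.comp H where
  app x := η.app (F.obj x)
  naturality f := η.naturality (F.map f)
  naturality_naturality θ := η.naturality_naturality (F.map₂ θ)
  naturality_id x := by
    change (η.naturality (F.map (𝟙 x))).hom ≫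
        η.app (F.obj x) ◁ (H.map₂ (F.mapId x).hom ≫ (H.mapId (F.obj x)).hom) =
      (G.map₂ (F.mapId x).hom ≫ (G.mapId (F.obj x)).hom) ▷ η.app (F.obj x) ≫
        (λ_ (η.app (F.obj x))).hom ≫ (ρ_ (η.app (F.obj x))).inv
    rw [whiskerLeft_comp, ← η.naturality_naturality_assoc, η.naturality_id, comp_whiskerRight,
      Category.assoc]
  naturality_comp {x y z} f g := by
    change (η.naturality (F.map (f ≫ g))).hom ≫ η.app (F.obj x) ◁ (H.map₂ (F.mapComp f g).hom ≫
        (H.mapComp (F.map f) (F.map g)).hom) =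
      (G.map₂ (F.mapComp f g).hom ≫ (G.mapComp (F.map f) (F.map g)).hom) ▷ η.app (F.obj z) ≫
        (α_ _ _ _).hom ≫ G.map (F.map f) ◁ (η.naturality (F.map g)).hom ≫ (α_ _ _ _).inv ≫
        (η.naturality (F.map f)).hom ▷ H.map (F.map g) ≫ (α_ _ _ _).hom
    rw [whiskerLeft_comp, ← η.naturality_naturality_assoc, η.naturality_comp, comp_whiskerRight,
      Category.assoc]
end Whisker

section Biadjunction
variable {A : Type u₁} [Bicategory.{w₁, v₁} A] {B : Type u₂} [Bicategory.{w₂, v₂} B]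
  {E : B ⥤ᵖ A} {R : A ⥤ᵖ B}

/-- For `η : 1 ⟶ R E`, the whiskering `E η : E ⟶ E R E`. -/
def unitPost (η : Pseudofunctor.id B ⟶ E.comp R) : E ⟶ E.comp (R.comp E) where
  app x := E.map (η.app x)
  naturality f := mapSquare E (η.naturality f)
  naturality_naturality {x y f g} θ :=
    mapSquare_naturality E (η.naturality f) (η.naturality g) θ (R.map₂ (E.map₂ θ))
      (η.naturality_naturality θ)
  naturality_id x := by
    have h1 : (E.mapId x).hom = E.map₂ (𝟙 (𝟙 x)) ≫ (E.mapId x).hom := by simp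
    have h2 : ((E.comp (R.comp E)).mapId x).hom =
        E.map₂ ((E.comp R).mapId x).hom ≫ (E.mapId (R.obj (E.obj x))).hom :=
      (E.map₂_comp_assoc (R.map₂ (E.mapId x).hom) (R.mapId (E.obj x)).hom _).symm
    rw [h1, h2]
    exact mapSquare_id E (η.app x) (𝟙 (𝟙 x)) ((E.comp R).mapId x).hom (η.naturality (𝟙 x))
      (η.naturality_id x)
  naturality_comp {x y z} f g := by
    have h1 : (E.mapComp f g).hom = E.map₂ (𝟙 (f ≫ g)) ≫ (E.mapComp f g).hom := by simp
    have h2 : ((E.comp (R.comp E)).mapComp f g).hom =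
        E.map₂ ((E.comp R).mapComp f g).hom ≫
          (E.mapComp (R.map (E.map f)) (R.map (E.map g))).hom :=
      (E.map₂_comp_assoc (R.map₂ (E.mapComp f g).hom) (R.mapComp (E.map f) (E.map g)).hom _).symm
    rw [h1, h2]
    exact mapSquare_comp E (𝟙 (f ≫ g)) ((E.comp R).mapComp f g).hom (η.naturality f)
      (η.naturality g) (η.naturality (f ≫ g)) (η.naturality_comp f g)

/-- For `κ : E R ⟶ 1`, the whiskering `κ E : E R E ⟶ E`. -/
def counitPre (κ : R.comp E ⟶ Pseudofunctor.id A) : E.comp (R.comp E) ⟶ E where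
  app x := κ.app (E.obj x)
  naturality f := κ.naturality (E.map f)
  naturality_naturality θ := κ.naturality_naturality (E.map₂ θ)
  naturality_id x := by
    have h1 : (E.mapId x).hom = ((E.comp (Pseudofunctor.id A)).mapId x).hom :=
      (Category.comp_id _).symm
    rw [h1]
    exact (preWhisker E κ).naturality_id x
  naturality_comp f g := by
    have h1 : (E.mapComp f g).hom = ((E.comp (Pseudofunctor.id A)).mapComp f g).hom :=
      (Category.comp_id _).symm
    rw [h1]
    exact (preWhisker E κ).naturality_comp f g

/-- For `η : 1 ⟶ R E`, the whiskering `η R : R ⟶ R E R`. -/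
def unitPre (η : Pseudofunctor.id B ⟶ E.comp R) : R ⟶ R.comp (E.comp R) where
  app a := η.app (R.obj a)
  naturality f := η.naturality (R.map f)
  naturality_naturality θ := η.naturality_naturality (R.map₂ θ)
  naturality_id a := by
    have h1 : (R.mapId a).hom = ((R.comp (Pseudofunctor.id B)).mapId a).hom :=
      (Category.comp_id _).symm
    rw [h1]
    exact (preWhisker R η).naturality_id a
  naturality_comp f g := by
    have h1 : (R.mapComp f g).hom = ((R.comp (Pseudofunctor.id B)).mapComp f g).hom :=
      (Category.comp_id _).symm
    rw [h1]
    exact (preWhisker R η).naturality_comp f g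

/-- For `κ : E R ⟶ 1`, the whiskering `R κ : R E R ⟶ R`. -/
def counitPost (κ : R.comp E ⟶ Pseudofunctor.id A) : R.comp (E.comp R) ⟶ R where
  app a := R.map (κ.app a)
  naturality f := mapSquare R (κ.naturality f)
  naturality_naturality {a b f g} θ :=
    mapSquare_naturality R (κ.naturality f) (κ.naturality g) (E.map₂ (R.map₂ θ)) θ
      (κ.naturality_naturality θ)
  naturality_id a := by
    have h1 : (R.mapId a).hom = R.map₂ (𝟙 (𝟙 a)) ≫ (R.mapId a).hom := by simp
    have h2 : ((R.comp (E.comp R)).mapId a).hom =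
        R.map₂ ((R.comp E).mapId a).hom ≫ (R.mapId (E.obj (R.obj a))).hom :=
      (R.map₂_comp_assoc (E.map₂ (R.mapId a).hom) (E.mapId (R.obj a)).hom _).symm
    rw [h1, h2]
    exact mapSquare_id R (κ.app a) ((R.comp E).mapId a).hom (𝟙 (𝟙 a)) (κ.naturality (𝟙 a))
      (κ.naturality_id a)
  naturality_comp f g := by
    have h1 : (R.mapComp f g).hom = R.map₂ (𝟙 (f ≫ g)) ≫ (R.mapComp f g).hom := by simp
    have h2 : ((R.comp (E.comp R)).mapComp f g).hom =
        R.map₂ ((R.comp E).mapComp f g).hom ≫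
          (R.mapComp (E.map (R.map f)) (E.map (R.map g))).hom :=
      (R.map₂_comp_assoc (E.map₂ (R.mapComp f g).hom) (E.mapComp (R.map f) (R.map g)).hom _).symm
    rw [h1, h2]
    exact mapSquare_comp R ((R.comp E).mapComp f g).hom (𝟙 (f ≫ g)) (κ.naturality f)
      (κ.naturality g) (κ.naturality (f ≫ g)) (κ.naturality_comp f g)

variable (E R) in
/-- `E` is left biadjoint to `R`: a unit `η : 1 ⟶ R E`, a counit `κ : E R ⟶ 1`, invertible
modifications `v : 1_E ≅ (κ E)(E η)` and `w : (R κ)(η R) ≅ 1_R`, and the two coherence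
(swallowtail) axioms: for each `x` the pasting
`η_x ≅ R(1) η_x ≅ R(κ_{Ex} E η_x) η_x ≅ R κ_{Ex} RE η_x η_x ≅ R κ_{Ex} η_{REx} η_x ≅ η_x`
of `v_x`, `η_{η_x}⁻¹` and `w_{Ex}` is the identity, and for each `a` the pasting
`κ_a ≅ κ_a κ_{ERa} E η_{Ra} ≅ κ_a ER κ_a E η_{Ra} ≅ κ_a E(R κ_a η_{Ra}) ≅ κ_a E(1) ≅ κ_a`
of `v_{Ra}`, `κ_{κ_a}⁻¹` and `w_a` is the identity. -/
structure Biadjunction where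
  /-- the unit `η` -/
  unit : Pseudofunctor.id B ⟶ E.comp R
  /-- the counit `κ` -/
  counit : R.comp E ⟶ Pseudofunctor.id A
  /-- the invertible modification `v` -/
  leftMod : 𝟙 E ≅ unitPost unit ≫ counitPre counit
  /-- the invertible modification `w` -/
  rightMod : unitPre unit ≫ counitPost counit ≅ 𝟙 R
  swallowtail_unit (x : B) :
    (ρ_ (unit.app x)).inv ≫ unit.app x ◁ ((R.mapId (E.obj x)).inv ≫
        R.map₂ (show 𝟙 (E.obj x) ⟶ E.map (unit.app x) ≫ counit.app (E.obj x) from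
          leftMod.hom.as.app x) ≫
        (R.mapComp (E.map (unit.app x)) (counit.app (E.obj x))).hom) ≫
      (α_ (unit.app x) (R.map (E.map (unit.app x))) (R.map (counit.app (E.obj x)))).inv ≫
      (show unit.app x ≫ R.map (E.map (unit.app x)) ⟶
          unit.app x ≫ unit.app (R.obj (E.obj x)) from (unit.naturality (unit.app x)).inv) ▷
        R.map (counit.app (E.obj x)) ≫
      (α_ (unit.app x) (unit.app (R.obj (E.obj x))) (R.map (counit.app (E.obj x)))).hom ≫
      unit.app x ◁ (show unit.app (R.obj (E.obj x)) ≫ R.map (counit.app (E.obj x)) ⟶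
          𝟙 (R.obj (E.obj x)) from rightMod.hom.as.app (E.obj x)) ≫
      (ρ_ (unit.app x)).hom = 𝟙 (unit.app x)
  swallowtail_counit (a : A) :
    (λ_ (counit.app a)).inv ≫
      (show 𝟙 (E.obj (R.obj a)) ⟶ E.map (unit.app (R.obj a)) ≫ counit.app (E.obj (R.obj a)) from
          leftMod.hom.as.app (R.obj a)) ▷ counit.app a ≫
      (α_ (E.map (unit.app (R.obj a))) (counit.app (E.obj (R.obj a))) (counit.app a)).hom ≫
      E.map (unit.app (R.obj a)) ◁ (show counit.app (E.obj (R.obj a)) ≫ counit.app a ⟶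
          E.map (R.map (counit.app a)) ≫ counit.app a from
          (counit.naturality (counit.app a)).inv) ≫
      (α_ (E.map (unit.app (R.obj a))) (E.map (R.map (counit.app a))) (counit.app a)).inv ≫
      ((E.mapComp (unit.app (R.obj a)) (R.map (counit.app a))).inv ≫
        E.map₂ (show unit.app (R.obj a) ≫ R.map (counit.app a) ⟶ 𝟙 (R.obj a) from
          rightMod.hom.as.app a) ≫
        (E.mapId (R.obj a)).hom) ▷ counit.app a ≫
      (λ_ (counit.app a)).hom = 𝟙 (counit.app a)

/-- `R` is right biadjoint: it has a left biadjoint. -/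
def IsRightBiadjoint (R : A ⥤ᵖ B) : Prop :=
  ∃ E : B ⥤ᵖ A, Nonempty (Biadjunction E R)
end Biadjunction

section Weighted
/-- For `F : X → K`, the pseudofunctor `K(-, F -) : Kᵒᵖ × X → Cat`. -/
def homTo {K : Type u₁} [Bicategory.{w₁, v₁} K] {X : Type u₂} [Bicategory.{w₂, v₂} X]
    (F : X ⥤ᵖ K) : Kᵒᵖ × X ⥤ᵖ Cat.{w₁, v₁} :=
  (prodMap (Pseudofunctor.id Kᵒᵖ) F).comp (homPseudofunctor K)

/-- For `D : Sᵒᵖ → A`, the pseudofunctor `A(D -, -) : S × A → Cat`. -/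
def homFrom {S : Type u₁} [Bicategory.{w₁, v₁} S] {A : Type u₂} [Bicategory.{w₂, v₂} A]
    (D : Sᵒᵖ ⥤ᵖ A) : S × A ⥤ᵖ Cat.{w₂, v₂} :=
  (prodMap (rightOp D) (Pseudofunctor.id A)).comp (homPseudofunctor A)

/-- The restriction `|D| : S₀ × A → K` of `D : S × A → K`, where `S₀` is the discrete 2-category on
the objects of `S`. -/
def restrictDiscrete {S : Type u₁} [Bicategory.{w₁, v₁} S] {A : Type u₂} [Bicategory.{w₂, v₂} A]
    {K : Type u₃} [Bicategory.{w₃, v₃} K] (D : S × A ⥤ᵖ K) :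
    LocallyDiscrete (Discrete S) × A ⥤ᵖ K :=
  (prodMap (discreteInclusion S) (Pseudofunctor.id A)).comp D

/-- `|D|` can be factorized through `B(-, R -)`: there are a pseudofunctor `D' : S₀ → Bᵒᵖ` and a
pseudonatural equivalence `|D| ≃ B(-, R -) ∘ (D' × 1)`. -/
def FactorsThrough {S : Type u₁} [Bicategory.{w₁, v₁} S] {A : Type u₂} [Bicategory.{w₂, v₂} A]
    {B : Type u₃} [Bicategory.{w₃, v₃} B] (D : S × A ⥤ᵖ Cat.{w₃, v₃}) (R : A ⥤ᵖ B) : Prop :=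
  ∃ D' : LocallyDiscrete (Discrete S) ⥤ᵖ Bᵒᵖ, Nonempty (Bicategory.Equivalence
    (restrictDiscrete D) ((prodMap D' (Pseudofunctor.id A)).comp (homTo R)))

/-- The pseudofunctor `a ↦ [S, Cat]_PS (W, P(-, a))`. -/
def weightedHom {S : Type v} [Bicategory.{v, v} S] {A : Type u₁} [Bicategory.{w₁, v₁} A]
    (W : S ⥤ᵖ Cat.{v, v}) (P : S × A ⥤ᵖ Cat.{v, v}) : A ⥤ᵖ Cat.{v, v} :=
  (curry P).comp (corep W)

/-- `L a` is the weighted bilimit `{W, T(-, a)}_bi` in `K`, pseudonaturally in `a`: there is an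
equivalence `K(X, L a) ≃ [S, Cat]_PS (W, K(X, T(-, a)))`, pseudonatural in `X` and in `a`. -/
def IsWeightedBilimitFamily {S : Type v} [Bicategory.{v, v} S] {A : Type u₁}
    [Bicategory.{w₁, v₁} A] {K : Type u₂} [Bicategory.{v, v} K]
    (W : S ⥤ᵖ Cat.{v, v}) (T : S × A ⥤ᵖ K) (L : A ⥤ᵖ K) : Prop :=
  Nonempty (Bicategory.Equivalence (homTo L)
    (weightedHom W ((prodExchange S Kᵒᵖ A).comp (homTo T))))

/-- `G` is the weighted bicolimit of `D : Sᵒᵖ → A` with weight `W : S → Cat`: there is an equivalence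
`A(G, X) ≃ [S, Cat]_PS (W, A(D -, X))`, pseudonatural in `X`. -/
def IsWeightedBicolimit {S : Type v} [Bicategory.{v, v} S] {A : Type u₁} [Bicategory.{v, v} A]
    (W : S ⥤ᵖ Cat.{v, v}) (D : Sᵒᵖ ⥤ᵖ A) (G : A) : Prop :=
  Nonempty (Bicategory.Equivalence (corep G) (weightedHom W (homFrom D)))
end Weighted

end BiLift

/-!
`J` is right biadjoint if and only if every `y : C` admits a universal arrow `y ⟶ J (G y)`, that
is, a birepresentation of `C(y, J -)`. By hypothesis (b) and the equivalence `D y ≃ A(𝒜_y -, -)`,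
evaluation at the terminal category identifies `C(y, J -)` with `[S, Cat](W, A(𝒜_y -, -))`, whose
birepresentations are by definition the weighted bicolimits `W * 𝒜_y`.

Universal arrows are assembled into a biadjunction in the iso-comma bicategory of `J`: every 1-cell
and 2-cell out of a universal arrow lifts, and such a 2-cell is determined by its left component. So
two composites of lifted 2-cells agree as soon as their left components do, and every coherence
law, the swallowtail identities included, becomes a coherence identity on left components. The
pseudofunctor `𝒜_y` is obtained by the same lifting, applied to the Yoneda embedding
`Aᵒᵖ → [A, Cat]`, from the representations of the individual `D y (s, -)` that (a) and the left
biadjoint of `R` provide.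
-/

namespace BiLift

section Exchange
variable {C : Type u₃} [Bicategory.{w₃, v₃} C]

theorem whisker_exchange_square_left {x y z z' t : C} {f g : x ⟶ y} (θ : f ⟶ g) {a : y ⟶ z}
    {b : z ⟶ t} {c : y ⟶ z'} {d : z' ⟶ t} (σ : a ≫ b ⟶ c ≫ d) :
    θ ▷ a ▷ b ≫ (α_ g a b).hom ≫ g ◁ σ =
      (α_ f a b).hom ≫ f ◁ σ ≫ (α_ f c d).inv ≫ θ ▷ c ▷ d ≫ (α_ g c d).hom := by
  have h := whisker_exchange θ σ
  simp only [whiskerRight_comp] at h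
  rw [← cancel_mono (α_ g c d).inv]
  simp only [Category.assoc, Iso.hom_inv_id, Category.comp_id] at h ⊢
  simpa using ((α_ f a b).hom ≫= h.symm) =≫ (α_ g c d).inv

theorem whisker_exchange_square_right {x y y' z t : C} {a : x ⟶ y} {b : y ⟶ z} {c : x ⟶ y'}
    {d : y' ⟶ z} (σ : a ≫ b ⟶ c ≫ d) {f g : z ⟶ t} (θ : f ⟶ g) :
    a ◁ b ◁ θ ≫ (α_ a b g).inv ≫ σ ▷ g =
      (α_ a b f).inv ≫ σ ▷ f ≫ (α_ c d f).hom ≫ c ◁ d ◁ θ ≫ (α_ c d g).inv := by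
  have h := whisker_exchange σ θ
  simp only [comp_whiskerLeft, Category.assoc] at h
  rw [← h, Iso.inv_hom_id_assoc]

end Exchange

section UniversalArrow
variable {Z : Type u₁} [Bicategory.{w₁, v₁} Z] {C : Type u₂} [Bicategory.{w₂, v₂} C]

/-- For `u : x ⟶ J c`, the functor `f ↦ u ≫ J f` from 1-cells `c ⟶ z` to 1-cells `x ⟶ J z`. -/
def transposeFunctor (J : Z ⥤ᵖ C) {x : C} {c : Z} (u : x ⟶ J.obj c) (z : Z) :
    (c ⟶ z) ⥤ (x ⟶ J.obj z) where
  obj f := u ≫ J.map f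
  map γ := u ◁ J.map₂ γ

/-- `u : x ⟶ J c` is a (bicategorical) universal arrow from `x` to `J`: composition with `u`
identifies 1-cells `c ⟶ z` with 1-cells `x ⟶ J z`, up to equivalence of categories. -/
def IsUniversalArrow (J : Z ⥤ᵖ C) {x : C} {c : Z} (u : x ⟶ J.obj c) : Prop :=
  ∀ z, (transposeFunctor J u z).IsEquivalence

end UniversalArrow

section IsoComma
variable {X : Type u₁} [Bicategory.{w₁, v₁} X] {Z : Type u₂} [Bicategory.{w₂, v₂} Z]
  {C : Type u₃} [Bicategory.{w₃, v₃} C]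

/-- The iso-comma bicategory `K ↓ J`: an object is a 1-cell `K x ⟶ J z`, a 1-cell is a square
filled with an invertible 2-cell, and a 2-cell is a pair of 2-cells compatible with the fillers. -/
structure IsoComma (K : X ⥤ᵖ C) (J : Z ⥤ᵖ C) where
  left : X
  right : Z
  arr : K.obj left ⟶ J.obj right

namespace IsoComma
variable {K : X ⥤ᵖ C} {J : Z ⥤ᵖ C}

/-- The 1-cells of the iso-comma bicategory. The filler points from the left leg to the right one,
as the naturality 2-cells of a `StrongTrans` do. -/
structure Hom (p q : IsoComma K J) where
  left : p.left ⟶ q.left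
  right : p.right ⟶ q.right
  sq : K.map left ≫ q.arr ≅ p.arr ≫ J.map right

/-- The 2-cells of the iso-comma bicategory. -/
@[ext]
structure Hom₂ {p q : IsoComma K J} (f g : Hom p q) where
  left : f.left ⟶ g.left
  right : f.right ⟶ g.right
  w : K.map₂ left ▷ q.arr ≫ g.sq.hom = f.sq.hom ≫ p.arr ◁ J.map₂ right

instance : CategoryStruct (IsoComma K J) where
  Hom := Hom
  id p :=
    { left := 𝟙 _
      right := 𝟙 _
      sq := whiskerRightIso (K.mapId p.left) p.arr ≪≫ λ_ _ ≪≫ (ρ_ _).symm ≪≫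
        whiskerLeftIso p.arr (J.mapId p.right).symm }
  comp {p _ r} f g :=
    { left := f.left ≫ g.left
      right := f.right ≫ g.right
      sq := whiskerRightIso (K.mapComp f.left g.left) r.arr ≪≫ α_ _ _ _ ≪≫
        whiskerLeftIso (K.map f.left) g.sq ≪≫ (α_ _ _ _).symm ≪≫
        whiskerRightIso f.sq (J.map g.right) ≪≫ α_ _ _ _ ≪≫
        whiskerLeftIso p.arr (J.mapComp f.right g.right).symm }

instance homCategory (p q : IsoComma K J) : Category (p ⟶ q) where
  Hom f g := Hom₂ f g
  id f := ⟨𝟙 _, 𝟙 _, by simp⟩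
  comp {f g h} x y := ⟨x.left ≫ y.left, x.right ≫ y.right, by
    rw [K.map₂_comp, J.map₂_comp, comp_whiskerRight, whiskerLeft_comp, Category.assoc, y.w,
      ← Category.assoc, x.w, Category.assoc]⟩

@[simp] theorem id_left (p : IsoComma K J) : Hom.left (𝟙 p) = 𝟙 p.left := rfl
@[simp] theorem id_right (p : IsoComma K J) : Hom.right (𝟙 p) = 𝟙 p.right := rfl
@[simp] theorem comp_left {p q r : IsoComma K J} (f : p ⟶ q) (g : q ⟶ r) :
    Hom.left (f ≫ g) = f.left ≫ g.left := rfl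
@[simp] theorem comp_right {p q r : IsoComma K J} (f : p ⟶ q) (g : q ⟶ r) :
    Hom.right (f ≫ g) = f.right ≫ g.right := rfl

theorem id_sq_hom (p : IsoComma K J) : (Hom.sq (𝟙 p)).hom =
    (K.mapId p.left).hom ▷ p.arr ≫ (λ_ p.arr).hom ≫ (ρ_ p.arr).inv ≫
      p.arr ◁ (J.mapId p.right).inv := rfl

theorem comp_sq_hom {p q r : IsoComma K J} (f : p ⟶ q) (g : q ⟶ r) : (Hom.sq (f ≫ g)).hom =
    (K.mapComp f.left g.left).hom ▷ r.arr ≫ (α_ _ _ _).hom ≫ K.map f.left ◁ g.sq.hom ≫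
      (α_ _ _ _).inv ≫ f.sq.hom ▷ J.map g.right ≫ (α_ _ _ _).hom ≫
      p.arr ◁ (J.mapComp f.right g.right).inv := rfl

theorem hom₂_ext {p q : IsoComma K J} {f g : p ⟶ q} {x y : f ⟶ g} (h : x.left = y.left)
    (h' : x.right = y.right) : x = y := Hom₂.ext h h'

theorem hom₂_w {p q : IsoComma K J} {f g : p ⟶ q} (x : f ⟶ g) :
    K.map₂ x.left ▷ q.arr ≫ g.sq.hom = f.sq.hom ≫ p.arr ◁ J.map₂ x.right := x.w

/-- The invertible 2-cell of the iso-comma bicategory with the given invertible components. -/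
def isoMk {p q : IsoComma K J} {f g : p ⟶ q} (l : f.left ≅ g.left) (r : f.right ≅ g.right)
    (w : K.map₂ l.hom ▷ q.arr ≫ g.sq.hom = f.sq.hom ≫ p.arr ◁ J.map₂ r.hom) : f ≅ g where
  hom := ⟨l.hom, r.hom, w⟩
  inv := ⟨l.inv, r.inv, by
    rw [← cancel_epi (K.map₂ l.hom ▷ q.arr), ← Category.assoc, ← comp_whiskerRight,
      ← K.map₂_comp, l.hom_inv_id, K.map₂_id, id_whiskerRight, Category.id_comp,
      ← Category.assoc, w, Category.assoc, ← whiskerLeft_comp, ← J.map₂_comp, r.hom_inv_id,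
      J.map₂_id, whiskerLeft_id, Category.comp_id]⟩
  hom_inv_id := hom₂_ext l.hom_inv_id r.hom_inv_id
  inv_hom_id := hom₂_ext l.inv_hom_id r.inv_hom_id

theorem whiskerLeft_w {p q r : IsoComma K J} (f : p ⟶ q) {g h : q ⟶ r} (x : g ⟶ h) :
    K.map₂ (f.left ◁ x.left) ▷ r.arr ≫ (Hom.sq (f ≫ h)).hom =
      (Hom.sq (f ≫ g)).hom ≫ p.arr ◁ J.map₂ (f.right ◁ x.right) := by
  have hx := congrArg (K.map f.left ◁ ·) (hom₂_w x)
  simp only [whiskerLeft_comp] at hx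
  simp only [comp_sq_hom, K.map₂_whisker_left, J.map₂_whisker_left, comp_whiskerRight,
    whiskerLeft_comp, Category.assoc, inv_hom_whiskerRight_assoc, whiskerLeft_inv_hom_assoc,
    whisker_assoc, Iso.inv_hom_id_assoc, reassoc_of% hx,
    reassoc_of% (whisker_exchange_square_right f.sq.hom (J.map₂ x.right))]

theorem whiskerRight_w {p q r : IsoComma K J} {f g : p ⟶ q} (x : f ⟶ g) (h : q ⟶ r) :
    K.map₂ (x.left ▷ h.left) ▷ r.arr ≫ (Hom.sq (g ≫ h)).hom =
      (Hom.sq (f ≫ h)).hom ≫ p.arr ◁ J.map₂ (x.right ▷ h.right) := by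
  have hx := congrArg (· ▷ J.map h.right) (hom₂_w x)
  have ex := whisker_exchange (K.map₂ x.left) h.sq.hom
  simp only [comp_whiskerRight, whisker_assoc] at hx
  simp only [comp_sq_hom, K.map₂_whisker_right, J.map₂_whisker_right, comp_whiskerRight,
    whiskerLeft_comp, Category.assoc, inv_hom_whiskerRight_assoc, whiskerLeft_inv_hom_assoc,
    associator_naturality_left_assoc]
  rw [← reassoc_of% ex]
  simp only [whiskerRight_comp, Category.assoc, Iso.hom_inv_id_assoc]
  rw [reassoc_of% hx]
  simp

theorem associator_w {p q r s : IsoComma K J} (f : p ⟶ q) (g : q ⟶ r) (h : r ⟶ s) :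
    K.map₂ (α_ f.left g.left h.left).hom ▷ s.arr ≫ (Hom.sq (f ≫ g ≫ h)).hom =
      (Hom.sq ((f ≫ g) ≫ h)).hom ≫ p.arr ◁ J.map₂ (α_ f.right g.right h.right).hom := by
  have ex := whisker_exchange_square_left (K.mapComp f.left g.left).hom h.sq.hom
  simp only [comp_whiskerLeft] at ex
  rw [← cancel_mono (α_ _ _ _).inv] at ex
  simp only [Category.assoc, Iso.hom_inv_id, Category.comp_id] at ex
  simp [comp_sq_hom, ← reassoc_of% ex,
    reassoc_of% (whisker_exchange_square_right f.sq.hom (J.mapComp g.right h.right).inv)]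

theorem leftUnitor_w {p q : IsoComma K J} (f : p ⟶ q) :
    K.map₂ (λ_ f.left).hom ▷ q.arr ≫ f.sq.hom =
      (Hom.sq (𝟙 p ≫ f)).hom ≫ p.arr ◁ J.map₂ (λ_ f.right).hom := by
  simp [comp_sq_hom, id_sq_hom,
    ← reassoc_of% (whisker_exchange_square_left (K.mapId p.left).hom f.sq.hom)]

theorem rightUnitor_w {p q : IsoComma K J} (f : p ⟶ q) :
    K.map₂ (ρ_ f.left).hom ▷ q.arr ≫ f.sq.hom =
      (Hom.sq (f ≫ 𝟙 q)).hom ≫ p.arr ◁ J.map₂ (ρ_ f.right).hom := by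
  simp [comp_sq_hom, id_sq_hom,
    reassoc_of% (whisker_exchange_square_right f.sq.hom (J.mapId q.right).inv)]

instance bicategory : Bicategory (IsoComma K J) where
  homCategory := homCategory
  whiskerLeft f _ _ x := ⟨f.left ◁ x.left, f.right ◁ x.right, whiskerLeft_w f x⟩
  whiskerRight x h := ⟨x.left ▷ h.left, x.right ▷ h.right, whiskerRight_w x h⟩
  associator f g h := isoMk (α_ f.left g.left h.left) (α_ f.right g.right h.right)
    (associator_w f g h)
  leftUnitor f := isoMk (λ_ f.left) (λ_ f.right) (leftUnitor_w f)
  rightUnitor f := isoMk (ρ_ f.left) (ρ_ f.right) (rightUnitor_w f)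
  whiskerLeft_id _ _ := hom₂_ext (whiskerLeft_id _ _) (whiskerLeft_id _ _)
  whiskerLeft_comp _ _ _ _ _ _ := hom₂_ext (whiskerLeft_comp _ _ _) (whiskerLeft_comp _ _ _)
  id_whiskerLeft _ := hom₂_ext (id_whiskerLeft _) (id_whiskerLeft _)
  comp_whiskerLeft _ _ _ _ _ := hom₂_ext (comp_whiskerLeft _ _ _) (comp_whiskerLeft _ _ _)
  id_whiskerRight _ _ := hom₂_ext (id_whiskerRight _ _) (id_whiskerRight _ _)
  comp_whiskerRight _ _ _ := hom₂_ext (comp_whiskerRight _ _ _) (comp_whiskerRight _ _ _)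
  whiskerRight_id _ := hom₂_ext (whiskerRight_id _) (whiskerRight_id _)
  whiskerRight_comp _ _ _ := hom₂_ext (whiskerRight_comp _ _ _) (whiskerRight_comp _ _ _)
  whisker_assoc _ _ _ _ _ := hom₂_ext (whisker_assoc _ _ _) (whisker_assoc _ _ _)
  whisker_exchange _ _ := hom₂_ext (whisker_exchange _ _) (whisker_exchange _ _)
  pentagon _ _ _ _ := hom₂_ext (pentagon _ _ _ _) (pentagon _ _ _ _)
  triangle _ _ := hom₂_ext (triangle _ _) (triangle _ _)

variable {p q : IsoComma K J}

theorem hom₂_ext_left (hp : IsUniversalArrow J p.arr) {f g : p ⟶ q} {x y : f ⟶ g}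
    (h : x.left = y.left) : x = y := by
  have := hp q.right
  refine hom₂_ext h ((transposeFunctor J p.arr q.right).map_injective ?_)
  change p.arr ◁ J.map₂ x.right = p.arr ◁ J.map₂ y.right
  rw [← cancel_epi f.sq.hom, ← hom₂_w, ← hom₂_w, h]

/-- A 1-cell out of a universal object, with prescribed left component. -/
noncomputable def lift (hp : IsUniversalArrow J p.arr) (φ : p.left ⟶ q.left) : p ⟶ q :=
  have := hp q.right
  ⟨φ, (transposeFunctor J p.arr q.right).objPreimage (K.map φ ≫ q.arr),
    ((transposeFunctor J p.arr q.right).objObjPreimageIso (K.map φ ≫ q.arr)).symm⟩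

/-- The 2-cell out of a universal object, with prescribed left component. -/
noncomputable def lift₂ (hp : IsUniversalArrow J p.arr) {f g : p ⟶ q} (β : f.left ⟶ g.left) :
    f ⟶ g :=
  have := hp q.right
  let σ : p.arr ≫ J.map f.right ⟶ p.arr ≫ J.map g.right :=
    f.sq.inv ≫ K.map₂ β ▷ q.arr ≫ g.sq.hom
  ⟨β, (transposeFunctor J p.arr q.right).preimage (X := f.right) (Y := g.right) σ, by
    have h : p.arr ◁ J.map₂ _ = σ :=
      (transposeFunctor J p.arr q.right).map_preimage (X := f.right) (Y := g.right) σ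
    rw [h, Iso.hom_inv_id_assoc]⟩

/-- The invertible 2-cell out of a universal object, with prescribed left component. -/
noncomputable def liftIso (hp : IsUniversalArrow J p.arr) {f g : p ⟶ q} (β : f.left ≅ g.left) :
    f ≅ g where
  hom := lift₂ hp β.hom
  inv := lift₂ hp β.inv
  hom_inv_id := hom₂_ext_left hp β.hom_inv_id
  inv_hom_id := hom₂_ext_left hp β.inv_hom_id

/-- The right component of a 2-isomorphism. -/
def rightIso {f g : p ⟶ q} (x : f ≅ g) : f.right ≅ g.right where
  hom := x.hom.right
  inv := x.inv.right
  hom_inv_id := congrArg Hom₂.right x.hom_inv_id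
  inv_hom_id := congrArg Hom₂.right x.inv_hom_id

theorem sq_hom_mapId {p : IsoComma K J} {f : p ⟶ p} (x : f ⟶ 𝟙 p) :
    f.sq.hom ≫ p.arr ◁ (J.map₂ x.right ≫ (J.mapId p.right).hom) =
      K.map₂ x.left ▷ p.arr ≫ (K.mapId p.left).hom ▷ p.arr ≫ (λ_ p.arr).hom ≫
        (ρ_ p.arr).inv := by
  rw [whiskerLeft_comp, ← Category.assoc, ← hom₂_w, id_sq_hom]
  simp

theorem sq_hom_mapComp {p q r : IsoComma K J} {f : p ⟶ q} {g : q ⟶ r} {k : p ⟶ r}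
    (x : k ⟶ f ≫ g) :
    k.sq.hom ≫ p.arr ◁ (J.map₂ x.right ≫ (J.mapComp f.right g.right).hom) =
      K.map₂ x.left ▷ r.arr ≫ (K.mapComp f.left g.left).hom ▷ r.arr ≫ (α_ _ _ _).hom ≫
        K.map f.left ◁ g.sq.hom ≫ (α_ _ _ _).inv ≫ f.sq.hom ▷ J.map g.right ≫
          (α_ _ _ _).hom := by
  rw [whiskerLeft_comp, ← Category.assoc, ← hom₂_w, comp_sq_hom]
  simp

end IsoComma

open IsoComma

variable {K : X ⥤ᵖ C} {J : Z ⥤ᵖ C} (G : X → Z) (η : ∀ x, K.obj x ⟶ J.obj (G x))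
  (hη : ∀ x, IsUniversalArrow J (η x))

/-- The section of the projection to `X` given by a family of universal objects. -/
noncomputable def universalSection : X ⥤ᵖ IsoComma K J where
  obj x := ⟨x, G x, η x⟩
  map φ := lift (hη _) φ
  map₂ β := lift₂ (hη _) β
  map₂_id _ := hom₂_ext_left (hη _) rfl
  map₂_comp _ _ := hom₂_ext_left (hη _) rfl
  mapId x := liftIso (hη _) (Iso.refl (𝟙 x))
  mapComp φ ψ := liftIso (hη _) (Iso.refl (φ ≫ ψ))
  map₂_whisker_left φ _ _ β := hom₂_ext_left (hη _) (by
    change φ ◁ β = 𝟙 _ ≫ φ ◁ β ≫ 𝟙 _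
    simp)
  map₂_whisker_right β φ := hom₂_ext_left (hη _) (by
    change β ▷ φ = 𝟙 _ ≫ β ▷ φ ≫ 𝟙 _
    simp)
  map₂_associator φ ψ χ := hom₂_ext_left (hη _) (by
    change (α_ φ ψ χ).hom = 𝟙 _ ≫ 𝟙 (φ ≫ ψ) ▷ χ ≫ (α_ φ ψ χ).hom ≫ φ ◁ 𝟙 (ψ ≫ χ) ≫ 𝟙 _
    simp)
  map₂_left_unitor {x _} φ := hom₂_ext_left (hη _) (by
    change (λ_ φ).hom = 𝟙 _ ≫ 𝟙 (𝟙 x) ▷ φ ≫ (λ_ φ).hom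
    simp)
  map₂_right_unitor {_ y} φ := hom₂_ext_left (hη _) (by
    change (ρ_ φ).hom = 𝟙 _ ≫ φ ◁ 𝟙 (𝟙 y) ≫ (ρ_ φ).hom
    simp)

/-- The pseudofunctor `x ↦ G x` determined by universal arrows `K x ⟶ J (G x)`. -/
noncomputable def universalFunctor : X ⥤ᵖ Z where
  obj := G
  map φ := ((universalSection G η hη).map φ).right
  map₂ β := ((universalSection G η hη).map₂ β).right
  map₂_id φ := congrArg Hom₂.right ((universalSection G η hη).map₂_id φ)
  map₂_comp β γ := congrArg Hom₂.right ((universalSection G η hη).map₂_comp β γ)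
  mapId x := rightIso ((universalSection G η hη).mapId x)
  mapComp φ ψ := rightIso ((universalSection G η hη).mapComp φ ψ)
  map₂_whisker_left φ _ _ β :=
    congrArg Hom₂.right ((universalSection G η hη).map₂_whisker_left φ β)
  map₂_whisker_right β φ :=
    congrArg Hom₂.right ((universalSection G η hη).map₂_whisker_right β φ)
  map₂_associator φ ψ χ :=
    congrArg Hom₂.right ((universalSection G η hη).map₂_associator φ ψ χ)
  map₂_left_unitor φ := congrArg Hom₂.right ((universalSection G η hη).map₂_left_unitor φ)
  map₂_right_unitor φ := congrArg Hom₂.right ((universalSection G η hη).map₂_right_unitor φ)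

/-- The universal arrows form a pseudonatural transformation. -/
noncomputable def universalUnit : K ⟶ (universalFunctor G η hη).comp J where
  app := η
  naturality φ := ((universalSection G η hη).map φ).sq
  naturality_naturality β := hom₂_w ((universalSection G η hη).map₂ β)
  naturality_id x := (sq_hom_mapId ((universalSection G η hη).mapId x).hom).trans (by
    change K.map₂ (𝟙 (𝟙 x)) ▷ η x ≫ _ = _
    rw [K.map₂_id, id_whiskerRight]
    exact Category.id_comp _)
  naturality_comp {_ _ x} φ ψ :=
    (sq_hom_mapComp ((universalSection G η hη).mapComp φ ψ).hom).trans (by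
      change K.map₂ (𝟙 (φ ≫ ψ)) ▷ η x ≫ _ = _
      rw [K.map₂_id, id_whiskerRight]
      exact Category.id_comp _)

end IsoComma

section UniversalBiadjunction
variable {A : Type u₁} [Bicategory.{w₁, v₁} A] {B : Type u₂} [Bicategory.{w₂, v₂} B]
  {J : A ⥤ᵖ B}

open IsoComma

/- The lemmas `…_w` are the conditions `Hom₂.w` of the 2-cells constructed here, written out in the
original bicategory: rewriting does not see through the definition of the composition of
`IsoComma` and of `Pseudofunctor.id`. -/
theorem idComma_map₂_w {a b : A} {f g : a ⟶ b} (γ : f ⟶ g) :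
    J.map₂ γ ▷ 𝟙 (J.obj b) ≫ (ρ_ (J.map g)).hom ≫ (λ_ (J.map g)).inv =
      ((ρ_ (J.map f)).hom ≫ (λ_ (J.map f)).inv) ≫ 𝟙 (J.obj a) ◁ J.map₂ γ := by
  simp

theorem idComma_mapId_w (a : A) :
    (J.mapId a).hom ▷ 𝟙 (J.obj a) ≫ 𝟙 (𝟙 (J.obj a)) ▷ 𝟙 (J.obj a) ≫ (λ_ (𝟙 (J.obj a))).hom ≫
        (ρ_ (𝟙 (J.obj a))).inv ≫ 𝟙 (J.obj a) ◁ (J.mapId a).inv =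
      ((ρ_ (J.map (𝟙 a))).hom ≫ (λ_ (J.map (𝟙 a))).inv) ≫ 𝟙 (J.obj a) ◁ J.map₂ (𝟙 (𝟙 a)) := by
  simp [unitors_equal]

theorem idComma_mapComp_w {a b c : A} (f : a ⟶ b) (g : b ⟶ c) :
    (J.mapComp f g).hom ▷ 𝟙 (J.obj c) ≫ 𝟙 (J.map f ≫ J.map g) ▷ 𝟙 (J.obj c) ≫ (α_ _ _ _).hom ≫
        J.map f ◁ ((ρ_ (J.map g)).hom ≫ (λ_ (J.map g)).inv) ≫ (α_ _ _ _).inv ≫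
        ((ρ_ (J.map f)).hom ≫ (λ_ (J.map f)).inv) ▷ J.map g ≫ (α_ _ _ _).hom ≫
        𝟙 (J.obj a) ◁ (J.mapComp f g).inv =
      ((ρ_ (J.map (f ≫ g))).hom ≫ (λ_ (J.map (f ≫ g))).inv) ≫
        𝟙 (J.obj a) ◁ J.map₂ (𝟙 (f ≫ g)) := by
  simp

/-- The pseudofunctor `a ↦ (J a, a, 𝟙)` into the iso-comma bicategory. -/
def idComma (J : A ⥤ᵖ B) : A ⥤ᵖ IsoComma (Pseudofunctor.id B) J where
  obj a := ⟨J.obj a, a, 𝟙 (J.obj a)⟩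
  map f := ⟨J.map f, f, ρ_ (J.map f) ≪≫ (λ_ (J.map f)).symm⟩
  map₂ γ := ⟨J.map₂ γ, γ, idComma_map₂_w γ⟩
  map₂_id f := hom₂_ext (J.map₂_id f) rfl
  map₂_comp γ δ := hom₂_ext (J.map₂_comp γ δ) rfl
  mapId a := IsoComma.isoMk (J.mapId a) (Iso.refl (𝟙 a)) (idComma_mapId_w a)
  mapComp f g := IsoComma.isoMk (J.mapComp f g) (Iso.refl (f ≫ g)) (idComma_mapComp_w f g)
  map₂_whisker_left f _ _ γ := hom₂_ext (J.map₂_whisker_left f γ)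
    (by change f ◁ γ = 𝟙 _ ≫ f ◁ γ ≫ 𝟙 _; simp)
  map₂_whisker_right γ f := hom₂_ext (J.map₂_whisker_right γ f)
    (by change γ ▷ f = 𝟙 _ ≫ γ ▷ f ≫ 𝟙 _; simp)
  map₂_associator f g h := hom₂_ext (J.map₂_associator f g h) (by
    change (α_ f g h).hom = 𝟙 _ ≫ 𝟙 (f ≫ g) ▷ h ≫ (α_ f g h).hom ≫ f ◁ 𝟙 (g ≫ h) ≫ 𝟙 _
    simp)
  map₂_left_unitor {x _} f := hom₂_ext (J.map₂_left_unitor f) (by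
    change (λ_ f).hom = 𝟙 _ ≫ 𝟙 (𝟙 x) ▷ f ≫ (λ_ f).hom
    simp)
  map₂_right_unitor {_ y} f := hom₂_ext (J.map₂_right_unitor f) (by
    change (ρ_ f).hom = 𝟙 _ ≫ f ◁ 𝟙 (𝟙 y) ≫ (ρ_ f).hom
    simp)

variable (G : B → A) (η : ∀ y, (Pseudofunctor.id B).obj y ⟶ J.obj (G y))
  (hη : ∀ y, IsUniversalArrow J (η y))

/-- The counit of `universalBiadjunction`, lifted to the iso-comma bicategory. -/
noncomputable def counitComma : J.comp (universalSection G η hη) ⟶ idComma J where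
  app a := lift (hη (J.obj a)) (𝟙 (J.obj a))
  naturality {a b} f := liftIso (hη (J.obj a)) (ρ_ (J.map f) ≪≫ (λ_ (J.map f)).symm)
  naturality_naturality {a b f g} γ := hom₂_ext_left (hη (J.obj a)) (idComma_map₂_w γ)
  naturality_id a := hom₂_ext_left (hη (J.obj a)) (by
    change ((ρ_ (J.map (𝟙 a))).hom ≫ (λ_ (J.map (𝟙 a))).inv) ≫ 𝟙 (J.obj a) ◁ (J.mapId a).hom =
      ((J.mapId a).hom ≫ 𝟙 _) ▷ 𝟙 (J.obj a) ≫ (λ_ (𝟙 (J.obj a))).hom ≫ (ρ_ (𝟙 (J.obj a))).inv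
    simp [unitors_equal])
  naturality_comp {a b c} f g := hom₂_ext_left (hη (J.obj a)) (by
    change ((ρ_ (J.map (f ≫ g))).hom ≫ (λ_ (J.map (f ≫ g))).inv) ≫ 𝟙 (J.obj a) ◁
        (J.mapComp f g).hom = ((J.mapComp f g).hom ≫ 𝟙 _) ▷ 𝟙 (J.obj c) ≫ (α_ _ _ _).hom ≫
        J.map f ◁ ((ρ_ (J.map g)).hom ≫ (λ_ (J.map g)).inv) ≫ (α_ _ _ _).inv ≫
        ((ρ_ (J.map f)).hom ≫ (λ_ (J.map f)).inv) ▷ J.map g ≫ (α_ _ _ _).hom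
    simp)

/-- The counit of `universalBiadjunction`: the right component of `counitComma`. -/
noncomputable def universalCounit : J.comp (universalFunctor G η hη) ⟶ Pseudofunctor.id A where
  app a := ((counitComma G η hη).app a).right
  naturality f := rightIso ((counitComma G η hη).naturality f)
  naturality_naturality γ :=
    congrArg Hom₂.right ((counitComma G η hη).naturality_naturality γ)
  naturality_id a := congrArg Hom₂.right ((counitComma G η hη).naturality_id a)
  naturality_comp f g := congrArg Hom₂.right ((counitComma G η hη).naturality_comp f g)

/-- The 1-cell `(η y, 𝟙)` of the iso-comma bicategory. -/
def unitComma (y : B) :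
    (IsoComma.mk y (G y) (η y) : IsoComma (Pseudofunctor.id B) J) ⟶ (idComma J).obj (G y) :=
  ⟨η y, 𝟙 (G y), ρ_ (η y) ≪≫ (ρ_ (η y)).symm ≪≫ whiskerLeftIso (η y) (J.mapId (G y)).symm⟩

theorem unitComma_naturality_w {x y : B} {c d : A} {φ : x ⟶ y} {h : x ⟶ J.obj c}
    {k : y ⟶ J.obj d} {l : c ⟶ d} (n : φ ≫ k ≅ h ≫ J.map l) :
    n.hom ▷ 𝟙 (J.obj d) ≫ 𝟙 (h ≫ J.map l) ▷ 𝟙 (J.obj d) ≫ (α_ _ _ _).hom ≫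
        h ◁ ((ρ_ (J.map l)).hom ≫ (λ_ (J.map l)).inv) ≫ (α_ _ _ _).inv ≫
        ((ρ_ h).hom ≫ (ρ_ h).inv ≫ h ◁ (J.mapId c).inv) ▷ J.map l ≫ (α_ _ _ _).hom ≫
        h ◁ (J.mapComp (𝟙 c) l).inv =
      (𝟙 (φ ≫ k) ▷ 𝟙 (J.obj d) ≫ (α_ _ _ _).hom ≫
        φ ◁ ((ρ_ k).hom ≫ (ρ_ k).inv ≫ k ◁ (J.mapId d).inv) ≫
        (α_ _ _ _).inv ≫ n.hom ▷ J.map (𝟙 d) ≫ (α_ _ _ _).hom ≫ h ◁ (J.mapComp l (𝟙 d)).inv) ≫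
      h ◁ J.map₂ ((ρ_ l).hom ≫ (λ_ l).inv) := by
  simp only [whiskerRight_id, Category.id_comp, Iso.hom_inv_id, whiskerLeft_comp,
    whiskerLeft_rightUnitor, Category.assoc, Iso.hom_inv_id_assoc, whisker_assoc,
    Iso.inv_hom_id_assoc, PrelaxFunctor.map₂_comp, Pseudofunctor.map₂_right_unitor,
    whiskerLeft_inv_hom_assoc]
  rw [← cancel_epi (α_ _ _ _).inv]
  simp only [Iso.inv_hom_id_assoc]
  rw [reassoc_of% (whisker_exchange_square_right n.hom (J.mapId d).inv)]
  simp only [whiskerRight_id, Iso.inv_hom_id_assoc, whiskerLeft_whiskerLeft_inv_hom_assoc,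
    Iso.hom_inv_id_assoc, Category.assoc, Iso.cancel_iso_inv_left, Iso.cancel_iso_hom_left]
  simp only [← whiskerLeft_comp]
  simp [J.mapComp_id_left_inv]

/-- The naturality 2-cell of `unitComma`. -/
noncomputable def unitCommaNaturality {x y : B} (φ : x ⟶ y) :
    (universalSection G η hη).map φ ≫ unitComma G η y ≅
      unitComma G η x ≫ (idComma J).map ((universalFunctor G η hη).map φ) :=
  IsoComma.isoMk ((universalUnit G η hη).naturality φ)
    (ρ_ ((universalFunctor G η hη).map φ) ≪≫ (λ_ ((universalFunctor G η hη).map φ)).symm)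
    (unitComma_naturality_w (J := J) (l := (universalFunctor G η hη).map φ)
      ((universalUnit G η hη).naturality φ))

/-- The triangle isomorphism at `y`, in the iso-comma bicategory. -/
noncomputable def triangleComma (y : B) :
    unitComma G η y ≅
      (universalSection G η hη).map (show y ⟶ J.obj (G y) from η y) ≫
        (counitComma G η hη).app (G y) :=
  liftIso (hη y) (ρ_ (η y)).symm

theorem triangle_modification_left {x y c d : B} {φ : x ⟶ y} {h : x ⟶ c} {k : y ⟶ d} {l : c ⟶ d}
    (n : φ ≫ k ≅ h ≫ l) :
    φ ◁ (ρ_ k).inv ≫ (α_ _ _ _).inv ≫ (𝟙 (φ ≫ k) ≫ n.hom ≫ 𝟙 (h ≫ l)) ▷ 𝟙 d ≫ (α_ _ _ _).hom ≫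
      h ◁ ((ρ_ l).hom ≫ (λ_ l).inv) ≫ (α_ _ _ _).inv = n.hom ≫ (ρ_ h).inv ▷ l := by
  simp

/-- The first triangle isomorphism, the right component of `triangleComma`. -/
noncomputable def universalLeftMod : 𝟙 (universalFunctor G η hη) ≅
    unitPost (universalUnit G η hη) ≫ counitPre (universalCounit G η hη) :=
  Pseudofunctor.StrongTrans.isoMk (fun y => rightIso (triangleComma G η hη y)) (by
    intro x y φ
    have h : (universalSection G η hη).map φ ◁ (triangleComma G η hη y).hom ≫
        (α_ _ _ _).inv ≫ (mapSquare (universalSection G η hη)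
          (show φ ≫ (show y ⟶ J.obj (G y) from η y) ≅
            (show x ⟶ J.obj (G x) from η x) ≫ J.map ((universalFunctor G η hη).map φ) from
            (universalUnit G η hη).naturality φ)).hom ▷ (counitComma G η hη).app (G y) ≫
        (α_ _ _ _).hom ≫ (universalSection G η hη).map (show x ⟶ J.obj (G x) from η x) ◁
          ((counitComma G η hη).naturality ((universalFunctor G η hη).map φ)).hom ≫
        (α_ _ _ _).inv = (unitCommaNaturality G η hη φ).hom ≫ (triangleComma G η hη x).hom ▷
          (idComma J).map ((universalFunctor G η hη).map φ) :=
      hom₂_ext_left (hη x)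
        (triangle_modification_left (B := B) ((universalUnit G η hη).naturality φ))
    exact congrArg Hom₂.right h)

/-- The second triangle isomorphism at `a`, the filler of `counitComma` at `a`. -/
noncomputable def counitTriangle (a : A) :
    (universalUnit G η hη).app (J.obj a) ≫ J.map ((universalCounit G η hη).app a) ≅
      𝟙 (J.obj a) :=
  ((counitComma G η hη).app a).sq.symm ≪≫ λ_ (𝟙 (J.obj a))

theorem counit_modification_w {a b c d : A} {f : a ⟶ b} {h : J.obj a ⟶ J.obj c}
    {k : J.obj b ⟶ J.obj d} {l : c ⟶ d} {κ : c ⟶ a} {κ' : d ⟶ b}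
    (s : 𝟙 (J.obj a) ≫ 𝟙 (J.obj a) ≅ h ≫ J.map κ) (s' : 𝟙 (J.obj b) ≫ 𝟙 (J.obj b) ≅ k ≫ J.map κ')
    (n : J.map f ≫ k ≅ h ≫ J.map l) (m : l ≫ κ' ≅ κ ≫ f)
    (H : ((ρ_ (J.map f)).hom ≫ (λ_ (J.map f)).inv) ▷ 𝟙 (J.obj b) ≫
        𝟙 (𝟙 (J.obj a) ≫ J.map f) ▷ 𝟙 (J.obj b) ≫ (α_ _ _ _).hom ≫
        𝟙 (J.obj a) ◁ ((ρ_ (J.map f)).hom ≫ (λ_ (J.map f)).inv) ≫ (α_ _ _ _).inv ≫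
        s.hom ▷ J.map f ≫ (α_ _ _ _).hom ≫ h ◁ (J.mapComp κ f).inv =
      (𝟙 (J.map f ≫ 𝟙 (J.obj b)) ▷ 𝟙 (J.obj b) ≫ (α_ _ _ _).hom ≫ J.map f ◁ s'.hom ≫
        (α_ _ _ _).inv ≫ n.hom ▷ J.map κ' ≫ (α_ _ _ _).hom ≫ h ◁ (J.mapComp l κ').inv) ≫
        h ◁ J.map₂ m.hom) :
    J.map f ◁ (s'.inv ≫ (λ_ (𝟙 (J.obj b))).hom) ≫ (ρ_ (J.map f)).hom ≫ (λ_ (J.map f)).inv =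
      ((α_ _ _ _).inv ≫ n.hom ▷ J.map κ' ≫ (α_ _ _ _).hom ≫ h ◁ (mapSquare J m).hom ≫
        (α_ _ _ _).inv) ≫ (s.inv ≫ (λ_ (𝟙 (J.obj a))).hom) ▷ J.map f := by
  have filler_eq := (J.map f ◁ s'.inv ≫ (α_ _ _ _).inv) ≫= H
  simp only [whiskerRight_id, Category.assoc, Category.id_comp, Iso.hom_inv_id, whiskerLeft_comp,
    whiskerLeft_rightUnitor, id_whiskerLeft, Iso.hom_inv_id_assoc, Iso.inv_hom_id_assoc,
    whiskerLeft_inv_hom_assoc] at filler_eq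
  simp only [unitors_equal, whiskerLeft_comp, whiskerLeft_rightUnitor, Category.assoc, mapSquare,
    Iso.trans_hom, Iso.symm_hom, Functor.mapIso_hom, PrelaxFunctor.mapFunctor_map,
    comp_whiskerRight]
  rw [← reassoc_of% filler_eq]
  simp

/-- The second triangle isomorphism. -/
noncomputable def universalRightMod : unitPre (universalUnit G η hη) ≫
    counitPost (universalCounit G η hη) ≅ 𝟙 J :=
  Pseudofunctor.StrongTrans.isoMk (counitTriangle G η hη) (by
    intro a b f
    exact counit_modification_w (J := J) ((counitComma G η hη).app a).sq
      ((counitComma G η hη).app b).sq ((universalUnit G η hη).naturality (J.map f))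
      ((universalCounit G η hη).naturality f) (hom₂_w ((counitComma G η hη).naturality f).hom))

theorem counitComma_unitComma_w {a c : A} {h : J.obj a ⟶ J.obj c} {κ : c ⟶ a}
    (s : 𝟙 (J.obj a) ≫ 𝟙 (J.obj a) ≅ h ≫ J.map κ) :
    ((λ_ (𝟙 (J.obj a))).inv ≫ s.hom) ▷ 𝟙 (J.obj a) ≫ 𝟙 (h ≫ J.map κ) ▷ 𝟙 (J.obj a) ≫
        (α_ _ _ _).hom ≫ h ◁ ((ρ_ (J.map κ)).hom ≫ (λ_ (J.map κ)).inv) ≫ (α_ _ _ _).inv ≫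
        ((ρ_ h).hom ≫ (ρ_ h).inv ≫ h ◁ (J.mapId c).inv) ▷ J.map κ ≫ (α_ _ _ _).hom ≫
        h ◁ (J.mapComp (𝟙 c) κ).inv =
      s.hom ≫ h ◁ J.map₂ (λ_ κ).inv := by
  simp [J.mapComp_id_left_inv]

/-- The 2-cell from the counit at `a` to the unit at `J a` followed by the image of the counit. -/
noncomputable def counitUnitComma (a : A) : (counitComma G η hη).app a ⟶
    unitComma G η (J.obj a) ≫ (idComma J).map ((universalCounit G η hη).app a) :=
  ⟨(λ_ (𝟙 (J.obj a))).inv ≫ ((counitComma G η hη).app a).sq.hom,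
    (λ_ ((universalCounit G η hη).app a)).inv,
    counitComma_unitComma_w (J := J) ((counitComma G η hη).app a).sq⟩

theorem swallowtail_unit_of_w {x : B} {c d : A} {h : x ⟶ J.obj c} {k : J.obj c ⟶ J.obj d}
    {κ : d ⟶ c} {l : c ⟶ d} (s : 𝟙 (J.obj c) ≫ 𝟙 (J.obj c) ≅ k ≫ J.map κ)
    (n : h ≫ k ≅ h ≫ J.map l) (m : 𝟙 c ⟶ l ≫ κ)
    (H : (ρ_ h).inv ▷ 𝟙 (J.obj c) ≫ 𝟙 (h ≫ 𝟙 (J.obj c)) ▷ 𝟙 (J.obj c) ≫ (α_ _ _ _).hom ≫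
        h ◁ s.hom ≫ (α_ _ _ _).inv ≫ n.hom ▷ J.map κ ≫ (α_ _ _ _).hom ≫
        h ◁ (J.mapComp l κ).inv =
      ((ρ_ h).hom ≫ (ρ_ h).inv ≫ h ◁ (J.mapId c).inv) ≫ h ◁ J.map₂ m) :
    (ρ_ h).inv ≫ h ◁ ((J.mapId c).inv ≫ J.map₂ m ≫ (J.mapComp l κ).hom) ≫ (α_ _ _ _).inv ≫
      n.inv ▷ J.map κ ≫ (α_ _ _ _).hom ≫ h ◁ (s.inv ≫ (λ_ (𝟙 (J.obj c))).hom) ≫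
      (ρ_ h).hom = 𝟙 h := by
  simp only [whiskerRight_id, Iso.hom_inv_id_assoc, Category.id_comp, Iso.hom_inv_id] at H
  simp only [whiskerLeft_comp, unitors_equal, whiskerLeft_rightUnitor, Category.assoc]
  rw [← reassoc_of% H]
  simp

theorem swallowtail_counit_left {a b : B} {h : a ⟶ b} {k : b ⟶ a} (s : 𝟙 a ≫ 𝟙 a ≅ h ≫ k) :
    ((λ_ (𝟙 a)).inv ≫ s.hom) ≫ (ρ_ h).inv ▷ k ≫ (α_ _ _ _).hom ≫
      h ◁ ((λ_ k).hom ≫ (ρ_ k).inv) ≫ (α_ _ _ _).inv ≫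
      (𝟙 (h ≫ k) ≫ (s.inv ≫ (λ_ (𝟙 a)).hom) ≫ 𝟙 (𝟙 a)) ▷ 𝟙 a ≫ (λ_ (𝟙 a)).hom = 𝟙 (𝟙 a) := by
  simp

/-- Universal arrows `y ⟶ J (G y)` make `G` a left biadjoint of `J`. -/
noncomputable def universalBiadjunction : Biadjunction (universalFunctor G η hη) J where
  unit := universalUnit G η hη
  counit := universalCounit G η hη
  leftMod := universalLeftMod G η hη
  rightMod := universalRightMod G η hη
  swallowtail_unit x := swallowtail_unit_of_w (J := J) ((counitComma G η hη).app (G x)).sq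
    ((universalUnit G η hη).naturality (show x ⟶ J.obj (G x) from η x)) _
    (hom₂_w (triangleComma G η hη x).hom)
  swallowtail_counit a := by
    let sec := universalSection G η hη
    have h : counitUnitComma G η hη a ≫ (triangleComma G η hη (J.obj a)).hom ▷
        (idComma J).map ((universalCounit G η hη).app a) ≫ (α_ _ _ _).hom ≫
        sec.map ((universalUnit G η hη).app (J.obj a)) ◁
          ((counitComma G η hη).naturality ((universalCounit G η hη).app a)).inv ≫
        (α_ _ _ _).inv ≫
        ((sec.mapComp _ _).inv ≫ sec.map₂ (counitTriangle G η hη a).hom ≫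
          (sec.mapId (J.obj a)).hom) ▷ (counitComma G η hη).app a ≫ (λ_ _).hom = 𝟙 _ :=
      hom₂_ext_left (hη _) (swallowtail_counit_left (B := B) ((counitComma G η hη).app a).sq)
    exact congrArg Hom₂.right h

end UniversalBiadjunction

section Equivalences
variable {C : Type u₃} [Bicategory.{w₃, v₃} C]

/-- A 1-cell is an equivalence. -/
def IsEquiv {a b : C} (l : a ⟶ b) : Prop := ∃ e : a ≌ b, e.hom = l

theorem IsEquiv.of_iso {a b : C} {l : a ⟶ b} {r : b ⟶ a} (η : 𝟙 a ≅ l ≫ r) (κ : r ≫ l ≅ 𝟙 b) :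
    IsEquiv l := ⟨Bicategory.Equivalence.mkOfAdjointifyCounit η κ, rfl⟩

theorem isEquiv_hom {a b : C} (e : a ≌ b) : IsEquiv e.hom := ⟨e, rfl⟩

theorem isEquiv_inv {a b : C} (e : a ≌ b) : IsEquiv e.inv := .of_iso e.counit.symm e.unit.symm

theorem isEquiv_id (a : C) : IsEquiv (𝟙 a) := isEquiv_hom (Bicategory.Equivalence.id a)

theorem IsEquiv.comp {a b c : C} {f : a ⟶ b} {g : b ⟶ c} (hf : IsEquiv f) (hg : IsEquiv g) :
    IsEquiv (f ≫ g) := by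
  obtain ⟨e, rfl⟩ := hf
  obtain ⟨e', rfl⟩ := hg
  refine .of_iso (r := e'.inv ≫ e.inv) ?_ ?_
  · exact e.unit ≪≫ whiskerLeftIso e.hom ((λ_ _).symm ≪≫ whiskerRightIso e'.unit e.inv ≪≫
      α_ _ _ _) ≪≫ (α_ _ _ _).symm
  · exact α_ _ _ _ ≪≫ whiskerLeftIso e'.inv ((α_ _ _ _).symm ≪≫ whiskerRightIso e.counit e'.hom ≪≫
      λ_ _) ≪≫ e'.counit

theorem IsEquiv.map {D : Type u₂} [Bicategory.{w₂, v₂} D] (F : C ⥤ᵖ D) {a b : C} {f : a ⟶ b}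
    (hf : IsEquiv f) : IsEquiv (F.map f) := by
  obtain ⟨e, rfl⟩ := hf
  exact .of_iso ((F.mapId a).symm ≪≫ F.map₂Iso e.unit ≪≫ F.mapComp e.hom e.inv)
    ((F.mapComp e.inv e.hom).symm ≪≫ F.map₂Iso e.counit ≪≫ F.mapId b)

theorem isEquiv_of_isEquivalence {C D : Cat.{w₁, v₁}} (l : C ⟶ D) [l.toFunctor.IsEquivalence] :
    IsEquiv l :=
  .of_iso (r := l.toFunctor.inv.toCatHom)
    (Cat.Hom.isoMk l.toFunctor.asEquivalence.unitIso)
    (Cat.Hom.isoMk l.toFunctor.asEquivalence.counitIso)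

theorem IsEquiv.isEquivalence {C D : Cat.{w₁, v₁}} {l : C ⟶ D} (h : IsEquiv l) :
    l.toFunctor.IsEquivalence := by
  obtain ⟨e, rfl⟩ := h
  exact (CategoryTheory.Equivalence.mk e.hom.toFunctor e.inv.toFunctor
    (Cat.Hom.toNatIso e.unit) (Cat.Hom.toNatIso e.counit)).isEquivalence_functor

theorem IsEquiv.postcomp_isEquivalence {a b : C} {l : a ⟶ b} (hl : IsEquiv l) (x : C) :
    (postcomp x l).IsEquivalence :=
  (hl.map (corep x)).isEquivalence

theorem IsEquiv.precomp_isEquivalence {a b : C} {l : a ⟶ b} (hl : IsEquiv l) (x : C) :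
    (precomp x l).IsEquivalence := by
  obtain ⟨e, rfl⟩ := hl
  exact (CategoryTheory.Equivalence.mk (precomp x e.hom) (precomp x e.inv)
    (NatIso.ofComponents (fun f => (λ_ f).symm ≪≫ whiskerRightIso e.counit.symm f ≪≫ α_ _ _ _)
      (by
        intro f g β
        change β ≫ (λ_ g).inv ≫ e.counit.inv ▷ g ≫ (α_ _ _ _).hom =
          ((λ_ f).inv ≫ e.counit.inv ▷ f ≫ (α_ _ _ _).hom) ≫ e.inv ◁ e.hom ◁ β
        have := whisker_exchange e.counit.inv β
        simp only [Category.assoc, ← associator_naturality_right, leftUnitor_inv_naturality_assoc]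
        rw [reassoc_of% this]))
    (NatIso.ofComponents (fun f => (α_ _ _ _).symm ≪≫ whiskerRightIso e.unit.symm f ≪≫ λ_ f) (by
        intro f g β
        change e.hom ◁ e.inv ◁ β ≫ (α_ _ _ _).inv ≫ e.unit.inv ▷ g ≫ (λ_ g).hom =
          ((α_ _ _ _).inv ≫ e.unit.inv ▷ f ≫ (λ_ f).hom) ≫ β
        have := whisker_exchange e.unit.inv β
        simp only [Category.assoc, associator_inv_naturality_right_assoc, ← leftUnitor_naturality]
        rw [reassoc_of% this]))).isEquivalence_functor

theorem IsEquiv.whiskerRight_injective {a b : C} {l : a ⟶ b} (hl : IsEquiv l) {x : C}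
    {f g : x ⟶ a} {β γ : f ⟶ g} (h : β ▷ l = γ ▷ l) : β = γ := by
  have := hl.postcomp_isEquivalence x
  exact (postcomp x l).map_injective h

theorem IsEquiv.exists_whiskerRight {a b : C} {l : a ⟶ b} (hl : IsEquiv l) {x : C}
    {f g : x ⟶ a} (β : f ≫ l ≅ g ≫ l) : ∃ γ : f ≅ g, γ.hom ▷ l = β.hom := by
  have := hl.postcomp_isEquivalence x
  exact ⟨(postcomp x l).preimageIso β, (postcomp x l).map_preimage β.hom⟩

section Pointwise
variable {X : Type u₁} [Bicategory.{w₁, v₁} X] {F G : X ⥤ᵖ C}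

/-- `n` is inverse to the naturality square of `θ` at `f`: pasting the two squares and contracting
`r ≫ θ` along `κ` gives the identity square on `G.map f`. When `θ.app y` is an equivalence, this
determines `n`. -/
structure IsInverseSquare (θ : F ⟶ G) (r : ∀ x, G.obj x ⟶ F.obj x)
    (κ : ∀ x, r x ≫ θ.app x ≅ 𝟙 (G.obj x)) {x y : X} (f : x ⟶ y)
    (n : G.map f ≫ r y ≅ r x ≫ F.map f) : Prop where
  w : n.hom ▷ θ.app y ≫ (α_ _ _ _).hom ≫ r x ◁ (θ.naturality f).hom ≫ (α_ _ _ _).inv ≫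
    (κ x).hom ▷ G.map f = (α_ _ _ _).hom ≫ G.map f ◁ (κ y).hom ≫ (ρ_ _).hom ≫ (λ_ _).inv

section
variable {θ : F ⟶ G} {r : ∀ x, G.obj x ⟶ F.obj x} {κ : ∀ x, r x ≫ θ.app x ≅ 𝟙 (G.obj x)}

theorem IsInverseSquare.naturality {x y : X} {f g : x ⟶ y} (β : f ⟶ g)
    {n : G.map f ≫ r y ≅ r x ≫ F.map f} {n' : G.map g ≫ r y ≅ r x ≫ F.map g}
    (hf : IsInverseSquare θ r κ f n) (hg : IsInverseSquare θ r κ g n') :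
    (G.map₂ β ▷ r y ≫ n'.hom) ▷ θ.app y = (n.hom ≫ r x ◁ F.map₂ β) ▷ θ.app y := by
  rw [← cancel_mono ((α_ _ _ _).hom ≫ r x ◁ (θ.naturality g).hom ≫ (α_ _ _ _).inv ≫
    (κ x).hom ▷ G.map g)]
  simp only [comp_whiskerRight, Category.assoc, hg.w, whisker_assoc, Iso.inv_hom_id_assoc]
  rw [← whiskerLeft_comp_assoc, θ.naturality_naturality, whiskerLeft_comp_assoc,
    associator_inv_naturality_right_assoc, whisker_exchange, reassoc_of% hf.w,
    associator_naturality_left_assoc, ← whisker_exchange_assoc]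
  simp

theorem IsInverseSquare.id {x : X} {n : G.map (𝟙 x) ≫ r x ≅ r x ≫ F.map (𝟙 x)}
    (h : IsInverseSquare θ r κ (𝟙 x) n) :
    (n.hom ≫ r x ◁ (F.mapId x).hom) ▷ θ.app x =
      ((G.mapId x).hom ▷ r x ≫ (λ_ (r x)).hom ≫ (ρ_ (r x)).inv) ▷ θ.app x := by
  rw [← cancel_mono ((α_ _ _ _).hom ≫ r x ◁ ((λ_ _).hom ≫ (ρ_ _).inv) ≫ (α_ _ _ _).inv ≫
    (κ x).hom ▷ 𝟙 _)]
  have e : (r x ◁ (F.mapId x).hom) ▷ θ.app x ≫ (α_ _ _ _).hom ≫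
      r x ◁ ((λ_ _).hom ≫ (ρ_ _).inv) = (α_ _ _ _).hom ≫ r x ◁ (θ.naturality (𝟙 x)).hom ≫
        r x ◁ θ.app x ◁ (G.mapId x).hom := by
    rw [← whiskerLeft_comp, θ.naturality_id]
    simp
  rw [comp_whiskerRight, Category.assoc, reassoc_of% e, associator_inv_naturality_right_assoc,
    whisker_exchange, reassoc_of% h.w]
  symm
  calc
    _ = 𝟙 _ ⊗≫ ((G.mapId x).hom ▷ (r x ≫ θ.app x) ≫ 𝟙 (G.obj x) ◁ (κ x).hom) ⊗≫ 𝟙 _ := by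
      bicategory
    _ = _ := by
      rw [← whisker_exchange]; bicategory

theorem IsInverseSquare.comp {x y z : X} {f : x ⟶ y} {g : y ⟶ z}
    {n : G.map f ≫ r y ≅ r x ≫ F.map f} {n' : G.map g ≫ r z ≅ r y ≫ F.map g}
    {n'' : G.map (f ≫ g) ≫ r z ≅ r x ≫ F.map (f ≫ g)} (hf : IsInverseSquare θ r κ f n)
    (hg : IsInverseSquare θ r κ g n') (hfg : IsInverseSquare θ r κ (f ≫ g) n'') :
    (n''.hom ≫ r x ◁ (F.mapComp f g).hom) ▷ θ.app z =
      ((G.mapComp f g).hom ▷ r z ≫ (α_ _ _ _).hom ≫ G.map f ◁ n'.hom ≫ (α_ _ _ _).inv ≫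
        n.hom ▷ F.map g ≫ (α_ _ _ _).hom) ▷ θ.app z := by
  rw [← cancel_mono ((α_ _ _ _).hom ≫ r x ◁ ((α_ _ _ _).hom ≫ F.map f ◁ (θ.naturality g).hom ≫
    (α_ _ _ _).inv ≫ (θ.naturality f).hom ▷ G.map g ≫ (α_ _ _ _).hom) ≫ (α_ _ _ _).inv ≫
      (κ x).hom ▷ (G.map f ≫ G.map g))]
  have e : (r x ◁ (F.mapComp f g).hom) ▷ θ.app z ≫ (α_ _ _ _).hom ≫
      r x ◁ ((α_ _ _ _).hom ≫ F.map f ◁ (θ.naturality g).hom ≫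
    (α_ _ _ _).inv ≫ (θ.naturality f).hom ▷ G.map g ≫ (α_ _ _ _).hom) =
        (α_ _ _ _).hom ≫ r x ◁ (θ.naturality (f ≫ g)).hom ≫
        r x ◁ θ.app x ◁ (G.mapComp f g).hom := by
    rw [← whiskerLeft_comp, θ.naturality_comp]
    simp
  rw [comp_whiskerRight, Category.assoc, reassoc_of% e, associator_inv_naturality_right_assoc,
    whisker_exchange, reassoc_of% hfg.w]
  symm
  calc
    _ = 𝟙 _ ⊗≫ (G.mapComp f g).hom ▷ (r z ≫ θ.app z) ⊗≫ G.map f ◁ n'.hom ▷ θ.app z ⊗≫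
        (n.hom ▷ (F.map g ≫ θ.app z) ≫ (r x ≫ F.map f) ◁ (θ.naturality g).hom) ⊗≫
        r x ◁ (θ.naturality f).hom ▷ G.map g ⊗≫ (κ x).hom ▷ (G.map f ≫ G.map g) ⊗≫ 𝟙 _ := by
      bicategory
    _ = 𝟙 _ ⊗≫ (G.mapComp f g).hom ▷ (r z ≫ θ.app z) ⊗≫ G.map f ◁ n'.hom ▷ θ.app z ⊗≫
        G.map f ◁ r y ◁ (θ.naturality g).hom ⊗≫
        (n.hom ▷ θ.app y ≫ (α_ _ _ _).hom ≫ r x ◁ (θ.naturality f).hom ≫ (α_ _ _ _).inv ≫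
      (κ x).hom ▷ G.map f) ▷ G.map g ⊗≫ 𝟙 _ := by
      rw [← whisker_exchange]; bicategory
    _ = 𝟙 _ ⊗≫ (G.mapComp f g).hom ▷ (r z ≫ θ.app z) ⊗≫
        G.map f ◁ (n'.hom ▷ θ.app z ≫ (α_ _ _ _).hom ≫ r y ◁ (θ.naturality g).hom ≫
          (α_ _ _ _).inv ≫ (κ y).hom ▷ G.map g) ⊗≫ 𝟙 _ := by
      rw [hf.w]; bicategory
    _ = 𝟙 _ ⊗≫ ((G.mapComp f g).hom ▷ (r z ≫ θ.app z) ≫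
        (G.map f ≫ G.map g) ◁ (κ z).hom) ⊗≫ 𝟙 _ := by
      rw [hg.w]; bicategory
    _ = _ := by
      rw [← whisker_exchange]; bicategory

end

variable (θ : F ⟶ G) (r : ∀ x, G.obj x ⟶ F.obj x) (κ : ∀ x, r x ≫ θ.app x ≅ 𝟙 (G.obj x))
  (hθ : ∀ x, IsEquiv (θ.app x))

theorem exists_isInverseSquare {x y : X} (hy : IsEquiv (θ.app y)) (f : x ⟶ y) :
    ∃ n, IsInverseSquare θ r κ f n := by
  obtain ⟨n, hn⟩ := hy.exists_whiskerRight (α_ _ _ _ ≪≫ whiskerLeftIso (G.map f) (κ y) ≪≫ ρ_ _ ≪≫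
    (λ_ _).symm ≪≫ whiskerRightIso (κ x).symm (G.map f) ≪≫ α_ _ _ _ ≪≫
    whiskerLeftIso (r x) (θ.naturality f).symm ≪≫ (α_ _ _ _).symm)
  exact ⟨n, ⟨by simp [hn]⟩⟩

/-- A choice of inverse of the naturality square of `θ` at `f`. -/
noncomputable def inverseSquare {x y : X} (f : x ⟶ y) : G.map f ≫ r y ≅ r x ≫ F.map f :=
  (exists_isInverseSquare θ r κ (hθ y) f).choose

theorem isInverseSquare_inverseSquare {x y : X} (f : x ⟶ y) :
    IsInverseSquare θ r κ f (inverseSquare θ r κ hθ f) :=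
  (exists_isInverseSquare θ r κ (hθ y) f).choose_spec

/-- The pseudonatural transformation with components `r` inverse to those of `θ`. -/
noncomputable def pointwiseInverse : G ⟶ F where
  app := r
  naturality f := inverseSquare θ r κ hθ f
  naturality_naturality {_ y _ _} β := (hθ y).whiskerRight_injective <|
    (isInverseSquare_inverseSquare θ r κ hθ _).naturality β (isInverseSquare_inverseSquare ..)
  naturality_id x := (hθ x).whiskerRight_injective (isInverseSquare_inverseSquare θ r κ hθ _).id
  naturality_comp {_ _ z} _ _ := (hθ z).whiskerRight_injective <|
    (isInverseSquare_inverseSquare θ r κ hθ _).comp (isInverseSquare_inverseSquare ..)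
      (isInverseSquare_inverseSquare ..)

/-- `κ` is an invertible modification from `pointwiseInverse ≫ θ` to the identity. -/
noncomputable def pointwiseInverseCompIso : pointwiseInverse θ r κ hθ ≫ θ ≅ 𝟙 G :=
  Pseudofunctor.StrongTrans.isoMk κ (by
    intro x y f
    have h := (isInverseSquare_inverseSquare θ r κ hθ f).w
    change G.map f ◁ (κ y).hom ≫ (ρ_ _).hom ≫ (λ_ _).inv = ((α_ _ _ _).inv ≫
      (inverseSquare θ r κ hθ f).hom ▷ θ.app y ≫ (α_ _ _ _).hom ≫
      r x ◁ (θ.naturality f).hom ≫ (α_ _ _ _).inv) ≫ (κ x).hom ▷ G.map f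
    simp only [Category.assoc, h, Iso.inv_hom_id_assoc])

end Pointwise

theorem exists_pointwiseInverse {X : Type u₁} [Bicategory.{w₁, v₁} X] {F G : X ⥤ᵖ C} (θ : F ⟶ G)
    (hθ : ∀ x, IsEquiv (θ.app x)) :
    ∃ θ' : G ⟶ F, (∀ x, IsEquiv (θ'.app x)) ∧ Nonempty (θ' ≫ θ ≅ 𝟙 G) := by
  choose e he using hθ
  refine ⟨pointwiseInverse θ (fun x => (e x).inv)
    (fun x => eqToIso (by rw [he]) ≪≫ (e x).counit) (fun x => ⟨e x, he x⟩),
    fun x => isEquiv_inv (e x), ⟨pointwiseInverseCompIso _ _ _ _⟩⟩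

theorem isEquiv_of_pointwise {X : Type u₁} [Bicategory.{w₁, v₁} X] {F G : X ⥤ᵖ C} (θ : F ⟶ G)
    (hθ : ∀ x, IsEquiv (θ.app x)) : IsEquiv θ := by
  obtain ⟨φ, hφ, ⟨i⟩⟩ := exists_pointwiseInverse θ hθ
  obtain ⟨κ, -, ⟨j⟩⟩ := exists_pointwiseInverse φ hφ
  refine .of_iso (r := φ) ?_ i
  exact j.symm ≪≫ whiskerRightIso ((ρ_ κ).symm ≪≫ whiskerLeftIso κ i.symm ≪≫
    (α_ _ _ _).symm ≪≫ whiskerRightIso j θ ≪≫ λ_ θ) φ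

theorem IsEquiv.app {X : Type u₁} [Bicategory.{w₁, v₁} X] {F G : X ⥤ᵖ C} {θ : F ⟶ G}
    (hθ : IsEquiv θ) (x : X) : IsEquiv (θ.app x) := by
  obtain ⟨e, rfl⟩ := hθ
  exact .of_iso (r := e.inv.app x)
    ⟨e.unit.hom.as.app x, e.unit.inv.as.app x,
      congrArg (fun m => m.as.app x) e.unit.hom_inv_id,
      congrArg (fun m => m.as.app x) e.unit.inv_hom_id⟩
    ⟨e.counit.hom.as.app x, e.counit.inv.as.app x,
      congrArg (fun m => m.as.app x) e.counit.hom_inv_id,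
      congrArg (fun m => m.as.app x) e.counit.inv_hom_id⟩

end Equivalences

section UniversalElement

variable {A : Type u₁} [Bicategory.{w₁, v₁} A] {F G : A ⥤ᵖ Cat.{w₂, v₂}}

/-- The functor `f ↦ (F f) u`. -/
def evalFunctor (F : A ⥤ᵖ Cat.{w₂, v₂}) {a : A} (u : F.obj a) (b : A) : (a ⟶ b) ⥤ F.obj b where
  obj f := (F.map f).toFunctor.obj u
  map γ := (F.map₂ γ).toNatTrans.app u
  map_id f := by rw [F.map₂_id]; rfl
  map_comp γ δ := by rw [F.map₂_comp]; rfl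

/-- `u` is a universal element if the functors `f ↦ (F f) u` are equivalences. -/
def IsUniversalElement (F : A ⥤ᵖ Cat.{w₂, v₂}) {a : A} (u : F.obj a) : Prop :=
  ∀ b, (evalFunctor F u b).IsEquivalence

/-- A family of 1-cells that is natural up to isomorphism; unlike for pseudonatural
transformations, the isomorphisms need not be compatible with identities and composition. -/
structure PreTrans {K : Type u₂} [Bicategory.{w₃, v₃} K] (F G : A ⥤ᵖ K) where
  app (a : A) : F.obj a ⟶ G.obj a
  naturality {a b : A} (f : a ⟶ b) : F.map f ≫ app b ≅ app a ≫ G.map f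
  naturality_naturality {a b : A} {f g : a ⟶ b} (γ : f ⟶ g) :
    F.map₂ γ ▷ app b ≫ (naturality g).hom = (naturality f).hom ≫ app a ◁ G.map₂ γ

/-- The family underlying a pseudonatural transformation. -/
def PreTrans.ofTrans {K : Type u₂} [Bicategory.{w₃, v₃} K] {F G : A ⥤ᵖ K} (θ : F ⟶ G) :
    PreTrans F G :=
  ⟨θ.app, θ.naturality, θ.naturality_naturality⟩

/-- The image of a family under a pseudofunctor. -/
def PreTrans.post {K : Type u₂} [Bicategory.{w₃, v₃} K] {F G : A ⥤ᵖ K} (θ : PreTrans F G)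
    {L : Type u₄} [Bicategory.{w₄, v₄} L] (H : K ⥤ᵖ L) : PreTrans (F.comp H) (G.comp H) where
  app a := H.map (θ.app a)
  naturality f := mapSquare H (θ.naturality f)
  naturality_naturality {_ _ f g} γ := mapSquare_naturality H (θ.naturality f) (θ.naturality g)
    (F.map₂ γ) (G.map₂ γ) (θ.naturality_naturality γ)

/-- Evaluation followed by a component of `θ` is evaluation at the image of the element. -/
def evalFunctorCompIso (θ : PreTrans F G) {a : A} (u : F.obj a) (b : A) :
    evalFunctor F u b ⋙ (θ.app b).toFunctor ≅ evalFunctor G ((θ.app a).toFunctor.obj u) b :=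
  NatIso.ofComponents (fun f => (Cat.Hom.toNatIso (θ.naturality f)).app u) (by
    intro f g γ
    exact congrArg (fun m => m.toNatTrans.app u) (θ.naturality_naturality γ))

theorem IsUniversalElement.congr {a : A} {u u' : F.obj a} (hu : IsUniversalElement F u)
    (i : u ≅ u') : IsUniversalElement F u' := by
  intro b
  have := hu b
  exact Functor.isEquivalence_of_iso (F := evalFunctor F u b)
    (NatIso.ofComponents (fun f => (F.map f).toFunctor.mapIso i)
      (fun {f g} γ => ((F.map₂ γ).toNatTrans.naturality i.hom).symm))

theorem IsUniversalElement.map {a : A} {u : F.obj a} (hu : IsUniversalElement F u)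
    (θ : PreTrans F G) (hθ : ∀ b, IsEquiv (θ.app b)) :
    IsUniversalElement G ((θ.app a).toFunctor.obj u) := by
  intro b
  have := hu b
  have := (hθ b).isEquivalence
  exact Functor.isEquivalence_of_iso (evalFunctorCompIso θ u b)

theorem IsUniversalElement.of_map {a : A} {u : F.obj a} (θ : PreTrans F G)
    (hθ : ∀ b, IsEquiv (θ.app b)) (hu : IsUniversalElement G ((θ.app a).toFunctor.obj u)) :
    IsUniversalElement F u := by
  intro b
  have := hu b
  have := (hθ b).isEquivalence
  have := Functor.isEquivalence_of_iso (evalFunctorCompIso θ u b).symm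
  exact Functor.isEquivalence_of_comp_right (evalFunctor F u b) (θ.app b).toFunctor

theorem PreTrans.exists_isUniversalElement_iff (θ : PreTrans F G) (hθ : ∀ b, IsEquiv (θ.app b))
    (a : A) : (∃ u : F.obj a, IsUniversalElement F u) ↔ ∃ u : G.obj a, IsUniversalElement G u := by
  constructor
  · rintro ⟨u, hu⟩
    exact ⟨_, hu.map θ hθ⟩
  · rintro ⟨u, hu⟩
    have := (hθ a).isEquivalence
    exact ⟨(θ.app a).toFunctor.objPreimage u, .of_map θ hθ
      (hu.congr ((θ.app a).toFunctor.objObjPreimageIso u).symm)⟩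

theorem isUniversalElement_id (a : A) : IsUniversalElement (corep a) (𝟙 a : a ⟶ a) := by
  intro b
  exact Functor.isEquivalence_of_iso (F := 𝟭 (a ⟶ b))
    (NatIso.ofComponents (fun f => (λ_ f).symm) (by
    intro f g γ
    exact leftUnitor_inv_naturality γ))

theorem evalFunctor_mapComp_naturality {a b c : A} (u : F.obj a) {f f' : a ⟶ b} (γ : f ⟶ f')
    (g : b ⟶ c) :
    (F.map₂ (γ ▷ g)).toNatTrans.app u ≫ (F.mapComp f' g).hom.toNatTrans.app u =
      (F.mapComp f g).hom.toNatTrans.app u ≫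
        (F.map g).toFunctor.map ((F.map₂ γ).toNatTrans.app u) := by
  have h : F.map₂ (γ ▷ g) ≫ (F.mapComp f' g).hom = (F.mapComp f g).hom ≫ F.map₂ γ ▷ F.map g := by
    simp
  exact congrArg (fun m => m.toNatTrans.app u) h

variable {F : A ⥤ᵖ Cat.{w₁, v₁}}

/-- The pseudonatural transformation determined by an element. -/
def yonedaTrans (F : A ⥤ᵖ Cat.{w₁, v₁}) {a : A} (u : F.obj a) : corep a ⟶ F where
  app b := (evalFunctor F u b).toCatHom
  naturality {b c} g := Cat.Hom.isoMk (NatIso.ofComponents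
    (fun f => (Cat.Hom.toNatIso (F.mapComp f g)).app u)
    (fun {f f'} γ => evalFunctor_mapComp_naturality u γ g))
  naturality_naturality {b c g h} γ := cat_hom₂_ext fun (f : a ⟶ b) => by
    have h : F.map₂ (f ◁ γ) ≫ (F.mapComp f h).hom = (F.mapComp f g).hom ≫ F.map f ◁ F.map₂ γ := by
      simp
    exact congrArg (fun m => m.toNatTrans.app u) h
  naturality_id b := cat_hom₂_ext fun (f : a ⟶ b) => by
    have h : (F.mapComp f (𝟙 b)).hom.toNatTrans.app u ≫
        (F.mapId b).hom.toNatTrans.app ((F.map f).toFunctor.obj u) =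
          (F.map₂ (ρ_ f).hom).toNatTrans.app u ≫ 𝟙 _ ≫ 𝟙 _ := by simp
    exact h
  naturality_comp {b c d} g h := cat_hom₂_ext fun (f : a ⟶ b) => by
    have hcomp : (F.mapComp f (g ≫ h)).hom ≫ F.map f ◁ (F.mapComp g h).hom =
        F.map₂ (α_ f g h).inv ≫ (F.mapComp (f ≫ g) h).hom ≫ (F.mapComp f g).hom ▷ F.map h ≫
          (α_ _ _ _).hom := by simp [map₂_associator_inv]
    have hcomp_app : (F.mapComp f (g ≫ h)).hom.toNatTrans.app u ≫
        (F.mapComp g h).hom.toNatTrans.app ((F.map f).toFunctor.obj u) =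
          (F.map₂ (α_ f g h).inv).toNatTrans.app u ≫ 𝟙 _ ≫
          (F.mapComp (f ≫ g) h).hom.toNatTrans.app u ≫ 𝟙 _ ≫
          (F.map h).toFunctor.map ((F.mapComp f g).hom.toNatTrans.app u) ≫ 𝟙 _ := by
      simpa using congrArg (fun m => m.toNatTrans.app u) hcomp
    exact hcomp_app

theorem IsUniversalElement.isEquiv_yonedaTrans {a : A} {u : F.obj a} (hu : IsUniversalElement F u) :
    IsEquiv (yonedaTrans F u) :=
  isEquiv_of_pointwise _ fun b =>
    have : (evalFunctor F u b).toCatHom.toFunctor.IsEquivalence := hu b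
    isEquiv_of_isEquivalence (evalFunctor F u b).toCatHom

theorem exists_isUniversalElement_iff (F : A ⥤ᵖ Cat.{w₁, v₁}) (a : A) :
    (∃ u : F.obj a, IsUniversalElement F u) ↔ Nonempty (Bicategory.Equivalence (corep a) F) := by
  constructor
  · rintro ⟨u, hu⟩
    exact ⟨hu.isEquiv_yonedaTrans.choose⟩
  · rintro ⟨e⟩
    exact ⟨_, (isUniversalElement_id a).map (.ofTrans e.hom) fun b => (isEquiv_hom e).app b⟩

end UniversalElement

section OfBiadjunction
variable {A : Type u₁} [Bicategory.{w₁, v₁} A] {B : Type u₂} [Bicategory.{w₂, v₂} B]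
  {L : B ⥤ᵖ A} {J : A ⥤ᵖ B}

/-- The functor `g ↦ L g ≫ k`. -/
def mapPrecomp (L : B ⥤ᵖ A) {x : B} {b : A} (k : L.obj x ⟶ b) (y : B) :
    (y ⟶ x) ⥤ (L.obj y ⟶ b) where
  obj g := L.map g ≫ k
  map γ := L.map₂ γ ▷ k

section
variable {y : B} (u : y ⟶ J.obj (L.obj y)) (κ : ∀ a, L.obj (J.obj a) ⟶ a)
  (m : ∀ {a b : A} (f : a ⟶ b), L.map (J.map f) ≫ κ b ≅ κ a ≫ f)
  (hm : ∀ {a b : A} {f g : a ⟶ b} (γ : f ⟶ g),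
    L.map₂ (J.map₂ γ) ▷ κ b ≫ (m g).hom = (m f).hom ≫ κ a ◁ γ)
  (t : 𝟙 (L.obj y) ≅ L.map u ≫ κ (L.obj y))

/-- The isomorphism `f ≅ L (u ≫ J f) ≫ κ` obtained from `t` and the naturality `m` of `κ`. -/
def homUnitIso (b : A) :
    𝟭 (L.obj y ⟶ b) ≅ transposeFunctor J u b ⋙ mapPrecomp L (κ b) y :=
  NatIso.ofComponents (fun f => (λ_ f).symm ≪≫ whiskerRightIso t f ≪≫ α_ _ _ _ ≪≫
    whiskerLeftIso (L.map u) (m f).symm ≪≫ (α_ _ _ _).symm ≪≫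
    whiskerRightIso (L.mapComp u (J.map f)).symm (κ b)) (by
    intro f g γ
    change γ ≫ (λ_ g).inv ≫ t.hom ▷ g ≫ (α_ _ _ _).hom ≫ L.map u ◁ (m g).inv ≫ (α_ _ _ _).inv ≫
      (L.mapComp u (J.map g)).inv ▷ κ b = ((λ_ f).inv ≫ t.hom ▷ f ≫ (α_ _ _ _).hom ≫
      L.map u ◁ (m f).inv ≫ (α_ _ _ _).inv ≫ (L.mapComp u (J.map f)).inv ▷ κ b) ≫
      L.map₂ (u ◁ J.map₂ γ) ▷ κ b
    have h : (m f).inv ≫ L.map₂ (J.map₂ γ) ▷ κ b = κ (L.obj y) ◁ γ ≫ (m g).inv := by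
      rw [Iso.inv_comp_eq, ← Category.assoc, ← hm, Category.assoc, Iso.hom_inv_id,
        Category.comp_id]
    have hL := congrArg (L.map u ◁ ·) h
    simp only [whiskerLeft_comp] at hL
    simp only [L.map₂_whisker_left, comp_whiskerRight, Category.assoc, inv_hom_whiskerRight_assoc,
      whisker_assoc, Iso.inv_hom_id_assoc, reassoc_of% hL]
    rw [leftUnitor_inv_naturality_assoc, whisker_exchange_assoc]
    simp)

end

section
variable {y : B} (u : ∀ x, x ⟶ J.obj (L.obj x)) {b : A} (k : L.obj (J.obj b) ⟶ b)
  (n : ∀ {x : B} (f : y ⟶ x), f ≫ u x ≅ u y ≫ J.map (L.map f))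
  (hn : ∀ {x : B} {f g : y ⟶ x} (γ : f ⟶ g),
    γ ▷ u x ≫ (n g).hom = (n f).hom ≫ u y ◁ J.map₂ (L.map₂ γ))
  (t : u (J.obj b) ≫ J.map k ≅ 𝟙 (J.obj b))

/-- The isomorphism `u ≫ J (L f ≫ k) ≅ f` obtained from `t` and the naturality `n` of `u`. -/
def homCounitIso : mapPrecomp L k y ⋙ transposeFunctor J (u y) b ≅ 𝟭 (y ⟶ J.obj b) :=
  NatIso.ofComponents (fun f => whiskerLeftIso (u y) (J.mapComp (L.map f) k) ≪≫ (α_ _ _ _).symm ≪≫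
    whiskerRightIso (n f).symm (J.map k) ≪≫ α_ _ _ _ ≪≫ whiskerLeftIso f t ≪≫ ρ_ f) (by
    intro f g γ
    change u y ◁ J.map₂ (L.map₂ γ ▷ k) ≫ u y ◁ (J.mapComp (L.map g) k).hom ≫ (α_ _ _ _).inv ≫
      (n g).inv ▷ J.map k ≫ (α_ _ _ _).hom ≫ g ◁ t.hom ≫ (ρ_ g).hom =
      (u y ◁ (J.mapComp (L.map f) k).hom ≫ (α_ _ _ _).inv ≫
      (n f).inv ▷ J.map k ≫ (α_ _ _ _).hom ≫ f ◁ t.hom ≫ (ρ_ f).hom) ≫ γ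
    have h : u y ◁ J.map₂ (L.map₂ γ) ≫ (n g).inv = (n f).inv ≫ γ ▷ u (J.obj b) := by
      rw [Iso.eq_inv_comp, ← Category.assoc, ← hn, Category.assoc, Iso.hom_inv_id,
        Category.comp_id]
    have hJ := congrArg (· ▷ J.map k) h
    simp only [comp_whiskerRight, whisker_assoc, Category.assoc] at hJ
    simp only [J.map₂_whisker_right, whiskerLeft_comp, Category.assoc, whiskerLeft_inv_hom_assoc,
      ← rightUnitor_naturality]
    have hex := whisker_exchange γ t.hom
    simp only [whiskerRight_comp, Category.assoc] at hex
    rw [reassoc_of% hex, Iso.hom_inv_id_assoc, ← reassoc_of% hJ, Iso.inv_hom_id_assoc])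

end

theorem Biadjunction.isUniversalArrow (h : Biadjunction L J) (y : B) :
    IsUniversalArrow J (c := L.obj y) (h.unit.app y) := by
  intro b
  exact (CategoryTheory.Equivalence.mk (transposeFunctor J (h.unit.app y) b)
    (mapPrecomp L (h.counit.app b) y)
    (homUnitIso (h.unit.app y) h.counit.app (fun f => h.counit.naturality f)
      (fun γ => h.counit.naturality_naturality γ)
      ⟨h.leftMod.hom.as.app y, h.leftMod.inv.as.app y,
        congrArg (fun m => m.as.app y) h.leftMod.hom_inv_id,
        congrArg (fun m => m.as.app y) h.leftMod.inv_hom_id⟩ b)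
    (homCounitIso h.unit.app (h.counit.app b) (fun f => h.unit.naturality f)
      (fun γ => h.unit.naturality_naturality γ)
      ⟨h.rightMod.hom.as.app b, h.rightMod.inv.as.app b,
        congrArg (fun m => m.as.app b) h.rightMod.hom_inv_id,
        congrArg (fun m => m.as.app b) h.rightMod.inv_hom_id⟩)).isEquivalence_functor

theorem exists_biadjunction (G : B → A) (u : ∀ y, y ⟶ J.obj (G y))
    (hu : ∀ y, IsUniversalArrow J (u y)) :
    ∃ L : B ⥤ᵖ A, (∀ y, L.obj y = G y) ∧ Nonempty (Biadjunction L J) :=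
  ⟨universalFunctor (K := Pseudofunctor.id B) G u hu, fun _ => rfl, ⟨universalBiadjunction G u hu⟩⟩

theorem isUniversalElement_comp_corep_iff {y : B} {a : A} (u : y ⟶ J.obj a) :
    IsUniversalElement (J.comp (corep y)) (a := a) u ↔ IsUniversalArrow J u := Iff.rfl

end OfBiadjunction

section CurryTrans

theorem mapSquare_trans {X : Type u₁} [Bicategory.{w₁, v₁} X] {K : Type u₂} [Bicategory.{w₂, v₂} K]
    {P Q : X ⥤ᵖ K} (θ : P ⟶ Q) {x y x' y' : X} {g : x ⟶ y} {g' : x' ⟶ y'} {t : x ⟶ x'}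
    {t' : y ⟶ y'} (σ : g ≫ t' ≅ t ≫ g') :
    P.map g ◁ (θ.naturality t').hom ≫ (α_ _ _ _).inv ≫ (θ.naturality g).hom ▷ Q.map t' ≫
        (α_ _ _ _).hom ≫ θ.app x ◁ (mapSquare Q σ).hom ≫ (α_ _ _ _).inv =
      ((α_ _ _ _).inv ≫ (mapSquare P σ).hom ▷ θ.app y' ≫ (α_ _ _ _).hom ≫
        P.map t ◁ (θ.naturality g').hom ≫ (α_ _ _ _).inv) ≫ (θ.naturality t).hom ▷ Q.map g' := by
  have naturality_gt' :
      P.map g ◁ (θ.naturality t').hom ≫ (α_ _ _ _).inv ≫ (θ.naturality g).hom ▷ Q.map t' ≫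
        (α_ _ _ _).hom = (α_ _ _ _).inv ≫ (P.mapComp g t').inv ▷ θ.app y' ≫
        (θ.naturality (g ≫ t')).hom ≫ θ.app x ◁ (Q.mapComp g t').hom := by
    rw [θ.naturality_comp g t']
    simp
  have naturality_tg' :
      (P.mapComp t g').hom ▷ θ.app y' ≫ (α_ _ _ _).hom ≫ P.map t ◁ (θ.naturality g').hom ≫
        (α_ _ _ _).inv ≫ (θ.naturality t).hom ▷ Q.map g' =
      (θ.naturality (t ≫ g')).hom ≫ θ.app x ◁ (Q.mapComp t g').hom ≫ (α_ _ _ _).inv := by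
    rw [reassoc_of% (θ.naturality_comp t g')]
    simp
  simp only [mapSquare, Iso.trans_hom, Iso.symm_hom, P.map₂Iso_hom, Q.map₂Iso_hom, whiskerLeft_comp,
    comp_whiskerRight, Category.assoc]
  rw [reassoc_of% naturality_gt', naturality_tg', reassoc_of% (θ.naturality_naturality σ.hom),
    whiskerLeft_hom_inv_assoc]

variable {S : Type u₁} [Bicategory.{w₁, v₁} S] {A : Type u₂} [Bicategory.{w₂, v₂} A]
  {K : Type u₃} [Bicategory.{w₃, v₃} K] {P Q : S × A ⥤ᵖ K}

open CategoryTheory.Prod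

/-- A pseudonatural transformation `P ⟶ Q` of pseudofunctors on `S × A`, regarded as a family of
1-cells `P(-, a) ⟶ Q(-, a)` of `[S, K]_PS`, natural in `a`. -/
def curryTrans (θ : P ⟶ Q) : PreTrans (curry P) (curry Q) where
  app a := preWhisker (Bicategory.Prod.sectL S a).toPseudofunctor θ
  naturality f := Pseudofunctor.StrongTrans.isoMk (fun s => θ.naturality (𝟙 s ×ₘ f))
    (fun g => mapSquare_trans θ (interchange g f))
  naturality_naturality {_ _ f g} γ := Pseudofunctor.StrongTrans.homCategory.ext fun s =>
    θ.naturality_naturality (f := 𝟙 s ×ₘ f) (g := 𝟙 s ×ₘ g) (𝟙 (𝟙 s), γ)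

end CurryTrans

section Evaluation
open CategoryTheory.Prod

/-- The one-object discrete category. Hom pseudofunctors of `Cat` are tested on it only. -/
abbrev pt : Cat.{v, v} := Cat.of (Discrete PUnit.{v + 1})

/-- Evaluation at the point, the equivalence `Cat(pt, C) ≃ C`. -/
def evalPt (C : Cat.{v, v}) : Cat.of (pt.{v} ⟶ C) ⟶ C :=
  Functor.toCatHom
    { obj := fun h => h.toFunctor.obj ⟨⟨⟩⟩
      map := fun η => η.toNatTrans.app ⟨⟨⟩⟩ }

theorem isEquiv_evalPt (C : Cat.{v, v}) : IsEquiv (evalPt C) := by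
  have : (evalPt C).toFunctor.IsEquivalence :=
    { faithful := ⟨fun e => cat_hom₂_ext fun ⟨⟨⟩⟩ => e⟩
      full := ⟨fun η => ⟨NatTrans.toCatHom₂ (Discrete.natTrans fun ⟨⟨⟩⟩ => η), rfl⟩⟩
      essSurj := ⟨fun c => ⟨((Functor.const (Discrete PUnit)).obj c).toCatHom, ⟨Iso.refl _⟩⟩⟩ }
  exact isEquiv_of_isEquivalence _

theorem evalPt_naturality {C D : Cat.{v, v}} (F : C ⟶ D) {h k : pt ⟶ C} (η : h ⟶ k) :
    F.toFunctor.map (η.toNatTrans.app ⟨⟨⟩⟩) ≫ 𝟙 (F.toFunctor.obj (k.toFunctor.obj ⟨⟨⟩⟩)) =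
      𝟙 (F.toFunctor.obj (h.toFunctor.obj ⟨⟨⟩⟩)) ≫ F.toFunctor.map (η.toNatTrans.app ⟨⟨⟩⟩) :=
  (Category.comp_id _).trans (Category.id_comp _).symm

/-- The component at the point of the 2-cell that the hom pseudofunctor assigns to `h` and `γ`.
It equals `γ_{h pt}`, but only after the identity `h (𝟙 pt)` left behind by unfolding is removed. -/
def evalMap₂ {C D : Cat.{v, v}} (h : pt ⟶ C) {F G : C ⟶ D} (γ : F ⟶ G) :
    F.toFunctor.obj (h.toFunctor.obj ⟨⟨⟩⟩) ⟶ G.toFunctor.obj (h.toFunctor.obj ⟨⟨⟩⟩) :=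
  F.toFunctor.map (h.toFunctor.map (𝟙 (Discrete.mk PUnit.unit))) ≫
    γ.toNatTrans.app (h.toFunctor.obj ⟨⟨⟩⟩)

theorem evalMap₂_eq {C D : Cat.{v, v}} (h : pt ⟶ C) {F G : C ⟶ D} (γ : F ⟶ G) :
    evalMap₂ h γ = γ.toNatTrans.app (h.toFunctor.obj ⟨⟨⟩⟩) := by
  have e : F.toFunctor.map (h.toFunctor.map (𝟙 (Discrete.mk PUnit.unit))) = 𝟙 _ :=
    (congrArg F.toFunctor.map (h.toFunctor.map_id _)).trans (F.toFunctor.map_id _)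
  exact (congrArg (· ≫ γ.toNatTrans.app _) e).trans (Category.id_comp _)

theorem evalPt_map₂ {C D : Cat.{v, v}} (h : pt ⟶ C) {F G : C ⟶ D} (γ : F ⟶ G) :
    evalMap₂ h γ ≫ 𝟙 (G.toFunctor.obj (h.toFunctor.obj ⟨⟨⟩⟩)) =
    𝟙 (F.toFunctor.obj (h.toFunctor.obj ⟨⟨⟩⟩)) ≫ γ.toNatTrans.app (h.toFunctor.obj ⟨⟨⟩⟩) := by
  rw [evalMap₂_eq, Category.id_comp, Category.comp_id]

variable {A : Type u₁} [Bicategory.{w₁, v₁} A]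

/-- The equivalences `Cat(pt, Q a) ≃ Q a`, natural in `a`. -/
def evalTrans (Q : A ⥤ᵖ Cat.{v, v}) : PreTrans (sliceRight (homTo Q) (op pt)) Q where
  app a := evalPt (Q.obj a)
  naturality f := Cat.Hom.isoMk (NatIso.ofComponents (fun _ => Iso.refl _)
    (fun η => evalPt_naturality (Q.map f) η))
  naturality_naturality {a _ _ _} γ := cat_hom₂_ext fun (h : pt ⟶ Q.obj a) =>
    evalPt_map₂ h (Q.map₂ γ)

variable {S : Type u₂} [Bicategory.{w₂, v₂} S]

/-- The equivalences `Cat(pt, T(s, a)) ≃ T(s, a)`, pseudonatural in `s` for fixed `a`. -/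
def evalSlice (T : S × A ⥤ᵖ Cat.{v, v}) (a : A) :
    slice ((prodExchange S Cat.{v, v}ᵒᵖ A).comp (homTo T)) (op pt, a) ⟶ slice T a where
  app s := evalPt (T.obj (s, a))
  naturality f := Cat.Hom.isoMk (NatIso.ofComponents (fun _ => Iso.refl _)
    (fun η => evalPt_naturality (T.map (f ×ₘ 𝟙 a)) η))
  naturality_naturality {s t f g} γ := cat_hom₂_ext fun (h : pt ⟶ T.obj (s, a)) =>
    evalPt_map₂ h (T.map₂ ((γ, 𝟙 (𝟙 a)) : (f ×ₘ 𝟙 a) ⟶ (g ×ₘ 𝟙 a)))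
  naturality_id s := cat_hom₂_ext fun (h : pt ⟶ T.obj (s, a)) => by
    have e : 𝟙 _ ≫ ((T.map₂ (𝟙 (𝟙 (s, a)))).toNatTrans.app (h.toFunctor.obj ⟨⟨⟩⟩) ≫
        (T.mapId (s, a)).hom.toNatTrans.app (h.toFunctor.obj ⟨⟨⟩⟩)) =
      (evalMap₂ h (T.map₂ (𝟙 (𝟙 (s, a)))) ≫ evalMap₂ h (T.map₂ (𝟙 (𝟙 (s, a)))) ≫
        evalMap₂ h (T.mapId (s, a)).hom ≫ 𝟙 _ ≫ 𝟙 _) ≫ 𝟙 _ ≫ 𝟙 _ := by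
      simp only [T.map₂_id]
      simp [evalMap₂_eq]
    exact e
  naturality_comp {s t r} f g := cat_hom₂_ext fun (h : pt ⟶ T.obj (s, a)) => by
    let i : (f ≫ g) ×ₘ 𝟙 a ⟶ (f ×ₘ 𝟙 a) ≫ (g ×ₘ 𝟙 a) := (𝟙 (f ≫ g), (λ_ (𝟙 a)).inv)
    have e : 𝟙 _ ≫ ((T.map₂ i).toNatTrans.app (h.toFunctor.obj ⟨⟨⟩⟩) ≫
        (T.mapComp (f ×ₘ 𝟙 a) (g ×ₘ 𝟙 a)).hom.toNatTrans.app (h.toFunctor.obj ⟨⟨⟩⟩)) =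
      (evalMap₂ h (T.map₂ i) ≫ evalMap₂ h (T.map₂ (𝟙 ((f ×ₘ 𝟙 a) ≫ (g ×ₘ 𝟙 a)))) ≫
        evalMap₂ h (T.mapComp (f ×ₘ 𝟙 a) (g ×ₘ 𝟙 a)).hom ≫ 𝟙 _ ≫ 𝟙 _ ≫ 𝟙 _) ≫ 𝟙 _ ≫ 𝟙 _ ≫
        𝟙 _ ≫ (T.map (g ×ₘ 𝟙 a)).toFunctor.map (𝟙 _) ≫ 𝟙 _ := by
      simp only [T.map₂_id]
      simp [evalMap₂_eq]
    exact e

/-- The equivalences `Cat(pt, T(-, a)) ≃ T(-, a)` of `[S, Cat]_PS`, natural in `a`. -/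
def evalCurry (T : S × A ⥤ᵖ Cat.{v, v}) :
    PreTrans ((Bicategory.Prod.sectR (op pt) A).toPseudofunctor.comp
      (curry ((prodExchange S Cat.{v, v}ᵒᵖ A).comp (homTo T)))) (curry T) where
  app a := evalSlice T a
  naturality {a b} f := Pseudofunctor.StrongTrans.isoMk
    (fun s => Cat.Hom.isoMk (NatIso.ofComponents (fun _ => Iso.refl _)
      (fun η => evalPt_naturality (T.map (𝟙 s ×ₘ f)) η)))
    (fun {s t} g => cat_hom₂_ext fun (h : pt ⟶ T.obj (s, a)) => by
      have e : 𝟙 _ ≫ 𝟙 _ ≫ (T.map (𝟙 t ×ₘ f)).toFunctor.map (𝟙 _) ≫ 𝟙 _ ≫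
          ((T.mapComp (g ×ₘ 𝟙 a) (𝟙 t ×ₘ f)).inv.toNatTrans.app (h.toFunctor.obj ⟨⟨⟩⟩) ≫
          (T.map₂ (interchange g f).hom).toNatTrans.app (h.toFunctor.obj ⟨⟨⟩⟩) ≫
          (T.mapComp (𝟙 s ×ₘ f) (g ×ₘ 𝟙 b)).hom.toNatTrans.app (h.toFunctor.obj ⟨⟨⟩⟩)) ≫ 𝟙 _ =
        (𝟙 _ ≫ ((((((𝟙 _ ≫ 𝟙 _) ≫ 𝟙 _) ≫ evalMap₂ h (T.mapComp (g ×ₘ 𝟙 a) (𝟙 t ×ₘ f)).inv) ≫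
          evalMap₂ h (T.map₂ (𝟙 ((g ×ₘ 𝟙 a) ≫ (𝟙 t ×ₘ f)))))) ≫
          evalMap₂ h (T.map₂ (interchange g f).hom) ≫
          (evalMap₂ h (T.map₂ (𝟙 ((𝟙 s ×ₘ f) ≫ (g ×ₘ 𝟙 b)))) ≫
            evalMap₂ h (T.mapComp (𝟙 s ×ₘ f) (g ×ₘ 𝟙 b)).hom ≫ 𝟙 _ ≫ 𝟙 _ ≫ 𝟙 _)) ≫
          𝟙 _ ≫ 𝟙 _ ≫ 𝟙 _) ≫ (T.map (g ×ₘ 𝟙 b)).toFunctor.map (𝟙 _) := by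
        simp only [T.map₂_id]
        simp [evalMap₂_eq]
      exact e)
  naturality_naturality {a b f g} γ := Pseudofunctor.StrongTrans.homCategory.ext fun s =>
    cat_hom₂_ext fun (h : pt ⟶ T.obj (s, a)) =>
    evalPt_map₂ h (T.map₂ ((𝟙 (𝟙 s), γ) : (𝟙 s ×ₘ f) ⟶ (𝟙 s ×ₘ g)))

end Evaluation

section Bicolimit

/-- The comparison `H(GF) ⟶ (HG)F`, whose components are identities: the two composites are not
syntactically equal. -/
def PreTrans.assoc {X : Type u₁} [Bicategory.{w₁, v₁} X] {Y : Type u₂} [Bicategory.{w₂, v₂} Y]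
    {Z : Type u₃} [Bicategory.{w₃, v₃} Z] {K : Type u₄} [Bicategory.{w₄, v₄} K]
    (F : X ⥤ᵖ Y) (G : Y ⥤ᵖ Z) (H : Z ⥤ᵖ K) : PreTrans (F.comp (G.comp H)) ((F.comp G).comp H) where
  app x := 𝟙 (H.obj (G.obj (F.obj x)))
  naturality f := ρ_ (H.map (G.map (F.map f))) ≪≫ (λ_ (H.map (G.map (F.map f)))).symm
  naturality_naturality {x y f g} γ := by
    change H.map₂ (G.map₂ (F.map₂ γ)) ▷ 𝟙 _ ≫ (ρ_ (H.map (G.map (F.map g)))).hom ≫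
        (λ_ (H.map (G.map (F.map g)))).inv =
      ((ρ_ (H.map (G.map (F.map f)))).hom ≫ (λ_ (H.map (G.map (F.map f)))).inv) ≫
        𝟙 _ ◁ H.map₂ (G.map₂ (F.map₂ γ))
    simp

variable {S : Type v} [Bicategory.{v, v} S] {A : Type u₁} [Bicategory.{v, v} A]

theorem PreTrans.exists_isUniversalElement_comp_iff {X : Type u₂} [Bicategory.{w₂, v₂} X]
    {K : Type u₃} [Bicategory.{w₃, v₃} K] {Φ : A ⥤ᵖ X} {P : X ⥤ᵖ K} {Q : A ⥤ᵖ K}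
    (H : K ⥤ᵖ Cat.{w₁, v₁}) (θ : PreTrans (Φ.comp P) Q) (hθ : ∀ b, IsEquiv (θ.app b)) (a : A) :
    (∃ u : H.obj (P.obj (Φ.obj a)), IsUniversalElement (a := a) (Φ.comp (P.comp H)) u) ↔
      ∃ u : H.obj (Q.obj a), IsUniversalElement (a := a) (Q.comp H) u :=
  ((PreTrans.assoc Φ P H).exists_isUniversalElement_iff (fun _ => isEquiv_id _) a).trans
    ((θ.post H).exists_isUniversalElement_iff (fun b => (hθ b).map H) a)

theorem exists_isUniversalElement_iff_of_isWeightedBilimitFamily {W : S ⥤ᵖ Cat.{v, v}}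
    {T : S × A ⥤ᵖ Cat.{v, v}} {Q : A ⥤ᵖ Cat.{v, v}} (hW : IsWeightedBilimitFamily W T Q) (a : A) :
    (∃ u : Q.obj a, IsUniversalElement Q u) ↔
      ∃ u : (weightedHom W T).obj a, IsUniversalElement (weightedHom W T) u := by
  obtain ⟨e⟩ := hW
  have evalQ := (evalTrans Q).exists_isUniversalElement_iff (fun b => isEquiv_evalPt _) a
  have bilimit := PreTrans.exists_isUniversalElement_iff (.ofTrans (preWhisker
    (Bicategory.Prod.sectR (op pt) A).toPseudofunctor e.hom)) (fun b => (isEquiv_hom e).app _) a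
  have evalT := (evalCurry T).exists_isUniversalElement_comp_iff (corep W)
    (fun b => isEquiv_of_pointwise (evalSlice T b) fun s => isEquiv_evalPt (T.obj (s, b))) a
  exact evalQ.symm.trans (bilimit.trans evalT)

theorem exists_isUniversalElement_iff_isWeightedBicolimit {W : S ⥤ᵖ Cat.{v, v}}
    {T : S × A ⥤ᵖ Cat.{v, v}} {Q : A ⥤ᵖ Cat.{v, v}} (hW : IsWeightedBilimitFamily W T Q)
    {D : Sᵒᵖ ⥤ᵖ A} (e : Bicategory.Equivalence T (homFrom D)) (a : A) :
    (∃ u : Q.obj a, IsUniversalElement Q u) ↔ IsWeightedBicolimit W D a := by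
  rw [IsWeightedBicolimit, ← exists_isUniversalElement_iff,
    exists_isUniversalElement_iff_of_isWeightedBilimitFamily hW]
  exact ((curryTrans e.hom).post (corep W)).exists_isUniversalElement_iff
    (fun b => (isEquiv_of_pointwise ((curryTrans e.hom).app b)
      fun s => (isEquiv_hom e).app (s, b)).map (corep W)) a

end Bicolimit

section ProdTrans
open CategoryTheory.Prod IsoComma
variable {S : Type u₁} [Bicategory.{w₁, v₁} S] {T : Type u₂} [Bicategory.{w₂, v₂} T]
  {A : Type u₃} [Bicategory.{w₃, v₃} A] {K : Type u₄} [Bicategory.{w₄, v₄} K]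

/-- The data of a pseudonatural transformation `P ⟶ H ∘ (G × 1)` given separately in each
variable: components, naturality 2-cells over `(g, 1)` and over `(1, f)`, and their
compatibility. -/
structure ProdTrans (P : S × A ⥤ᵖ K) (H : T × A ⥤ᵖ K) (G : S ⥤ᵖ T) where
  app (s : S) (a : A) : P.obj (s, a) ⟶ H.obj (G.obj s, a)
  natL {s t : S} (g : s ⟶ t) (a : A) :
    P.map (g ×ₘ 𝟙 a) ≫ app t a ≅ app s a ≫ H.map (G.map g ×ₘ 𝟙 a)
  natR (s : S) {a b : A} (f : a ⟶ b) :
    P.map (𝟙 s ×ₘ f) ≫ app s b ≅ app s a ≫ H.map (𝟙 (G.obj s) ×ₘ f)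
  natL_naturality {s t : S} {g h : s ⟶ t} (γ : g ⟶ h) (a : A) :
    P.map₂ ((γ, 𝟙 (𝟙 a)) : (g ×ₘ 𝟙 a) ⟶ (h ×ₘ 𝟙 a)) ▷ app t a ≫ (natL h a).hom =
      (natL g a).hom ≫
        app s a ◁ H.map₂ ((G.map₂ γ, 𝟙 (𝟙 a)) : (G.map g ×ₘ 𝟙 a) ⟶ (G.map h ×ₘ 𝟙 a))
  natR_naturality (s : S) {a b : A} {f g : a ⟶ b} (γ : f ⟶ g) :
    P.map₂ ((𝟙 (𝟙 s), γ) : (𝟙 s ×ₘ f) ⟶ (𝟙 s ×ₘ g)) ▷ app s b ≫ (natR s g).hom =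
      (natR s f).hom ≫
        app s a ◁ H.map₂ ((𝟙 (𝟙 (G.obj s)), γ) : (𝟙 (G.obj s) ×ₘ f) ⟶ (𝟙 (G.obj s) ×ₘ g))
  natL_id (s : S) (a : A) : (natL (𝟙 s) a).hom ≫ app s a ◁
      (H.map₂ (((G.mapId s).hom, 𝟙 (𝟙 a)) : (G.map (𝟙 s) ×ₘ 𝟙 a) ⟶ 𝟙 (G.obj s, a)) ≫
        (H.mapId (G.obj s, a)).hom) =
    (P.mapId (s, a)).hom ▷ app s a ≫ (λ_ (app s a)).hom ≫ (ρ_ (app s a)).inv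
  natR_id (s : S) (a : A) : (natR s (𝟙 a)).hom ≫ app s a ◁ (H.mapId (G.obj s, a)).hom =
    (P.mapId (s, a)).hom ▷ app s a ≫ (λ_ (app s a)).hom ≫ (ρ_ (app s a)).inv
  natL_comp {s t r : S} (g : s ⟶ t) (h : t ⟶ r) (a : A) :
    (natL (g ≫ h) a).hom ≫ app s a ◁
      (H.map₂ (((G.mapComp g h).hom, (λ_ (𝟙 a)).inv) : (G.map (g ≫ h) ×ₘ 𝟙 a) ⟶
        (G.map g ×ₘ 𝟙 a) ≫ (G.map h ×ₘ 𝟙 a)) ≫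
        (H.mapComp (G.map g ×ₘ 𝟙 a) (G.map h ×ₘ 𝟙 a)).hom) =
    (P.map₂ ((𝟙 (g ≫ h), (λ_ (𝟙 a)).inv) : ((g ≫ h) ×ₘ 𝟙 a) ⟶ (g ×ₘ 𝟙 a) ≫ (h ×ₘ 𝟙 a)) ≫
        (P.mapComp (g ×ₘ 𝟙 a) (h ×ₘ 𝟙 a)).hom) ▷ app r a ≫ (α_ _ _ _).hom ≫
      P.map (g ×ₘ 𝟙 a) ◁ (natL h a).hom ≫ (α_ _ _ _).inv ≫
      (natL g a).hom ▷ H.map (G.map h ×ₘ 𝟙 a) ≫ (α_ _ _ _).hom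
  natR_comp (s : S) {a b c : A} (f : a ⟶ b) (g : b ⟶ c) :
    (natR s (f ≫ g)).hom ≫ app s a ◁
      (H.map₂ (((ρ_ (𝟙 (G.obj s))).inv, 𝟙 (f ≫ g)) : (𝟙 (G.obj s) ×ₘ (f ≫ g)) ⟶
        (𝟙 (G.obj s) ×ₘ f) ≫ (𝟙 (G.obj s) ×ₘ g)) ≫
        (H.mapComp (𝟙 (G.obj s) ×ₘ f) (𝟙 (G.obj s) ×ₘ g)).hom) =
    (P.map₂ (((ρ_ (𝟙 s)).inv, 𝟙 (f ≫ g)) : (𝟙 s ×ₘ (f ≫ g)) ⟶ (𝟙 s ×ₘ f) ≫ (𝟙 s ×ₘ g)) ≫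
        (P.mapComp (𝟙 s ×ₘ f) (𝟙 s ×ₘ g)).hom) ▷ app s c ≫ (α_ _ _ _).hom ≫
      P.map (𝟙 s ×ₘ f) ◁ (natR s g).hom ≫ (α_ _ _ _).inv ≫
      (natR s f).hom ▷ H.map (𝟙 (G.obj s) ×ₘ g) ≫ (α_ _ _ _).hom
  exchange {s t : S} (g : s ⟶ t) {a b : A} (f : a ⟶ b) :
    P.map (g ×ₘ 𝟙 a) ◁ (natR t f).hom ≫ (α_ _ _ _).inv ≫
      (natL g a).hom ▷ H.map (𝟙 (G.obj t) ×ₘ f) ≫ (α_ _ _ _).hom ≫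
      app s a ◁ (mapSquare H (interchange (G.map g) f)).hom ≫ (α_ _ _ _).inv =
    ((α_ _ _ _).inv ≫ (mapSquare P (interchange g f)).hom ▷ app t b ≫ (α_ _ _ _).hom ≫
      P.map (𝟙 s ×ₘ f) ◁ (natL g b).hom ≫ (α_ _ _ _).inv) ≫
      (natR s f).hom ▷ H.map (G.map g ×ₘ 𝟙 b)

theorem map₂_id_comp_mapId (P : S ⥤ᵖ K) (s : S) :
    P.map₂ (𝟙 (𝟙 s)) ≫ (P.mapId s).hom = (P.mapId s).hom := by
  rw [P.map₂_id, Category.id_comp]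

theorem IsoComma.hom₂_w_of_eq {P : S ⥤ᵖ K} {H : T ⥤ᵖ K} {p q : IsoComma P H} {f g : p ⟶ q}
    (x : f ⟶ g) {l : f.left ⟶ g.left} {r : f.right ⟶ g.right} (hl : x.left = l)
    (hr : x.right = r) : P.map₂ l ▷ q.arr ≫ g.sq.hom = f.sq.hom ≫ p.arr ◁ H.map₂ r := by
  subst hl hr; exact hom₂_w x

theorem IsoComma.w_of_sq_hom_mapId {P : S ⥤ᵖ K} {H : T ⥤ᵖ K} {p : IsoComma P H} {f : p ⟶ p}
    (l : f.left ⟶ 𝟙 p.left) (r : f.right ⟶ 𝟙 p.right)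
    (h : f.sq.hom ≫ p.arr ◁ (H.map₂ r ≫ (H.mapId p.right).hom) =
      (P.map₂ l ≫ (P.mapId p.left).hom) ▷ p.arr ≫ (λ_ p.arr).hom ≫ (ρ_ p.arr).inv) :
    P.map₂ l ▷ p.arr ≫ (Hom.sq (𝟙 p)).hom = f.sq.hom ≫ p.arr ◁ H.map₂ r := by
  rw [id_sq_hom, ← cancel_mono (p.arr ◁ (H.mapId p.right).hom)]
  simp only [whiskerLeft_comp, comp_whiskerRight, Category.assoc] at h
  simp [h]

theorem IsoComma.w_of_sq_hom_mapComp {P : S ⥤ᵖ K} {H : T ⥤ᵖ K} {p q t : IsoComma P H}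
    {f : p ⟶ q} {g : q ⟶ t} {k : p ⟶ t} (l : k.left ⟶ f.left ≫ g.left)
    (r : k.right ⟶ f.right ≫ g.right)
    (h : k.sq.hom ≫ p.arr ◁ (H.map₂ r ≫ (H.mapComp f.right g.right).hom) =
      (P.map₂ l ≫ (P.mapComp f.left g.left).hom) ▷ t.arr ≫ (α_ _ _ _).hom ≫
      P.map f.left ◁ g.sq.hom ≫ (α_ _ _ _).inv ≫ f.sq.hom ▷ H.map g.right ≫ (α_ _ _ _).hom) :
    P.map₂ l ▷ t.arr ≫ (Hom.sq (f ≫ g)).hom = k.sq.hom ≫ p.arr ◁ H.map₂ r := by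
  rw [comp_sq_hom, ← cancel_mono (p.arr ◁ (H.mapComp f.right g.right).hom)]
  simp only [whiskerLeft_comp, comp_whiskerRight, Category.assoc] at h
  simp [h]

theorem IsoComma.w_of_mapSquare {P : S ⥤ᵖ K} {H : T ⥤ᵖ K} {p q q' t : IsoComma P H} {f : p ⟶ q}
    {g : q ⟶ t} {f' : p ⟶ q'} {g' : q' ⟶ t} (l : f.left ≫ g.left ≅ f'.left ≫ g'.left)
    (r : f.right ≫ g.right ≅ f'.right ≫ g'.right)
    (h : P.map f.left ◁ g.sq.hom ≫ (α_ _ _ _).inv ≫ f.sq.hom ▷ H.map g.right ≫ (α_ _ _ _).hom ≫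
      p.arr ◁ (mapSquare H r).hom ≫ (α_ _ _ _).inv =
      ((α_ _ _ _).inv ≫ (mapSquare P l).hom ▷ t.arr ≫ (α_ _ _ _).hom ≫
        P.map f'.left ◁ g'.sq.hom ≫ (α_ _ _ _).inv) ≫ f'.sq.hom ▷ H.map g'.right) :
    P.map₂ l.hom ▷ t.arr ≫ (Hom.sq (f' ≫ g')).hom =
      (Hom.sq (f ≫ g)).hom ≫ p.arr ◁ H.map₂ r.hom := by
  simp only [mapSquare, Iso.trans_hom, Iso.symm_hom, P.map₂Iso_hom, H.map₂Iso_hom, whiskerLeft_comp,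
    comp_whiskerRight, Category.assoc] at h
  rw [comp_sq_hom, comp_sq_hom, ← cancel_mono (p.arr ◁ (H.mapComp f'.right g'.right).hom),
    ← cancel_mono (α_ _ _ _).inv, ← cancel_epi ((P.mapComp f.left g.left).inv ▷ t.arr),
    ← cancel_epi (α_ _ _ _).inv]
  simp [h]

theorem IsoComma.w_conj {P : S ⥤ᵖ K} {H : T ⥤ᵖ K} {p q : IsoComma P H} {k : p ⟶ q}
    {l : p.left ⟶ q.left} {r : p.right ⟶ q.right} (i : l ≅ k.left) (j : k.right ≅ r) :
    P.map₂ i.hom ▷ q.arr ≫ k.sq.hom =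
      (whiskerRightIso (P.map₂Iso i) q.arr ≪≫ k.sq ≪≫ whiskerLeftIso p.arr (H.map₂Iso j)).hom ≫
        p.arr ◁ H.map₂ j.inv := by
  simp only [Iso.trans_hom, whiskerRightIso_hom, whiskerLeftIso_hom, Category.assoc,
    P.map₂Iso_hom, H.map₂Iso_hom]
  rw [← whiskerLeft_comp, ← H.map₂_comp, Iso.hom_inv_id, H.map₂_id, whiskerLeft_id,
    Category.comp_id]

section Factorization
variable {C : Type u₁} [Bicategory.{w₁, v₁} C]

theorem factorization_fst_map₂ {x y : C} {f g : x ⟶ y} (γ : f ⟶ g) :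
    (ρ_ f).inv ≫ γ ▷ 𝟙 y ≫ g ◁ 𝟙 (𝟙 y) ≫ (ρ_ g).hom = γ := by simp

theorem factorization_snd_map₂ {x y : C} {f g : x ⟶ y} (γ : f ⟶ g) :
    (λ_ f).inv ≫ 𝟙 (𝟙 x) ▷ f ≫ 𝟙 x ◁ γ ≫ (λ_ g).hom = γ := by simp

theorem factorization_fst_id {x : C} {f : x ⟶ x} (γ : f ⟶ 𝟙 x) :
    (ρ_ f).inv ≫ γ ▷ 𝟙 x ≫ (λ_ (𝟙 x)).hom ≫ 𝟙 (𝟙 x) = γ := by simp [unitors_equal]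

theorem factorization_snd_id (x : C) :
    (λ_ (𝟙 x)).inv ≫ 𝟙 (𝟙 x) ▷ 𝟙 x ≫ (λ_ (𝟙 x)).hom ≫ 𝟙 (𝟙 x) = 𝟙 (𝟙 x) := by simp

theorem factorization_fst_comp {x y z : C} {f : x ⟶ y} {g : y ⟶ z} {k : x ⟶ z} (γ : k ⟶ f ≫ g) :
    (ρ_ k).inv ≫ γ ▷ 𝟙 z ≫ (f ≫ g) ◁ (ρ_ (𝟙 z)).inv ≫ (α_ _ _ _).hom ≫
      f ◁ ((α_ _ _ _).inv ≫ ((ρ_ g).hom ≫ (λ_ g).inv) ▷ 𝟙 z ≫ (α_ _ _ _).hom) ≫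
        (α_ _ _ _).inv ≫ (ρ_ f).hom ▷ _ ≫ f ◁ (ρ_ g).hom = γ := by
  bicategory

theorem factorization_snd_comp {x y z : C} (f : x ⟶ y) (g : y ⟶ z) :
    (λ_ (f ≫ g)).inv ≫ (λ_ (𝟙 x)).inv ▷ (f ≫ g) ≫ (𝟙 x ≫ 𝟙 x) ◁ 𝟙 (f ≫ g) ≫ (α_ _ _ _).hom ≫
      𝟙 x ◁ ((α_ _ _ _).inv ≫ ((λ_ f).hom ≫ (ρ_ f).inv) ▷ g ≫ (α_ _ _ _).hom) ≫
        (α_ _ _ _).inv ≫ (λ_ f).hom ▷ _ ≫ f ◁ (λ_ g).hom = 𝟙 (f ≫ g) := by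
  bicategory

end Factorization

namespace ProdTrans
variable {P : S × A ⥤ᵖ K} {H : T × A ⥤ᵖ K} {G : S ⥤ᵖ T} (θ : ProdTrans P H G)

/-- The component at `(s, a)`, as an object of the iso-comma bicategory `P ↓ H`. -/
def obj (s : S) (a : A) : IsoComma P H := ⟨(s, a), (G.obj s, a), θ.app s a⟩

/-- The naturality square over `(g, 1)`. -/
def homL {s t : S} (g : s ⟶ t) (a : A) : θ.obj s a ⟶ θ.obj t a :=
  ⟨g ×ₘ 𝟙 a, G.map g ×ₘ 𝟙 a, θ.natL g a⟩

/-- The naturality square over `(1, f)`. -/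
def homR (s : S) {a b : A} (f : a ⟶ b) : θ.obj s a ⟶ θ.obj s b :=
  ⟨𝟙 s ×ₘ f, 𝟙 (G.obj s) ×ₘ f, θ.natR s f⟩

/-- The law `natL_naturality`, as a 2-cell of squares. -/
def homL₂ {s t : S} {g h : s ⟶ t} (γ : g ⟶ h) (a : A) : θ.homL g a ⟶ θ.homL h a :=
  ⟨(γ, 𝟙 (𝟙 a)), (G.map₂ γ, 𝟙 (𝟙 a)), θ.natL_naturality γ a⟩

/-- The law `natR_naturality`, as a 2-cell of squares. -/
def homR₂ (s : S) {a b : A} {f g : a ⟶ b} (γ : f ⟶ g) : θ.homR s f ⟶ θ.homR s g :=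
  ⟨(𝟙 (𝟙 s), γ), (𝟙 (𝟙 (G.obj s)), γ), θ.natR_naturality s γ⟩

/-- The law `natL_id`, as a 2-cell of squares. -/
def homLId (s : S) (a : A) : θ.homL (𝟙 s) a ⟶ 𝟙 (θ.obj s a) :=
  ⟨𝟙 (𝟙 (s, a)), ((G.mapId s).hom, 𝟙 (𝟙 a)), w_of_sq_hom_mapId (f := θ.homL (𝟙 s) a) (𝟙 (𝟙 (s, a)))
    ((G.mapId s).hom, 𝟙 (𝟙 a)) ((θ.natL_id s a).trans
      (congrArg (· ▷ θ.app s a ≫ (λ_ _).hom ≫ (ρ_ _).inv) (map₂_id_comp_mapId P (s, a)).symm))⟩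

/-- The law `natR_id`, as a 2-cell of squares. -/
def homRId (s : S) (a : A) : θ.homR s (𝟙 a) ⟶ 𝟙 (θ.obj s a) :=
  ⟨𝟙 (𝟙 (s, a)), 𝟙 (𝟙 (G.obj s, a)), w_of_sq_hom_mapId (f := θ.homR s (𝟙 a)) (𝟙 (𝟙 (s, a)))
    (𝟙 (𝟙 (G.obj s, a))) ((congrArg (fun m => (θ.natR s (𝟙 a)).hom ≫ θ.app s a ◁ m)
      (map₂_id_comp_mapId H (G.obj s, a))).trans ((θ.natR_id s a).trans
      (congrArg (· ▷ θ.app s a ≫ (λ_ _).hom ≫ (ρ_ _).inv) (map₂_id_comp_mapId P (s, a)).symm)))⟩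

/-- The law `natL_comp`, as a 2-cell of squares. -/
def homLComp {s t r : S} (g : s ⟶ t) (h : t ⟶ r) (a : A) :
    θ.homL (g ≫ h) a ⟶ θ.homL g a ≫ θ.homL h a :=
  ⟨(𝟙 (g ≫ h), (λ_ (𝟙 a)).inv), ((G.mapComp g h).hom, (λ_ (𝟙 a)).inv),
    w_of_sq_hom_mapComp (f := θ.homL g a) (g := θ.homL h a) (k := θ.homL (g ≫ h) a) _ _
      (θ.natL_comp g h a)⟩

/-- The law `natR_comp`, as a 2-cell of squares. -/
def homRComp (s : S) {a b c : A} (f : a ⟶ b) (g : b ⟶ c) :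
    θ.homR s (f ≫ g) ⟶ θ.homR s f ≫ θ.homR s g :=
  ⟨((ρ_ (𝟙 s)).inv, 𝟙 (f ≫ g)), ((ρ_ (𝟙 (G.obj s))).inv, 𝟙 (f ≫ g)),
    w_of_sq_hom_mapComp (f := θ.homR s f) (g := θ.homR s g) (k := θ.homR s (f ≫ g)) _ _
      (θ.natR_comp s f g)⟩

/-- The law `exchange`, as a 2-cell of squares. -/
def homExchange {s t : S} (g : s ⟶ t) {a b : A} (f : a ⟶ b) :
    θ.homL g a ≫ θ.homR t f ⟶ θ.homR s f ≫ θ.homL g b :=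
  ⟨(interchange g f).hom, (interchange (G.map g) f).hom,
    w_of_mapSquare (f := θ.homL g a) (g := θ.homR t f) (f' := θ.homR s f) (g' := θ.homL g b)
      (interchange g f) (interchange (G.map g) f) (θ.exchange g f)⟩

/-- The square over `(g, f)`, obtained from the factorization `(g, f) ≅ (g, 1) ≫ (1, f)`. -/
def hom {s t : S} (g : s ⟶ t) {a b : A} (f : a ⟶ b) : θ.obj s a ⟶ θ.obj t b :=
  ⟨g ×ₘ f, G.map g ×ₘ f,
    whiskerRightIso (P.map₂Iso (Iso.prod (ρ_ g).symm (λ_ f).symm)) (θ.app t b) ≪≫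
    Hom.sq (θ.homL g a ≫ θ.homR t f) ≪≫
    whiskerLeftIso (θ.app s a) (H.map₂Iso (Iso.prod (ρ_ (G.map g)) (λ_ f)))⟩

/-- The comparison of the square over `(g, f)` with the pasting of those over `(g, 1)` and
`(1, f)`. -/
def homIso {s t : S} (g : s ⟶ t) {a b : A} (f : a ⟶ b) :
    θ.hom g f ≅ θ.homL g a ≫ θ.homR t f :=
  isoMk (f := θ.hom g f) (g := θ.homL g a ≫ θ.homR t f) (Iso.prod (ρ_ g).symm (λ_ f).symm)
    (Iso.prod (ρ_ (G.map g)) (λ_ f)).symm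
    (w_conj (k := θ.homL g a ≫ θ.homR t f) (Iso.prod (ρ_ g).symm (λ_ f).symm)
      (Iso.prod (ρ_ (G.map g)) (λ_ f)))

theorem hom_sq_naturality {s t : S} {g g' : s ⟶ t} (γ : g ⟶ g') {a b : A} {f f' : a ⟶ b}
    (δ : f ⟶ f') :
    P.map₂ ((γ, δ) : (g ×ₘ f) ⟶ (g' ×ₘ f')) ▷ θ.app t b ≫ (θ.hom g' f').sq.hom =
      (θ.hom g f).sq.hom ≫
        θ.app s a ◁ H.map₂ ((G.map₂ γ, δ) : (G.map g ×ₘ f) ⟶ (G.map g' ×ₘ f')) :=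
  hom₂_w_of_eq ((θ.homIso g f).hom ≫ θ.homL₂ γ a ▷ θ.homR t f ≫ θ.homL g' a ◁ θ.homR₂ t δ ≫
      (θ.homIso g' f').inv)
    (Prod.ext (factorization_fst_map₂ γ) (factorization_snd_map₂ δ))
    (Prod.ext (factorization_fst_map₂ (G.map₂ γ)) (factorization_snd_map₂ δ))

/-- The unit 2-cell of the assignment `(g, f) ↦ θ.hom g f`. -/
def homId (s : S) (a : A) : θ.hom (𝟙 s) (𝟙 a) ⟶ 𝟙 (θ.obj s a) :=
  ⟨𝟙 (𝟙 (s, a)), ((G.mapId s).hom, 𝟙 (𝟙 a)), hom₂_w_of_eq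
    ((θ.homIso (𝟙 s) (𝟙 a)).hom ≫ θ.homLId s a ▷ θ.homR s (𝟙 a) ≫ (λ_ _).hom ≫ θ.homRId s a)
    (Prod.ext (factorization_fst_id (𝟙 (𝟙 s))) (factorization_snd_id a))
    (Prod.ext (factorization_fst_id (G.mapId s).hom) (factorization_snd_id a))⟩

/-- The composition 2-cell of the assignment `(g, f) ↦ θ.hom g f`: the middle factors of
`(g, 1) (1, f) (h, 1) (1, k)` are exchanged. -/
def homComp {s t r : S} (g : s ⟶ t) (h : t ⟶ r) {a b c : A} (f : a ⟶ b) (k : b ⟶ c) :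
    θ.hom (g ≫ h) (f ≫ k) ⟶ θ.hom g f ≫ θ.hom h k :=
  ⟨𝟙 ((g ≫ h) ×ₘ (f ≫ k)), ((G.mapComp g h).hom, 𝟙 (f ≫ k)), hom₂_w_of_eq
    (f := θ.hom (g ≫ h) (f ≫ k)) (g := θ.hom g f ≫ θ.hom h k)
    ((θ.homIso (g ≫ h) (f ≫ k)).hom ≫ θ.homLComp g h a ▷ θ.homR r (f ≫ k) ≫
      (θ.homL g a ≫ θ.homL h a) ◁ θ.homRComp r f k ≫ (α_ _ _ _).hom ≫
      θ.homL g a ◁ ((α_ _ _ _).inv ≫ θ.homExchange h f ▷ θ.homR r k ≫ (α_ _ _ _).hom) ≫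
      (α_ _ _ _).inv ≫ (θ.homIso g f).inv ▷ _ ≫ θ.hom g f ◁ (θ.homIso h k).inv)
    (Prod.ext (factorization_fst_comp (𝟙 (g ≫ h))) (factorization_snd_comp f k))
    (Prod.ext (factorization_fst_comp (G.mapComp g h).hom) (factorization_snd_comp f k))⟩

/-- The pseudonatural transformation `P ⟶ H ∘ (G × 1)` assembled from the two variables. -/
def toTrans : P ⟶ (prodMap G (Pseudofunctor.id A)).comp H where
  app x := θ.app x.1 x.2
  naturality k := (θ.hom k.1 k.2).sq
  naturality_naturality γ := θ.hom_sq_naturality γ.1 γ.2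
  naturality_id x := (sq_hom_mapId (θ.homId x.1 x.2)).trans (by
    change P.map₂ (𝟙 (𝟙 x)) ▷ θ.app x.1 x.2 ≫ _ = _
    rw [P.map₂_id, id_whiskerRight]
    exact Category.id_comp _)
  naturality_comp {_ _ z} k l := (sq_hom_mapComp (θ.homComp k.1 l.1 k.2 l.2)).trans (by
    change P.map₂ (𝟙 (k ≫ l)) ▷ θ.app z.1 z.2 ≫ _ = _
    rw [P.map₂_id, id_whiskerRight]
    exact Category.id_comp _)

end ProdTrans
end ProdTrans

section OfCurry
open CategoryTheory.Prod
variable {S : Type u₁} [Bicategory.{w₁, v₁} S] {T : Type u₂} [Bicategory.{w₂, v₂} T]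
  {A : Type u₃} [Bicategory.{w₃, v₃} A] {K : Type u₄} [Bicategory.{w₄, v₄} K]

/-- The pseudofunctor `s ↦ P(s, -)` into `[A, K]_PS`. -/
def curryRight (P : S × A ⥤ᵖ K) : S ⥤ᵖ (A ⥤ᵖ K) :=
  curry ((Bicategory.Prod.swap A S).toPseudofunctor.comp P)

/-- The component at `a` of an invertible modification, as an invertible 2-cell. -/
def modificationIsoApp {F F' : A ⥤ᵖ K} {θ θ' : F ⟶ F'} (m : θ ≅ θ') (a : A) :
    θ.app a ≅ θ'.app a where
  hom := m.hom.as.app a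
  inv := m.inv.as.app a
  hom_inv_id := congrArg (fun m => m.as.app a) m.hom_inv_id
  inv_hom_id := congrArg (fun m => m.as.app a) m.inv_hom_id

theorem naturality_congr_id {x y : K} {u : x ⟶ y} {k : x ⟶ x} {h : y ⟶ y} {m m' : h ⟶ 𝟙 y}
    {n n' : k ⟶ 𝟙 x} (hm : m = m') (hn : n = n') (i : k ≫ u ≅ u ≫ h)
    (hi : i.hom ≫ u ◁ m = n ▷ u ≫ (λ_ u).hom ≫ (ρ_ u).inv) :
    i.hom ≫ u ◁ m' = n' ▷ u ≫ (λ_ u).hom ≫ (ρ_ u).inv := by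
  subst hm hn; exact hi

theorem naturality_congr_comp {x y z x' y' z' : K} {u : x ⟶ x'} {u' : y ⟶ y'} {u'' : z ⟶ z'}
    {k : x ⟶ y} {l : y ⟶ z} {kl : x ⟶ z} {k' : x' ⟶ y'} {l' : y' ⟶ z'} {kl' : x' ⟶ z'}
    {m m' : kl' ⟶ k' ≫ l'} {n n' : kl ⟶ k ≫ l} (hm : m = m') (hn : n = n')
    (i : kl ≫ u'' ≅ u ≫ kl') (j : l ≫ u'' ≅ u' ≫ l') (j' : k ≫ u' ≅ u ≫ k')
    (hi : i.hom ≫ u ◁ m = n ▷ u'' ≫ (α_ _ _ _).hom ≫ k ◁ j.hom ≫ (α_ _ _ _).inv ≫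
      j'.hom ▷ l' ≫ (α_ _ _ _).hom) :
    i.hom ≫ u ◁ m' = n' ▷ u'' ≫ (α_ _ _ _).hom ≫ k ◁ j.hom ≫ (α_ _ _ _).inv ≫
      j'.hom ▷ l' ≫ (α_ _ _ _).hom := by
  subst hm hn; exact hi

theorem map₂_id_map₂_id_mapId (P : S ⥤ᵖ K) (s : S) :
    P.map₂ (𝟙 (𝟙 s)) ≫ P.map₂ (𝟙 (𝟙 s)) ≫ (P.mapId s).hom = (P.mapId s).hom := by
  rw [map₂_id_comp_mapId, map₂_id_comp_mapId]

theorem map₂_map₂_id_mapComp (P : S × A ⥤ᵖ K) {s t r : S} {g : s ⟶ t} {h : t ⟶ r} {k : s ⟶ r}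
    {a b c : A} {f : a ⟶ b} {f' : b ⟶ c} {l : a ⟶ c} {i i' : k ⟶ g ≫ h} {j j' : l ⟶ f ≫ f'}
    (hi : i = i') (hj : j = j') :
    P.map₂ ((i, j) : (k ×ₘ l) ⟶ (g ×ₘ f) ≫ (h ×ₘ f')) ≫ P.map₂ (𝟙 ((g ×ₘ f) ≫ (h ×ₘ f'))) ≫
        (P.mapComp (g ×ₘ f) (h ×ₘ f')).hom =
      P.map₂ ((i', j') : (k ×ₘ l) ⟶ (g ×ₘ f) ≫ (h ×ₘ f')) ≫ (P.mapComp (g ×ₘ f) (h ×ₘ f')).hom := by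
  rw [hi, hj, P.map₂_id, Category.id_comp]

theorem map₂_map₂_map₂_id_mapComp (P : S × A ⥤ᵖ K) {s t r : S} {g : s ⟶ t} {h : t ⟶ r}
    {k : s ⟶ r} {a b c : A} {f : a ⟶ b} {f' : b ⟶ c} {l : a ⟶ c} (i : k ⟶ g ≫ h)
    {j j' : l ⟶ f ≫ f'} (hj : j = j') :
    P.map₂ ((i, 𝟙 l) : (k ×ₘ l) ⟶ ((g ≫ h) ×ₘ l)) ≫
        P.map₂ ((𝟙 (g ≫ h), j) : ((g ≫ h) ×ₘ l) ⟶ (g ×ₘ f) ≫ (h ×ₘ f')) ≫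
        P.map₂ (𝟙 ((g ×ₘ f) ≫ (h ×ₘ f'))) ≫ (P.mapComp (g ×ₘ f) (h ×ₘ f')).hom =
      P.map₂ ((i, j') : (k ×ₘ l) ⟶ (g ×ₘ f) ≫ (h ×ₘ f')) ≫ (P.mapComp (g ×ₘ f) (h ×ₘ f')).hom := by
  rw [map₂_map₂_id_mapComp P rfl hj, ← P.map₂_comp_assoc]
  congr 2
  exact Prod.ext (Category.comp_id i) (Category.id_comp j')

theorem mapSquare_swap (P : S × A ⥤ᵖ K) {s t : S} (g : s ⟶ t) {a b : A} (f : a ⟶ b) :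
    (mapSquare ((Bicategory.Prod.swap A S).toPseudofunctor.comp P) (interchange f g)).hom =
      (mapSquare P (interchange g f)).inv := by
  have e : ((P.mapComp (𝟙 s ×ₘ f) (g ×ₘ 𝟙 b)).inv ≫ P.map₂ (𝟙 ((𝟙 s ×ₘ f) ≫ (g ×ₘ 𝟙 b)))) ≫
      P.map₂ (interchange g f).inv ≫ (P.map₂ (𝟙 ((g ×ₘ 𝟙 a) ≫ (𝟙 t ×ₘ f))) ≫
        (P.mapComp (g ×ₘ 𝟙 a) (𝟙 t ×ₘ f)).hom) =
      ((P.mapComp (𝟙 s ×ₘ f) (g ×ₘ 𝟙 b)).inv ≫ P.map₂ (interchange g f).inv) ≫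
        (P.mapComp (g ×ₘ 𝟙 a) (𝟙 t ×ₘ f)).hom := by
    simp only [P.map₂_id, Category.comp_id, Category.id_comp, Category.assoc]
  exact e

theorem exchange_of_modification {x y x' y' X Y X' Y' : K} {g : x ⟶ y} {t : y ⟶ y'} {r : x ⟶ x'}
    {g' : x' ⟶ y'} {G : X ⟶ Y} {T : Y ⟶ Y'} {R : X ⟶ X'} {G' : X' ⟶ Y'} {u : x ⟶ X} {v : y ⟶ Y}
    {u' : x' ⟶ X'} {v' : y' ⟶ Y'} {m : g ≫ t ≅ r ≫ g'} {m' : r ≫ g' ⟶ g ≫ t} (hm : m' = m.inv)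
    {n : G ≫ T ≅ R ≫ G'} {n' : R ≫ G' ⟶ G ≫ T} (hn : n' = n.inv) (p : g ≫ v ≅ u ≫ G)
    (q : t ≫ v' ≅ v ≫ T) (p' : g' ≫ v' ≅ u' ≫ G') (q' : r ≫ u' ≅ u ≫ R)
    (h : r ◁ p'.hom ≫ (α_ _ _ _).inv ≫ q'.hom ▷ G' ≫ (α_ _ _ _).hom ≫ u ◁ n' ≫ (α_ _ _ _).inv =
      ((α_ _ _ _).inv ≫ m' ▷ v' ≫ (α_ _ _ _).hom ≫ g ◁ q.hom ≫ (α_ _ _ _).inv) ≫ p.hom ▷ T) :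
    g ◁ q.hom ≫ (α_ _ _ _).inv ≫ p.hom ▷ T ≫ (α_ _ _ _).hom ≫ u ◁ n.hom ≫ (α_ _ _ _).inv =
      ((α_ _ _ _).inv ≫ m.hom ▷ v' ≫ (α_ _ _ _).hom ≫ r ◁ p'.hom ≫ (α_ _ _ _).inv) ≫
        q'.hom ▷ G' := by
  subst hm hn
  simp only [Category.assoc] at h ⊢
  rw [← cancel_mono (α_ _ _ _).hom, ← cancel_mono (u ◁ n.inv), ← cancel_mono (α_ _ _ _).inv]
  simp only [Category.assoc, Iso.inv_hom_id, Iso.inv_hom_id_assoc, Category.comp_id,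
    whiskerLeft_hom_inv_assoc, Iso.hom_inv_id, h, Iso.hom_inv_id_assoc, hom_inv_whiskerRight_assoc]

variable {P : S × A ⥤ᵖ K} {H : T × A ⥤ᵖ K} {G : S ⥤ᵖ T}

/-- A transformation between the curried pseudofunctors `s ↦ P(s, -)` and `s ↦ H(G s, -)`,
regarded as a transformation in two variables. -/
def ProdTrans.ofCurry (η : curryRight P ⟶ G.comp (curryRight H)) : ProdTrans P H G where
  app s a := (η.app s).app a
  natL g a := modificationIsoApp (η.naturality g) a
  natR s _ _ f := (η.app s).naturality f
  natL_naturality γ a := congrArg (fun m => m.as.app a) (η.naturality_naturality γ)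
  natR_naturality s _ _ _ _ γ := (η.app s).naturality_naturality γ
  natL_id s a := naturality_congr_id
    (congrArg (H.map₂ (((G.mapId s).hom, 𝟙 (𝟙 a)) : (G.map (𝟙 s) ×ₘ 𝟙 a) ⟶ 𝟙 (G.obj s, a)) ≫ ·)
      (map₂_id_map₂_id_mapId H (G.obj s, a)))
    (map₂_id_map₂_id_mapId P (s, a)) _ (congrArg (fun m => m.as.app a) (η.naturality_id s))
  natR_id s a := naturality_congr_id (map₂_id_map₂_id_mapId H (G.obj s, a))
    (map₂_id_map₂_id_mapId P (s, a)) _ ((η.app s).naturality_id a)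
  natL_comp g h a := naturality_congr_comp
    (map₂_map₂_map₂_id_mapComp H (G.mapComp g h).hom unitors_inv_equal.symm)
    (map₂_map₂_id_mapComp P rfl unitors_inv_equal.symm)
    _ _ _ (congrArg (fun m => m.as.app a) (η.naturality_comp g h))
  natR_comp s _ _ _ f g := naturality_congr_comp
    (map₂_map₂_id_mapComp H unitors_inv_equal rfl) (map₂_map₂_id_mapComp P unitors_inv_equal rfl)
    _ _ _ ((η.app s).naturality_comp f g)
  exchange g _ _ f := exchange_of_modification (mapSquare_swap P g f)
    (mapSquare_swap H (G.map g) f) _ _ _ _ ((η.naturality g).hom.as.naturality f)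

end OfCurry

section Yoneda
variable {A : Type u₁} [Bicategory.{w₁, v₁} A] {a : A} {F : A ⥤ᵖ Cat.{w₁, v₁}}

/-- The functor `θ ↦ θ_a(1_a)` from transformations out of `A(a, -)` to elements of `F a`; it is
the equivalence of the bicategorical Yoneda lemma. -/
def yonedaEval (F : A ⥤ᵖ Cat.{w₁, v₁}) (a : A) : (corep a ⟶ F) ⥤ F.obj a where
  obj θ := (θ.app a).toFunctor.obj (𝟙 a : a ⟶ a)
  map Γ := (Γ.as.app a).toNatTrans.app (𝟙 a : a ⟶ a)

/-- The functor `u ↦ (f ↦ (F f) u)`, a quasi-inverse of `yonedaEval F a`. -/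
def yonedaTransFunctor (F : A ⥤ᵖ Cat.{w₁, v₁}) (a : A) : F.obj a ⥤ (corep a ⟶ F) where
  obj u := yonedaTrans F u
  map m :=
    { as :=
      { app := fun _ => NatTrans.toCatHom₂
          { app := fun f => (F.map f).toFunctor.map m
            naturality := fun _ _ γ => ((F.map₂ γ).toNatTrans.naturality m).symm }
        naturality := fun {b _} g => cat_hom₂_ext fun (f : a ⟶ b) =>
          (F.mapComp f g).hom.toNatTrans.naturality m } }
  map_id u := Pseudofunctor.StrongTrans.homCategory.ext fun b => cat_hom₂_ext fun (f : a ⟶ b) =>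
    (F.map f).toFunctor.map_id u
  map_comp m n := Pseudofunctor.StrongTrans.homCategory.ext fun b =>
    cat_hom₂_ext fun (f : a ⟶ b) => (F.map f).toFunctor.map_comp m n

section
variable (θ : corep a ⟶ F)

/-- The component of `θ` at `b`, as a functor `f ↦ θ f` on `A(a, b)`. -/
def transFunctor (b : A) : (a ⟶ b) ⥤ F.obj b := (θ.app b).toFunctor

/-- The isomorphism `θ (h ≫ g) ≅ (F g) (θ h)` given by the pseudonaturality of `θ` at `g`. -/
def transIso {b c : A} (h : a ⟶ b) (g : b ⟶ c) :
    (transFunctor θ c).obj (h ≫ g) ≅ (F.map g).toFunctor.obj ((transFunctor θ b).obj h) :=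
  (Cat.Hom.toNatIso (θ.naturality g)).app h

theorem transIso_naturality_left {b c : A} {h h' : a ⟶ b} (γ : h ⟶ h') (g : b ⟶ c) :
    (transFunctor θ c).map (γ ▷ g) ≫ (transIso θ h' g).hom =
      (transIso θ h g).hom ≫ (F.map g).toFunctor.map ((transFunctor θ b).map γ) :=
  (θ.naturality g).hom.toNatTrans.naturality γ

theorem transIso_naturality_right {b c : A} (h : a ⟶ b) {g g' : b ⟶ c} (γ : g ⟶ g') :
    (transFunctor θ c).map (h ◁ γ) ≫ (transIso θ h g').hom =
      (transIso θ h g).hom ≫ (F.map₂ γ).toNatTrans.app ((transFunctor θ b).obj h) :=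
  congrArg (fun m => m.toNatTrans.app h) (θ.naturality_naturality γ)

theorem transIso_comp {b c d : A} (h : a ⟶ b) (g : b ⟶ c) (k : c ⟶ d) :
    (transIso θ h (g ≫ k)).hom ≫ (F.mapComp g k).hom.toNatTrans.app ((transFunctor θ b).obj h) =
      (transFunctor θ d).map (α_ h g k).inv ≫ (transIso θ (h ≫ g) k).hom ≫
        (F.map k).toFunctor.map (transIso θ h g).hom := by
  have e : (transIso θ h (g ≫ k)).hom ≫
      (F.mapComp g k).hom.toNatTrans.app ((transFunctor θ b).obj h) =
      (transFunctor θ d).map (α_ h g k).inv ≫ 𝟙 _ ≫ (transIso θ (h ≫ g) k).hom ≫ 𝟙 _ ≫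
        (F.map k).toFunctor.map (transIso θ h g).hom ≫ 𝟙 _ :=
    congrArg (fun m => m.toNatTrans.app h) (θ.naturality_comp g k)
  simpa only [Category.id_comp, Category.comp_id] using e

/-- The isomorphism `θ f ≅ (F f) (θ 1)`. -/
def yonedaIsoApp {b : A} (f : a ⟶ b) :
    (transFunctor θ b).obj f ≅ (F.map f).toFunctor.obj ((transFunctor θ a).obj (𝟙 a)) :=
  (transFunctor θ b).mapIso (λ_ f).symm ≪≫ transIso θ (𝟙 a) f

theorem yonedaIsoApp_hom {b : A} (f : a ⟶ b) : (yonedaIsoApp θ f).hom =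
    (transFunctor θ b).map (λ_ f).inv ≫ (transIso θ (𝟙 a) f).hom := rfl

theorem yonedaIsoApp_naturality {b : A} {f f' : a ⟶ b} (γ : f ⟶ f') :
    (transFunctor θ b).map γ ≫ (yonedaIsoApp θ f').hom =
      (yonedaIsoApp θ f).hom ≫ (F.map₂ γ).toNatTrans.app ((transFunctor θ a).obj (𝟙 a)) := by
  rw [yonedaIsoApp_hom, yonedaIsoApp_hom, Category.assoc, ← transIso_naturality_right,
    ← Functor.map_comp_assoc, ← Functor.map_comp_assoc, leftUnitor_inv_naturality]

theorem yonedaIsoApp_comp {b c : A} (f : a ⟶ b) (g : b ⟶ c) :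
    (yonedaIsoApp θ (f ≫ g)).hom ≫
        (F.mapComp f g).hom.toNatTrans.app ((transFunctor θ a).obj (𝟙 a)) =
      (transIso θ f g).hom ≫ (F.map g).toFunctor.map (yonedaIsoApp θ f).hom := by
  rw [yonedaIsoApp_hom, yonedaIsoApp_hom, Category.assoc, transIso_comp, Functor.map_comp,
    ← reassoc_of% (transIso_naturality_left θ (λ_ f).inv g), ← Functor.map_comp_assoc]
  congr 2
  simp

/-- The Yoneda isomorphism between `θ` and the transformation determined by its value at `1`. -/
def yonedaIso : θ ≅ yonedaTrans F ((transFunctor θ a).obj (𝟙 a)) :=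
  Pseudofunctor.StrongTrans.isoMk
    (fun _ => Cat.Hom.isoMk (NatIso.ofComponents (fun f => yonedaIsoApp θ f)
      (fun γ => yonedaIsoApp_naturality θ γ)))
    (fun {b _} g => cat_hom₂_ext fun (f : a ⟶ b) => yonedaIsoApp_comp θ f g)

end

/-- The component at `f` of a modification between transformations out of `A(a, -)`. -/
def transMap {θ θ' : corep a ⟶ F} (Γ : θ ⟶ θ') {b : A} (f : a ⟶ b) :
    (transFunctor θ b).obj f ⟶ (transFunctor θ' b).obj f :=
  (Γ.as.app b).toNatTrans.app f

theorem yonedaIsoApp_modification {θ θ' : corep a ⟶ F} (Γ : θ ⟶ θ') {b : A} (f : a ⟶ b) :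
    transMap Γ f ≫ (yonedaIsoApp θ' f).hom =
      (yonedaIsoApp θ f).hom ≫ (F.map f).toFunctor.map (transMap Γ (𝟙 a)) := by
  have h : transMap Γ (𝟙 a ≫ f) ≫ (transIso θ' (𝟙 a) f).hom =
      (transIso θ (𝟙 a) f).hom ≫ (F.map f).toFunctor.map (transMap Γ (𝟙 a)) :=
    congrArg (fun m => m.toNatTrans.app (𝟙 a)) (Γ.as.naturality f)
  have h' : (transFunctor θ b).map (λ_ f).inv ≫ transMap Γ (𝟙 a ≫ f) =
      transMap Γ f ≫ (transFunctor θ' b).map (λ_ f).inv :=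
    (Γ.as.app b).toNatTrans.naturality (λ_ f).inv
  rw [yonedaIsoApp_hom, yonedaIsoApp_hom, Category.assoc, ← h, reassoc_of% h']

theorem isEquivalence_yonedaEval (F : A ⥤ᵖ Cat.{w₁, v₁}) (a : A) :
    (yonedaEval F a).IsEquivalence :=
  (CategoryTheory.Equivalence.mk (yonedaEval F a) (yonedaTransFunctor F a)
    (NatIso.ofComponents yonedaIso fun Γ => Pseudofunctor.StrongTrans.homCategory.ext fun b =>
      cat_hom₂_ext fun (f : a ⟶ b) => yonedaIsoApp_modification Γ f)
    (NatIso.ofComponents (fun u => (Cat.Hom.toNatIso (F.mapId a)).app u)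
      (fun m => (F.mapId a).hom.toNatTrans.naturality m))).isEquivalence_functor

end Yoneda

section Coyoneda
open Bicategory.Opposite
variable {A : Type u₁} [Bicategory.{w₁, v₁} A]

variable (A) in
/-- The contravariant Yoneda embedding `a ↦ A(a, -)`. -/
def coyoneda : Aᵒᵖ ⥤ᵖ (A ⥤ᵖ Cat.{w₁, v₁}) := curryRight (homPseudofunctor A)

theorem isUniversalElement_coyoneda (x : Aᵒᵖ) :
    IsUniversalElement ((coyoneda A).obj x) (a := x.unop) (𝟙 x.unop) := by
  intro b
  exact Functor.isEquivalence_of_iso (F := 𝟭 (x.unop ⟶ b))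
    (NatIso.ofComponents (fun f => (λ_ f).symm ≪≫ whiskerLeftIso (𝟙 x.unop) (λ_ f).symm) (by
    intro f g γ
    have h : γ ≫ (λ_ g).inv ≫ 𝟙 x.unop ◁ (λ_ g).inv = ((λ_ f).inv ≫ 𝟙 x.unop ◁ (λ_ f).inv) ≫
        𝟙 (𝟙 x.unop) ▷ (𝟙 x.unop ≫ f) ≫ 𝟙 x.unop ◁ 𝟙 x.unop ◁ γ := by simp
    exact h))

theorem isEquivalence_unopFunctor (x y : Aᵒᵖ) : (unopFunctor x y).IsEquivalence :=
  (CategoryTheory.Equivalence.mk (unopFunctor x y) (opFunctor y.unop x.unop)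
    (Iso.refl _) (Iso.refl _)).isEquivalence_functor

/-- The Yoneda embedding on hom categories, restricted along the transformation
`A(x, -) ⟶ (coyoneda A)(x)` and evaluated at the identity, is the identity up to isomorphism. -/
def coyonedaMapCompEvalIso (x y : Aᵒᵖ) : unopFunctor x y ≅ (coyoneda A).mapFunctor x y ⋙
    precomp ((coyoneda A).obj y) (yonedaTrans ((coyoneda A).obj x) (a := x.unop) (𝟙 x.unop)) ⋙
      yonedaEval ((coyoneda A).obj y) x.unop :=
  let w : x.unop ⟶ x.unop := 𝟙 x.unop ≫ 𝟙 x.unop ≫ 𝟙 x.unop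
  let j : 𝟙 x.unop ≅ w ≫ 𝟙 x.unop := (λ_ _ ≪≫ λ_ _).symm ≪≫ (ρ_ w).symm
  NatIso.ofComponents (fun f => (ρ_ f.unop).symm ≪≫ whiskerLeftIso f.unop j) (by
    intro f g γ
    have h : γ.unop2 ≫ (ρ_ g.unop).inv ≫ g.unop ◁ j.hom =
        ((ρ_ f.unop).inv ≫ f.unop ◁ j.hom) ≫
          γ.unop2 ▷ (w ≫ 𝟙 x.unop) ≫ g.unop ◁ w ◁ 𝟙 (𝟙 x.unop) := by
      rw [whiskerLeft_id, whiskerLeft_id, Category.comp_id, Category.assoc, whisker_exchange,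
        rightUnitor_inv_naturality_assoc]
    exact h)

theorem isEquivalence_coyoneda_mapFunctor (x y : Aᵒᵖ) :
    ((coyoneda A).mapFunctor x y).IsEquivalence := by
  let θ := yonedaTrans ((coyoneda A).obj x) (a := x.unop) (𝟙 x.unop)
  have := (isUniversalElement_coyoneda x).isEquiv_yonedaTrans.precomp_isEquivalence
    ((coyoneda A).obj y)
  have := isEquivalence_yonedaEval ((coyoneda A).obj y) x.unop
  have : ((coyoneda A).mapFunctor x y ⋙ precomp ((coyoneda A).obj y) θ ⋙
      yonedaEval ((coyoneda A).obj y) x.unop).IsEquivalence :=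
    @Functor.isEquivalence_of_iso _ _ _ _ _ _ (coyonedaMapCompEvalIso x y)
      (isEquivalence_unopFunctor x y)
  have := Functor.isEquivalence_trans (precomp ((coyoneda A).obj y) θ)
    (yonedaEval ((coyoneda A).obj y) x.unop)
  exact Functor.isEquivalence_of_comp_right ((coyoneda A).mapFunctor x y)
    (precomp ((coyoneda A).obj y) θ ⋙ yonedaEval ((coyoneda A).obj y) x.unop)

theorem IsEquiv.isUniversalArrow_coyoneda {F : A ⥤ᵖ Cat.{w₁, v₁}} {x : Aᵒᵖ}
    {θ : F ⟶ (coyoneda A).obj x} (hθ : IsEquiv θ) : IsUniversalArrow (coyoneda A) θ := by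
  intro z
  have := isEquivalence_coyoneda_mapFunctor x z
  have := hθ.precomp_isEquivalence ((coyoneda A).obj z)
  exact Functor.isEquivalence_trans ((coyoneda A).mapFunctor x z)
    (precomp ((coyoneda A).obj z) θ)

theorem IsUniversalElement.exists_isEquiv_coyoneda {F : A ⥤ᵖ Cat.{w₁, v₁}} {a : A} {u : F.obj a}
    (hu : IsUniversalElement F u) : ∃ θ : F ⟶ (coyoneda A).obj (op a), IsEquiv θ := by
  obtain ⟨e, -⟩ := hu.isEquiv_yonedaTrans
  obtain ⟨e₂, -⟩ := (isUniversalElement_coyoneda (op a)).isEquiv_yonedaTrans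
  exact ⟨e.inv ≫ e₂.hom, (isEquiv_inv e).comp (isEquiv_hom e₂)⟩

/-- A pseudofunctor `S → Aᵒᵖ` regarded as a pseudofunctor `Sᵒᵖ → A`. -/
def leftOp {S : Type u₂} [Bicategory.{w₂, v₂} S] (G : S ⥤ᵖ Aᵒᵖ) : Sᵒᵖ ⥤ᵖ A where
  obj s := (G.obj s.unop).unop
  map f := (G.map f.unop).unop
  map₂ η := (G.map₂ η.unop2).unop2
  map₂_id f := congrArg Hom2.unop2 (G.map₂_id f.unop)
  map₂_comp η θ := congrArg Hom2.unop2 (G.map₂_comp η.unop2 θ.unop2)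
  mapId s := (G.mapId s.unop).unop2
  mapComp f g := (G.mapComp g.unop f.unop).unop2
  map₂_whisker_left f _ _ η := congrArg Hom2.unop2 (G.map₂_whisker_right η.unop2 f.unop)
  map₂_whisker_right η h := congrArg Hom2.unop2 (G.map₂_whisker_left h.unop η.unop2)
  map₂_associator f g h := congrArg Hom2.unop2 (map₂_associator_inv G h.unop g.unop f.unop)
  map₂_left_unitor f := congrArg Hom2.unop2 (G.map₂_right_unitor f.unop)
  map₂_right_unitor f := congrArg Hom2.unop2 (G.map₂_left_unitor f.unop)

theorem rightOp_leftOp {S : Type u₂} [Bicategory.{w₂, v₂} S] (G : S ⥤ᵖ Aᵒᵖ) :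
    rightOp (leftOp G) = G := rfl

theorem exists_equivalence_homFrom {S : Type u₂} [Bicategory.{w₂, v₂} S]
    (D : S × A ⥤ᵖ Cat.{w₁, v₁}) (a : S → A) (u : ∀ s, ((curryRight D).obj s).obj (a s))
    (hu : ∀ s, IsUniversalElement ((curryRight D).obj s) (u s)) :
    ∃ E : Sᵒᵖ ⥤ᵖ A, Nonempty (Bicategory.Equivalence D (homFrom E)) := by
  choose η hη using fun s => (hu s).exists_isEquiv_coyoneda
  let G := universalFunctor (fun s => op (a s)) η fun s => (hη s).isUniversalArrow_coyoneda
  let θ := (ProdTrans.ofCurry (H := homPseudofunctor A) (G := G)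
    (universalUnit (fun s => op (a s)) η fun s => (hη s).isUniversalArrow_coyoneda)).toTrans
  have hθ : IsEquiv θ := isEquiv_of_pointwise θ fun x => (hη x.1).app x.2
  refine ⟨leftOp G, ?_⟩
  rw [homFrom, rightOp_leftOp]
  exact ⟨hθ.choose⟩

end Coyoneda

section Discrete
open CategoryTheory.Prod Bicategory.Opposite
variable {S : Type u₁} [Bicategory.{w₁, v₁} S] {A : Type u₂} [Bicategory.{w₂, v₂} A]
  {B : Type u₃} [Bicategory.{w₃, v₃} B]

/-- The comparison of `B(E x, R -)` with the slice at `x` of `B(-, R -) ∘ (E × 1)`, whose action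
on 1-cells also composes with `E 1`. -/
def corepCompTrans {X : Type u₄} [Bicategory.{w₄, v₄} X] (E : X ⥤ᵖ Bᵒᵖ) (R : A ⥤ᵖ B) (x : X) :
    PreTrans (R.comp (corep (E.obj x).unop))
      (sliceRight ((prodMap E (Pseudofunctor.id A)).comp (homTo R)) x) where
  app a := 𝟙 (Cat.of ((E.obj x).unop ⟶ R.obj a))
  naturality {a b} f := Cat.Hom.isoMk (NatIso.ofComponents
    (fun (h : (E.obj x).unop ⟶ R.obj a) => (λ_ (h ≫ R.map f)).symm ≪≫
      whiskerRightIso (E.mapId x).unop2.symm (h ≫ R.map f)) (by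
      intro (h : (E.obj x).unop ⟶ R.obj a) (k : (E.obj x).unop ⟶ R.obj a) γ
      have e : γ ▷ R.map f ≫ (λ_ (k ≫ R.map f)).inv ≫ (E.mapId x).inv.unop2 ▷ (k ≫ R.map f) =
          ((λ_ (h ≫ R.map f)).inv ≫ (E.mapId x).inv.unop2 ▷ (h ≫ R.map f)) ≫
            (E.map (𝟙 x)).unop ◁ γ ▷ R.map f := by
        rw [Category.assoc, ← whisker_exchange, leftUnitor_inv_naturality_assoc]
        rfl
      exact e))
  naturality_naturality {a b f g} γ := cat_hom₂_ext fun (h : (E.obj x).unop ⟶ R.obj a) => by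
    have e : h ◁ R.map₂ γ ≫ (λ_ (h ≫ R.map g)).inv ≫
        (E.mapId x).inv.unop2 ▷ (h ≫ R.map g) =
      ((λ_ (h ≫ R.map f)).inv ≫ (E.mapId x).inv.unop2 ▷ (h ≫ R.map f)) ≫
        (E.map₂ (𝟙 (𝟙 x))).unop2 ▷ (h ≫ R.map f) ≫ (E.map (𝟙 x)).unop ◁ h ◁ R.map₂ γ := by
      rw [E.map₂_id, unop2_id, id_whiskerRight, Category.id_comp, Category.assoc,
        ← whisker_exchange, leftUnitor_inv_naturality_assoc]
      rfl
    exact e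

/-- The comparison of the slices at `s` of `D` and of its restriction to the discrete 2-category
on the objects of `S`, which agree on the nose. -/
def restrictDiscreteTrans {K : Type u₄} [Bicategory.{w₄, v₄} K] (D : S × A ⥤ᵖ K) (s : S) :
    PreTrans (sliceRight (restrictDiscrete D) ⟨⟨s⟩⟩) ((curryRight D).obj s) where
  app a := 𝟙 (D.obj (s, a))
  naturality f := ρ_ (D.map (𝟙 s ×ₘ f)) ≪≫ (λ_ (D.map (𝟙 s ×ₘ f))).symm
  naturality_naturality {a b f g} γ := by
    let γ' : (𝟙 s ×ₘ f) ⟶ (𝟙 s ×ₘ g) := (𝟙 (𝟙 s), γ)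
    have h : D.map₂ γ' ▷ 𝟙 (D.obj (s, b)) ≫
        (ρ_ (D.map (𝟙 s ×ₘ g))).hom ≫ (λ_ (D.map (𝟙 s ×ₘ g))).inv =
      ((ρ_ (D.map (𝟙 s ×ₘ f))).hom ≫ (λ_ (D.map (𝟙 s ×ₘ f))).inv) ≫
        𝟙 (D.obj (s, a)) ◁ D.map₂ γ' := by simp
    exact h

theorem FactorsThrough.exists_isUniversalElement {D : S × A ⥤ᵖ Cat.{w₃, v₃}} {R : A ⥤ᵖ B}
    (hD : FactorsThrough D R) (hR : IsRightBiadjoint R) (s : S) :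
    ∃ (a : A) (u : ((curryRight D).obj s).obj a), IsUniversalElement ((curryRight D).obj s) u := by
  obtain ⟨D', ⟨e⟩⟩ := hD
  obtain ⟨E, ⟨h⟩⟩ := hR
  have corep_univ := (isUniversalElement_comp_corep_iff _).2
    (h.isUniversalArrow (D'.obj ⟨⟨s⟩⟩).unop)
  have slice_univ := corep_univ.map (corepCompTrans D' R ⟨⟨s⟩⟩) fun b => isEquiv_id _
  have restrict_univ := slice_univ.map (.ofTrans (preWhisker (Bicategory.Prod.sectR
    (⟨⟨s⟩⟩ : LocallyDiscrete (Discrete S)) A).toPseudofunctor e.inv))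
    fun b => (isEquiv_inv e).app (⟨⟨s⟩⟩, b)
  exact ⟨_, _, restrict_univ.map (restrictDiscreteTrans D s) fun b => isEquiv_id _⟩

end Discrete

end BiLift

theorem mainTheorem2_general
    {S : Type v} [Bicategory.{v, v} S]
    {A : Type u₁} [Bicategory.{v, v} A]
    {C : Type u₃} [Bicategory.{v, v} C]
    (W : S ⥤ᵖ Cat.{v, v})
    (J : A ⥤ᵖ C)
    (D : C → (S × A ⥤ᵖ Cat.{v, v}))
    (hD : ∀ (y : C) (s : S), ∃ (a : A) (u : ((BiLift.curryRight (D y)).obj s).obj a),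
      BiLift.IsUniversalElement ((BiLift.curryRight (D y)).obj s) u)
    (hW : ∀ y : C, BiLift.IsWeightedBilimitFamily W (D y) (J.comp (BiLift.corep y))) :
    (∀ y : C, ∃ 𝒜 : Sᵒᵖ ⥤ᵖ A,
      Nonempty (Bicategory.Equivalence (D y) (BiLift.homFrom 𝒜))) ∧
    ∀ 𝒜 : C → (Sᵒᵖ ⥤ᵖ A),
      (∀ y : C, Nonempty (Bicategory.Equivalence (D y) (BiLift.homFrom (𝒜 y)))) →
      (BiLift.IsRightBiadjoint J ↔
        ∀ y : C, ∃ G : A, BiLift.IsWeightedBicolimit W (𝒜 y) G) ∧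
      ∀ G : C → A, (∀ y : C, BiLift.IsWeightedBicolimit W (𝒜 y) (G y)) →
        ∃ L : C ⥤ᵖ A, (∀ y : C, L.obj y = G y) ∧ Nonempty (BiLift.Biadjunction L J) := by
  refine ⟨fun y => ?_, fun 𝒜 h𝒜 => ?_⟩
  · choose a u hu using hD y
    exact BiLift.exists_equivalence_homFrom (D y) a u hu
  have arrow_iff_bicolimit (y : C) (a : A) :
      (∃ u : y ⟶ J.obj a, BiLift.IsUniversalArrow J u) ↔ BiLift.IsWeightedBicolimit W (𝒜 y) a :=
    BiLift.exists_isUniversalElement_iff_isWeightedBicolimit (hW y) (h𝒜 y).some a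
  have biadjoint_of_bicolimits (G : C → A)
      (hG : ∀ y : C, BiLift.IsWeightedBicolimit W (𝒜 y) (G y)) :
      ∃ L : C ⥤ᵖ A, (∀ y : C, L.obj y = G y) ∧ Nonempty (BiLift.Biadjunction L J) := by
    choose u hu using fun y => (arrow_iff_bicolimit y (G y)).2 (hG y)
    exact BiLift.exists_biadjunction G u hu
  refine ⟨⟨fun ⟨L, ⟨h⟩⟩ y => ⟨L.obj y, (arrow_iff_bicolimit y _).1 ⟨_, h.isUniversalArrow y⟩⟩,
    fun h => ?_⟩, biadjoint_of_bicolimits⟩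
  choose G hG using h
  obtain ⟨L, -, h⟩ := biadjoint_of_bicolimits G hG
  exact ⟨L, h⟩

theorem mainTheorem2
    {S : Type v} [Bicategory.{v, v} S] [Bicategory.Strict S]
    {A : Type u₁} [Bicategory.{v, v} A] [Bicategory.Strict A]
    {B : Type u₂} [Bicategory.{v, v} B] [Bicategory.Strict B]
    {C : Type u₃} [Bicategory.{v, v} C] [Bicategory.Strict C]
    (W : S ⥤ᵖ Cat.{v, v})
    (R : A ⥤ᵖ B) (hR : BiLift.IsRightBiadjoint R)
    (J : A ⥤ᵖ C)
    (D : C → (S × A ⥤ᵖ Cat.{v, v}))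
    (hD : ∀ y : C, BiLift.FactorsThrough (D y) R)
    (hW : ∀ y : C, BiLift.IsWeightedBilimitFamily W (D y) (J.comp (BiLift.corep y))) :
    (∀ y : C, ∃ 𝒜 : Sᵒᵖ ⥤ᵖ A,
      Nonempty (Bicategory.Equivalence (D y) (BiLift.homFrom 𝒜))) ∧
    ∀ 𝒜 : C → (Sᵒᵖ ⥤ᵖ A),
      (∀ y : C, Nonempty (Bicategory.Equivalence (D y) (BiLift.homFrom (𝒜 y)))) →
      (BiLift.IsRightBiadjoint J ↔
        ∀ y : C, ∃ G : A, BiLift.IsWeightedBicolimit W (𝒜 y) G) ∧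
      ∀ G : C → A, (∀ y : C, BiLift.IsWeightedBicolimit W (𝒜 y) (G y)) →
        ∃ L : C ⥤ᵖ A, (∀ y : C, L.obj y = G y) ∧ Nonempty (BiLift.Biadjunction L J) :=
  mainTheorem2_general W J D (fun y => (hD y).exists_isUniversalElement hR) hW
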